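/- Let $X$ be a complex Banach space and $A:D(A)\subset X\to X$ a closed, densely defined linear operator. For $\theta\in(0,\pi/2]$ put $\Sigma_\theta=\{\lambda\in\mathbb C\setminus\{0\}:|\arg\lambda|<\pi/2+\theta\}$. Assume that $A$ is sectorial: for some $\theta_0\in(0,\pi/2]$ and $C>0$ the resolvent $R(\lambda,A)=(\lambda-A)^{-1}$ exists and is analytic on $\Sigma_{\theta_0}$, with $\|R(\lambda,A)\|\le C/|\lambda|$ there. Let $\alpha\in(0,1)$, $T>0$, and $\theta_1=\min\{\frac{\pi(1-\alpha)+2\theta_0}{2\alpha},\frac{\pi}{2}\}$. Let $g\in C^1([0,T),D(A))$, where $D(A)$ carries the graph norm, and consider $$\partial_t^\alpha u(t)=Au(t)+g(t)\quad\text{for } t\in(0,T),\qquad u(0)=0,$$ with Caputo's derivative $\partial_t^\alpha u(t)=\frac{1}{\Gamma(1-\alpha)}\int_0^t(t-\tau)^{-\alpha}u'(\tau)\,d\tau$. Write $\Phi_{1-\alpha}(t)=t^{-\alpha}/\Gamma(1-\alpha)$ for $t>0$. A strong solution is a function $u\in C([0,T),X)$ with $u(0)=0$, $u\in C((0,T),D(A))$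 and $\Phi_{1-\alpha}*u\in C^1((0,T),X)$, differentiable on $(0,T)$ with $\tau\mapsto(t-\tau)^{-\alpha}u'(\tau)$ integrable on $(0,t)$ for every $t\in(0,T)$, that satisfies the equation on $(0,T)$. Let $\Gamma$ be a piecewise $C^1$ contour in $\Sigma_{\theta_1}$, both of whose ends go to infinity with tangent directions making acute (positive) angles with the negative real half-axis in the limit, and which is oriented counter-clockwise, i.e. from the lower to the upper end (such contours exist). For $t>0$ let $$P_\alpha(t)=\frac{1}{2\pi i}\int_\Gamma e^{\lambda t}R(\lambda^\alpha,A)\,d\lambda .$$ Then this integral converges absolutely for every $t>0$, and $P_\alpha$ is the inverse Laplace transform of $R(\lambda^\alpha,A)$: for $\operatorname{Re}\lambda>0$ the integral $\int_0^\infty e^{-\lambda t}P_\alpha(t)\,dt$ converges absolutely and equals $R(\lambda^\alpha,A)$. The equation has exactly one strong solution on $[0,T)$, namely $$u(t)=(P_\alpha*g)(t)=\int_0^tP_\alpha(t-\tau)g(\tau)\,d\tau,\qquad t\in[0,T),$$ where the integral converges. Moreover $u\in C([0,T),D(A))$ and $\Phi_{1-\alpha}*u\in C^1([0,T),X)$,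 and uniqueness also holds among the functions $u\in C([0,T),X)$ with $u(0)=0$, $u\in C((0,T),D(A))$ and $\Phi_{1-\alpha}*u\in C^1((0,T),X)$ that satisfy the equation with $\partial_t^\alpha u$ read as $\frac{d}{dt}(\Phi_{1-\alpha}*u)$. -/

import Mathlib

open MeasureTheory Set Filter Topology

namespace FracEvol

noncomputable section

/-- The open sector of all `z ≠ 0` with `|arg z| < π / 2 + θ`. -/
def sector (θ : ℝ) : Set ℂ :=
  {z : ℂ | z ≠ 0 ∧ |z.arg| < Real.pi / 2 + θ}

/-- The angle `θ₁ = min {(π (1 - α) + 2 θ₀) / (2 α), π / 2}`. -/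
def angleOne (α θ₀ : ℝ) : ℝ :=
  min ((Real.pi * (1 - α) + 2 * θ₀) / (2 * α)) (Real.pi / 2)

/-- `Φ_β(t) = t ^ (β - 1) / Γ(β)` for `t > 0`, and `0` for `t ≤ 0`. -/
def Phi (β t : ℝ) : ℝ :=
  if 0 < t then t ^ (β - 1) / Real.Gamma β else 0

section Banach

variable {X : Type*} [NormedAddCommGroup X] [NormedSpace ℂ X]

open Classical in
/-- The value `A x` for `x ∈ D(A)`. The value `0` outside `D(A)` is a convention only; membership
in the domain is always required separately. -/
def opApply (A : X →ₗ.[ℂ] X) (x : X) : X :=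
  if h : x ∈ A.domain then A ⟨x, h⟩ else 0

/-- The bounded operator `R` is a two-sided inverse of `z - A : D(A) → X`. -/
def IsResolventAt (A : X →ₗ.[ℂ] X) (z : ℂ) (R : X →L[ℂ] X) : Prop :=
  (∀ x : X, R x ∈ A.domain ∧ z • R x - opApply A (R x) = x) ∧
    ∀ x ∈ A.domain, R (z • x - opApply A x) = x

/-- The resolvent set of `A`. -/
def resolventSet (A : X →ₗ.[ℂ] X) : Set ℂ :=
  {z : ℂ | ∃ R : X →L[ℂ] X, IsResolventAt A z R}

open Classical in
/-- The resolvent `(z - A)⁻¹`, for `z` in the resolvent set (`0` elsewhere). -/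
def res (A : X →ₗ.[ℂ] X) (z : ℂ) : X →L[ℂ] X :=
  if h : ∃ R : X →L[ℂ] X, IsResolventAt A z R then h.choose else 0

/-- `A` is sectorial with angle `θ₀`: its resolvent exists and is analytic in the sector, and it is
bounded there by `C / |z|`. -/
structure IsSectorial (A : X →ₗ.[ℂ] X) (θ₀ : ℝ) : Prop where
  angle_pos : 0 < θ₀
  angle_le : θ₀ ≤ Real.pi / 2
  subset_resolventSet : sector θ₀ ⊆ resolventSet A
  analytic : DifferentiableOn ℂ (res A) (sector θ₀)
  bound : ∃ C : ℝ, 0 < C ∧ ∀ z ∈ sector θ₀, ‖res A z‖ ≤ C / ‖z‖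

/-- `f ∈ C(J, D(A))`, where `D(A)` carries the graph norm: the pair `(f, A f)` is continuous. -/
def ContinuousOnDomain (A : X →ₗ.[ℂ] X) (f : ℝ → X) (J : Set ℝ) : Prop :=
  (∀ t ∈ J, f t ∈ A.domain) ∧ ContinuousOn (fun t => (f t, opApply A (f t))) J

/-- `f ∈ C¹(J, D(A))`, where `D(A)` carries the graph norm: the pair `(f, A f)` is `C¹`
(with one-sided derivatives at an endpoint that belongs to the interval `J`). -/
def C1OnDomain (A : X →ₗ.[ℂ] X) (f : ℝ → X) (J : Set ℝ) : Prop :=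
  (∀ t ∈ J, f t ∈ A.domain) ∧ ContDiffOn ℝ 1 (fun t => (f t, opApply A (f t))) J

/-- The convolution `(Φ_β * f)(t)` over `(0, t)`. -/
def phiConv (β : ℝ) (f : ℝ → X) (t : ℝ) : X :=
  ∫ s in (0 : ℝ)..t, Phi β (t - s) • f s

/-- Caputo's derivative `(1 / Γ(1 - α)) ∫₀ᵗ (t - s) ^ (-α) u'(s) ds`. -/
def caputoDeriv (α : ℝ) (u : ℝ → X) (t : ℝ) : X :=
  (1 / Real.Gamma (1 - α)) • ∫ s in (0 : ℝ)..t, (t - s) ^ (-α) • deriv u s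

/-- The regularity asked of a strong solution on a time interval `J`, which is `(0, T)` or `[0, T)`:
`u` is continuous on `J ∪ {0}` with `u(0) = u₀`, `u ∈ C(J, D(A))`,
and `Φ_{1-α} * (u - u₀) ∈ C¹(J, X)`. -/
structure HasStrongRegularity (A : X →ₗ.[ℂ] X) (α : ℝ) (J : Set ℝ) (u₀ : X) (u : ℝ → X) :
    Prop where
  initial : u 0 = u₀
  continuousOn : ContinuousOn u (insert 0 J)
  domain : ContinuousOnDomain A u J
  conv_c1 : ContDiffOn ℝ 1 (phiConv (1 - α) fun s => u s - u₀) J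

/-- A strong solution of `∂_t^α u = A u + g` on `(0, T)` with `u(0) = u₀`. The two fields before the
equation say that the integral that defines Caputo's derivative makes sense. -/
structure IsStrongSolution (A : X →ₗ.[ℂ] X) (α T : ℝ) (u₀ : X) (g u : ℝ → X) : Prop where
  regularity : HasStrongRegularity A α (Ioo 0 T) u₀ u
  differentiable : ∀ t ∈ Ioo (0 : ℝ) T, DifferentiableAt ℝ u t
  integrable : ∀ t ∈ Ioo (0 : ℝ) T,
    IntervalIntegrable (fun s => (t - s) ^ (-α) • deriv u s) volume 0 t
  equation : ∀ t ∈ Ioo (0 : ℝ) T, caputoDeriv α u t = opApply A (u t) + g t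

/-- The same notion with Caputo's derivative read in its regularized form
`d/dt (Φ_{1-α} * (u - u₀))`, which needs no derivative of `u` itself. -/
structure IsRegularizedStrongSolution (A : X →ₗ.[ℂ] X) (α T : ℝ) (u₀ : X) (g u : ℝ → X) :
    Prop where
  regularity : HasStrongRegularity A α (Ioo 0 T) u₀ u
  equation : ∀ t ∈ Ioo (0 : ℝ) T,
    deriv (phiConv (1 - α) fun s => u s - u₀) t = opApply A (u t) + g t

/-- `γ` parametrizes a contour in the sector of angle `θ`: it is continuous and piecewise `C¹` with
locally integrable derivative, it stays in the sector, and it goes to infinity at both ends, its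
tangent direction there making an acute angle (`ψ₁` below, `ψ₂` above) with the negative
real half-axis. It is run through counter-clockwise, that is, from the lower end to the upper. -/
structure IsContour (θ : ℝ) (γ : ℝ → ℂ) : Prop where
  continuous : Continuous γ
  piecewise_c1 : ∃ S : Finset ℝ, (∀ x ∉ S, DifferentiableAt ℝ γ x) ∧
    ContinuousOn (deriv γ) (S : Set ℝ)ᶜ
  locallyIntegrable : LocallyIntegrable (deriv γ) volume
  mem_sector : ∀ x, γ x ∈ sector θ
  lower_end : Tendsto (fun x => ‖γ x‖) atBot atTop
  upper_end : Tendsto (fun x => ‖γ x‖) atTop atTop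
  lower_angle : ∃ ψ₁ : ℝ, 0 < ψ₁ ∧ ψ₁ < Real.pi / 2 ∧
    Tendsto (fun x => deriv γ x / (‖deriv γ x‖ : ℂ)) atBot
      (𝓝 (-Complex.exp (-((Real.pi - ψ₁ : ℝ) : ℂ) * Complex.I)))
  upper_angle : ∃ ψ₂ : ℝ, 0 < ψ₂ ∧ ψ₂ < Real.pi / 2 ∧
    Tendsto (fun x => deriv γ x / (‖deriv γ x‖ : ℂ)) atTop
      (𝓝 (Complex.exp (((Real.pi - ψ₂ : ℝ) : ℂ) * Complex.I)))

/-- The integrand `e^{z t} (z^α - A)⁻¹ dz` along `z = γ(x)`; the power is the principal one. -/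
def contourIntegrand (A : X →ₗ.[ℂ] X) (α : ℝ) (γ : ℝ → ℂ) (t x : ℝ) : X →L[ℂ] X :=
  (Complex.exp (γ x * (t : ℂ)) * deriv γ x) • res A (γ x ^ (α : ℂ))

/-- `P_α(t) = (1 / (2 π i)) ∫_γ e^{z t} (z^α - A)⁻¹ dz`. -/
def opP (A : X →ₗ.[ℂ] X) (α : ℝ) (γ : ℝ → ℂ) (t : ℝ) : X →L[ℂ] X :=
  (1 / (2 * (Real.pi : ℂ) * Complex.I)) • ∫ x : ℝ, contourIntegrand A α γ t x

/-- The convolution `(P_α * g)(t) = ∫₀ᵗ P_α(t - s) g(s) ds`. -/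
def convP (A : X →ₗ.[ℂ] X) (α : ℝ) (γ : ℝ → ℂ) (g : ℝ → X) (t : ℝ) : X :=
  ∫ s in (0 : ℝ)..t, opP A α γ (t - s) (g s)

end Banach

end

end FracEvol

namespace FracEvol

noncomputable section

theorem mem_sector_iff {θ : ℝ} (h₀ : 0 < θ) (h₁ : θ ≤ Real.pi / 2) (z : ℂ) :
    z ∈ sector θ ↔ 0 < z.re ∨ 0 < z.re * Real.cos θ + |z.im| * Real.sin θ := by
  have hc : 0 ≤ Real.cos θ := Real.cos_nonneg_of_mem_Icc ⟨by linarith, h₁⟩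
  rcases eq_or_ne z 0 with rfl | hz
  · simp [sector]
  have hn : 0 < ‖z‖ := norm_pos_iff.2 hz
  have hpi := Real.pi_pos
  have hre : z.re = ‖z‖ * Real.cos |z.arg| := by
    rw [Real.cos_abs, Complex.norm_mul_cos_arg]
  have him : |z.im| = ‖z‖ * Real.sin |z.arg| := by
    rw [← Real.abs_sin_eq_sin_abs_of_abs_le_pi (Complex.abs_arg_le_pi z),
      ← Complex.norm_mul_sin_arg z, abs_mul, abs_norm]
  have hsum : z.re * Real.cos θ + |z.im| * Real.sin θ = ‖z‖ * Real.cos (|z.arg| - θ) := by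
    rw [hre, him, Real.cos_sub]; ring
  have hle := Complex.abs_arg_le_pi z
  have h0 := abs_nonneg z.arg
  rw [hsum, hre]
  constructor
  · rintro ⟨-, h⟩
    rcases eq_or_lt_of_le h0 with h' | h'
    · left; rw [← h']; simpa using hn
    · right
      exact mul_pos hn (Real.cos_pos_of_mem_Ioo ⟨by linarith, by linarith⟩)
  · rintro (h | h)
    · refine ⟨hz, ?_⟩
      by_contra! hcon
      have := Real.cos_nonpos_of_pi_div_two_le_of_le (x := |z.arg|) (by linarith) (by linarith)
      nlinarith
    · refine ⟨hz, ?_⟩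
      by_contra! hcon
      have := Real.cos_nonpos_of_pi_div_two_le_of_le (x := |z.arg| - θ) (by linarith)
        (by linarith)
      nlinarith

theorem isOpen_sector {θ : ℝ} (h₀ : 0 < θ) (h₁ : θ ≤ Real.pi / 2) : IsOpen (sector θ) := by
  have : sector θ = {z : ℂ | 0 < z.re} ∪ {z : ℂ | 0 < z.re * Real.cos θ + |z.im| * Real.sin θ} := by
    ext z; exact mem_sector_iff h₀ h₁ z
  rw [this]
  refine (isOpen_lt continuous_const Complex.continuous_re).union
    (isOpen_lt continuous_const ?_)
  fun_prop

theorem sector_subset_slitPlane {θ : ℝ} (h₁ : θ ≤ Real.pi / 2) :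
    sector θ ⊆ Complex.slitPlane := by
  rintro z ⟨hz, h⟩
  rw [Complex.mem_slitPlane_iff_arg]
  refine ⟨fun h' => ?_, hz⟩
  rw [h', abs_of_pos Real.pi_pos] at h
  linarith

theorem ofReal_mul_mem_sector {θ r : ℝ} (hr : 0 < r) {z : ℂ} (hz : z ∈ sector θ) :
    (r : ℂ) * z ∈ sector θ := by
  refine ⟨mul_ne_zero (by exact_mod_cast hr.ne') hz.1, ?_⟩
  rw [Complex.arg_real_mul _ hr]
  exact hz.2

theorem mem_sector_of_re_pos {θ : ℝ} (h₀ : 0 < θ) {z : ℂ} (hz : 0 < z.re) : z ∈ sector θ := by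
  refine ⟨fun h => by simp [h] at hz, ?_⟩
  have := Complex.abs_arg_lt_pi_div_two_iff.2 (Or.inl hz)
  linarith

theorem polar_mem_sector {θ r φ : ℝ} (h₁ : θ ≤ Real.pi / 2) (hr : 0 < r)
    (hφ : |φ| < Real.pi / 2 + θ) : (r : ℂ) * Complex.exp (φ * Complex.I) ∈ sector θ := by
  refine ofReal_mul_mem_sector hr ⟨Complex.exp_ne_zero _, ?_⟩
  rw [abs_lt] at hφ
  rw [Complex.arg_exp_mul_I, (toIocMod_eq_self _).2 ⟨by linarith, by linarith⟩, abs_lt]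
  exact hφ

theorem conj_mem_sector {θ : ℝ} (h₁ : θ ≤ Real.pi / 2) {z : ℂ} (hz : z ∈ sector θ) :
    (starRingEnd ℂ) z ∈ sector θ := by
  have h := (Complex.mem_slitPlane_iff_arg.1 (sector_subset_slitPlane h₁ hz)).1
  refine ⟨by simpa using hz.1, ?_⟩
  rw [Complex.arg_conj, if_neg h, abs_neg]
  exact hz.2

theorem angleOne_pos {α θ₀ : ℝ} (hα₀ : 0 < α) (hα₁ : α < 1) (h₀ : 0 < θ₀) :
    0 < angleOne α θ₀ := by
  have := Real.pi_pos
  refine lt_min (div_pos ?_ (by linarith)) (by linarith)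
  nlinarith

theorem angleOne_le (α θ₀ : ℝ) : angleOne α θ₀ ≤ Real.pi / 2 := min_le_right _ _

theorem cpow_mem_sector {α θ₀ : ℝ} (hα₀ : 0 < α) (h₁ : θ₀ ≤ Real.pi / 2) {z : ℂ}
    (hz : z ∈ sector (angleOne α θ₀)) : z ^ (α : ℂ) ∈ sector θ₀ := by
  have hle : angleOne α θ₀ ≤ (Real.pi * (1 - α) + 2 * θ₀) / (2 * α) := min_le_left _ _
  rw [le_div_iff₀ (by linarith)] at hle
  have hα : α * |z.arg| < Real.pi / 2 + θ₀ := by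
    have := mul_lt_mul_of_pos_left hz.2 hα₀
    nlinarith
  rw [Complex.cpow_ofReal z α]
  refine ofReal_mul_mem_sector (Real.rpow_pos_of_pos (norm_pos_iff.2 hz.1) _) ?_
  have := polar_mem_sector (r := 1) (φ := z.arg * α) h₁ one_pos
    (by rw [abs_mul, abs_of_pos hα₀, mul_comm]; exact hα)
  rw [Complex.exp_mul_I] at this
  simpa using this

/-- Primitives exist on a sector. -/
theorem exists_primitive_sector {E : Type*} [NormedAddCommGroup E] [NormedSpace ℂ E]
    [CompleteSpace E] {θ : ℝ} (h₁ : θ ≤ Real.pi / 2) {F : ℂ → E}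
    (hF : DifferentiableOn ℂ F (sector θ)) :
    ∃ G : ℂ → E, ∀ z ∈ sector θ, HasDerivAt G (F z) z := by
  set s : Set ℂ := Complex.im ⁻¹' Ioo (-(Real.pi / 2 + θ)) (Real.pi / 2 + θ) with hs
  have hconv : Convex ℝ s := (convex_Ioo _ _).is_linear_preimage Complex.imLm.isLinear
  have hopen : IsOpen s := isOpen_Ioo.preimage Complex.continuous_im
  have hexp : ∀ w ∈ s, Complex.exp w ∈ sector θ := by
    intro w hw
    have := polar_mem_sector h₁ (Real.exp_pos w.re) (φ := w.im) (abs_lt.2 hw)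
    rwa [Complex.ofReal_exp, ← Complex.exp_add, Complex.re_add_im] at this
  have hd : DifferentiableOn ℂ (fun w => Complex.exp w • F (Complex.exp w)) s :=
    Complex.differentiable_exp.differentiableOn.smul
      (hF.comp Complex.differentiable_exp.differentiableOn hexp)
  obtain ⟨g, hg⟩ := hconv.exists_forall_hasDerivWithinAt hd
  refine ⟨fun z => g (Complex.log z), fun z hz => ?_⟩
  have hl : Complex.log z ∈ s := by
    simp only [hs, mem_preimage, Complex.log_im]
    exact abs_lt.1 hz.2
  have h := ((hg _ hl).hasDerivAt (hopen.mem_nhds hl)).scomp z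
    (Complex.hasDerivAt_log (sector_subset_slitPlane h₁ hz))
  rw [Complex.exp_log hz.1, smul_smul, inv_mul_cancel₀ hz.1, one_smul] at h
  exact h

/-- The contour consisting of two rays that start at `ε` and leave to infinity at the angles
`± (π / 2 + θ / 2)`. -/
def wedge (θ ε x : ℝ) : ℂ :=
  ⟨ε - Real.sin (θ / 2) * |x|, Real.cos (θ / 2) * x⟩

section Wedge

variable {θ ε : ℝ}

theorem sin_half_pos (h₀ : 0 < θ) (h₁ : θ ≤ Real.pi / 2) : 0 < Real.sin (θ / 2) :=
  Real.sin_pos_of_pos_of_lt_pi (by linarith) (by linarith [Real.pi_pos])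

theorem cos_half_pos (h₀ : 0 < θ) (h₁ : θ ≤ Real.pi / 2) : 0 < Real.cos (θ / 2) :=
  Real.cos_pos_of_mem_Ioo ⟨by linarith [Real.pi_pos], by linarith [Real.pi_pos]⟩

theorem continuous_wedge : Continuous (wedge θ ε) := by
  have : wedge θ ε = fun x : ℝ => ((ε - Real.sin (θ / 2) * |x| : ℝ) : ℂ) +
      ((Real.cos (θ / 2) * x : ℝ) : ℂ) * Complex.I := by
    ext x; exact (Complex.mk_eq_add_mul_I _ _)
  rw [this]
  fun_prop

theorem wedge_mem_sector (h₀ : 0 < θ) (h₁ : θ ≤ Real.pi / 2) (hε : 0 < ε) (x : ℝ) :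
    wedge θ ε x ∈ sector θ := by
  rw [mem_sector_iff h₀ h₁]
  have hs := sin_half_pos h₀ h₁
  have hc := cos_half_pos h₀ h₁
  rcases eq_or_ne x 0 with rfl | hx
  · left; simpa [wedge] using hε
  · right
    have h : Real.sin (θ / 2) = Real.sin θ * Real.cos (θ / 2) - Real.cos θ * Real.sin (θ / 2) := by
      rw [← Real.sin_sub]; congr 1; ring
    have hcos : 0 ≤ Real.cos θ := Real.cos_nonneg_of_mem_Icc ⟨by linarith, h₁⟩
    have : (wedge θ ε x).re * Real.cos θ + |(wedge θ ε x).im| * Real.sin θ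
        = ε * Real.cos θ + |x| * Real.sin (θ / 2) := by
      simp only [wedge, abs_mul, abs_of_pos hc]
      linear_combination |x| * (-h)
    rw [this]
    have := mul_pos (abs_pos.2 hx) hs
    positivity

theorem hasDerivAt_wedge_of_pos {x : ℝ} (hx : 0 < x) :
    HasDerivAt (wedge θ ε) ⟨-Real.sin (θ / 2), Real.cos (θ / 2)⟩ x := by
  have h : HasDerivAt (fun y : ℝ => (ε : ℂ) + (y : ℂ) * ⟨-Real.sin (θ / 2), Real.cos (θ / 2)⟩)
      (1 * ⟨-Real.sin (θ / 2), Real.cos (θ / 2)⟩) x :=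
    ((Complex.ofRealCLM.hasDerivAt (x := x)).mul_const _).const_add _
  rw [one_mul] at h
  refine h.congr_of_eventuallyEq ?_
  filter_upwards [lt_mem_nhds hx] with y hy
  apply Complex.ext <;> simp [wedge, abs_of_pos hy] <;> ring

theorem hasDerivAt_wedge_of_neg {x : ℝ} (hx : x < 0) :
    HasDerivAt (wedge θ ε) ⟨Real.sin (θ / 2), Real.cos (θ / 2)⟩ x := by
  have h : HasDerivAt (fun y : ℝ => (ε : ℂ) + (y : ℂ) * ⟨Real.sin (θ / 2), Real.cos (θ / 2)⟩)
      (1 * ⟨Real.sin (θ / 2), Real.cos (θ / 2)⟩) x :=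
    ((Complex.ofRealCLM.hasDerivAt (x := x)).mul_const _).const_add _
  rw [one_mul] at h
  refine h.congr_of_eventuallyEq ?_
  filter_upwards [gt_mem_nhds hx] with y hy
  apply Complex.ext <;> simp [wedge, abs_of_neg hy] <;> ring

theorem norm_mk_sin_cos (φ : ℝ) : ‖(⟨Real.sin φ, Real.cos φ⟩ : ℂ)‖ = 1 := by
  rw [Complex.norm_eq_sqrt_sq_add_sq]; simp

theorem norm_mk_neg_sin_cos (φ : ℝ) : ‖(⟨-Real.sin φ, Real.cos φ⟩ : ℂ)‖ = 1 := by
  rw [Complex.norm_eq_sqrt_sq_add_sq]; simp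

theorem norm_deriv_wedge {x : ℝ} (hx : x ≠ 0) : ‖deriv (wedge θ ε) x‖ = 1 := by
  rcases lt_or_gt_of_ne hx with hx | hx
  · rw [(hasDerivAt_wedge_of_neg hx).deriv, norm_mk_sin_cos]
  · rw [(hasDerivAt_wedge_of_pos hx).deriv, norm_mk_neg_sin_cos]

theorem sin_half_lt_one (h₀ : 0 < θ) (h₁ : θ ≤ Real.pi / 2) : Real.sin (θ / 2) < 1 := by
  have := cos_half_pos h₀ h₁
  nlinarith [Real.sin_sq_add_cos_sq (θ / 2)]

theorem le_norm_wedge_sq (h₀ : 0 < θ) (h₁ : θ ≤ Real.pi / 2) (x : ℝ) :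
    (1 - Real.sin (θ / 2)) * (ε ^ 2 + x ^ 2) ≤ ‖wedge θ ε x‖ ^ 2 := by
  have hs := sin_half_pos h₀ h₁
  rw [← Complex.normSq_eq_norm_sq, Complex.normSq_apply, wedge]
  have h1 := Real.sin_sq_add_cos_sq (θ / 2)
  have h2 : |x| ^ 2 = x ^ 2 := sq_abs x
  have h3 := mul_nonneg hs.le (sq_nonneg (ε - |x|))
  have : (ε - Real.sin (θ / 2) * |x|) * (ε - Real.sin (θ / 2) * |x|) +
      Real.cos (θ / 2) * x * (Real.cos (θ / 2) * x)
      = ε ^ 2 + x ^ 2 - 2 * Real.sin (θ / 2) * ε * |x| := by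
    linear_combination (Real.sin (θ / 2)) ^ 2 * h2 + x ^ 2 * h1
  simp only
  rw [this]
  nlinarith

theorem tendsto_norm_wedge (h₀ : 0 < θ) (h₁ : θ ≤ Real.pi / 2) :
    Tendsto (fun x => ‖wedge θ ε x‖) atTop atTop ∧
      Tendsto (fun x => ‖wedge θ ε x‖) atBot atTop := by
  have hc := cos_half_pos h₀ h₁
  have hle : ∀ x, Real.cos (θ / 2) * |x| ≤ ‖wedge θ ε x‖ := fun x => by
    refine le_trans (le_of_eq ?_) (Complex.abs_im_le_norm _)
    simp [wedge, abs_mul, abs_of_pos hc]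
  exact ⟨tendsto_atTop_mono hle (tendsto_abs_atTop_atTop.const_mul_atTop hc),
    tendsto_atTop_mono hle (tendsto_abs_atBot_atTop.const_mul_atTop hc)⟩

theorem isContour_wedge (h₀ : 0 < θ) (h₁ : θ ≤ Real.pi / 2) (hε : 0 < ε) :
    IsContour θ (wedge θ ε) := by
  have hpi := Real.pi_pos
  refine ⟨continuous_wedge, ⟨{0}, fun x hx => ?_, fun x hx => ?_⟩, ?_, wedge_mem_sector h₀ h₁ hε,
    (tendsto_norm_wedge h₀ h₁).2, (tendsto_norm_wedge h₀ h₁).1,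
    ⟨Real.pi / 2 - θ / 2, by linarith, by linarith, ?_⟩,
    ⟨Real.pi / 2 - θ / 2, by linarith, by linarith, ?_⟩⟩
  · rcases lt_or_gt_of_ne (show x ≠ 0 by simpa using hx) with hx | hx
    · exact (hasDerivAt_wedge_of_neg hx).differentiableAt
    · exact (hasDerivAt_wedge_of_pos hx).differentiableAt
  · refine ContinuousAt.continuousWithinAt ?_
    rcases lt_or_gt_of_ne (show x ≠ 0 by simpa using hx) with hx | hx
    · refine (continuousAt_const (y := (⟨Real.sin (θ / 2), Real.cos (θ / 2)⟩ : ℂ))).congr ?_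
      filter_upwards [gt_mem_nhds hx] with y hy
      exact (hasDerivAt_wedge_of_neg hy).deriv.symm
    · refine (continuousAt_const (y := (⟨-Real.sin (θ / 2), Real.cos (θ / 2)⟩ : ℂ))).congr ?_
      filter_upwards [lt_mem_nhds hx] with y hy
      exact (hasDerivAt_wedge_of_pos hy).deriv.symm
  · refine (locallyIntegrable_const (1 : ℝ)).mono (measurable_deriv _).aestronglyMeasurable ?_
    filter_upwards [compl_mem_ae_iff.2 (measure_singleton (0 : ℝ))] with x hx
    rw [norm_deriv_wedge (by simpa using hx)]; simp
  · refine tendsto_const_nhds.congr' ?_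
    filter_upwards [eventually_lt_atBot 0] with x hx
    rw [(hasDerivAt_wedge_of_neg hx).deriv, norm_mk_sin_cos, Complex.ofReal_one, div_one]
    have h : -((Real.pi - (Real.pi / 2 - θ / 2) : ℝ) : ℂ) =
        ((-(θ / 2 + Real.pi / 2) : ℝ) : ℂ) := by push_cast; ring
    rw [h, Complex.exp_mul_I, ← Complex.ofReal_cos, ← Complex.ofReal_sin, Real.cos_neg,
      Real.sin_neg, Real.cos_add_pi_div_two, Real.sin_add_pi_div_two]
    apply Complex.ext <;> simp [-Complex.ofReal_cos, -Complex.ofReal_sin]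
  · refine tendsto_const_nhds.congr' ?_
    filter_upwards [eventually_gt_atTop 0] with x hx
    rw [(hasDerivAt_wedge_of_pos hx).deriv, norm_mk_neg_sin_cos, Complex.ofReal_one, div_one]
    have h : (Real.pi - (Real.pi / 2 - θ / 2) : ℝ) = θ / 2 + Real.pi / 2 := by ring
    rw [h, Complex.exp_mul_I, ← Complex.ofReal_cos, ← Complex.ofReal_sin,
      Real.cos_add_pi_div_two, Real.sin_add_pi_div_two]
    apply Complex.ext <;> simp [-Complex.ofReal_cos, -Complex.ofReal_sin]

end Wedge

section Ends

variable {θ : ℝ} {γ : ℝ → ℂ}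

/-- The mirror image of a contour in the real axis, run through backwards. -/
def reflect (γ : ℝ → ℂ) (x : ℝ) : ℂ := (starRingEnd ℂ) (γ (-x))

theorem deriv_reflect (γ : ℝ → ℂ) (x : ℝ) :
    deriv (reflect γ) x = -(starRingEnd ℂ) (deriv γ (-x)) := by
  have : reflect γ = fun x => Complex.conjCLE ((fun y => γ (-y)) x) := rfl
  rw [this]
  by_cases hd : DifferentiableAt ℝ (fun y => γ (-y)) x
  · have :=
      (Complex.conjCLE.toContinuousLinearMap.hasFDerivAt.comp_hasDerivAt x hd.hasDerivAt).deriv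
    rw [deriv_comp_neg] at this
    simpa [Function.comp_def] using this
  · have hd' : ¬ DifferentiableAt ℝ (fun x => Complex.conjCLE ((fun y => γ (-y)) x)) x := by
      intro h'
      exact hd (Complex.conjCLE.comp_differentiableAt_iff.1 h')
    have hd2 : ¬ DifferentiableAt ℝ γ (-x) := fun h' =>
      hd (h'.comp x differentiable_neg.differentiableAt)
    rw [deriv_zero_of_not_differentiableAt hd', deriv_zero_of_not_differentiableAt hd2]
    simp

theorem IsContour.reflect (h₁ : θ ≤ Real.pi / 2) (h : IsContour θ γ) :
    IsContour θ (reflect γ) := by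
  have hd : deriv (FracEvol.reflect γ) = fun x => -(starRingEnd ℂ) (deriv γ (-x)) :=
    funext (deriv_reflect γ)
  refine ⟨Complex.continuous_conj.comp (h.continuous.comp continuous_neg), ?_, ?_,
    fun x => conj_mem_sector h₁ (h.mem_sector _), ?_, ?_, ?_, ?_⟩
  · obtain ⟨S, hS, hS'⟩ := h.piecewise_c1
    refine ⟨S.image Neg.neg, fun x hx => ?_, ?_⟩
    · have : -x ∉ S := fun hh => hx (Finset.mem_image.2 ⟨-x, hh, by simp⟩)
      exact Complex.conjCLE.comp_differentiableAt_iff.2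
        ((hS _ this).comp x differentiable_neg.differentiableAt)
    · rw [hd]
      refine (Complex.continuous_conj.comp_continuousOn
        (hS'.comp continuous_neg.continuousOn ?_)).neg
      intro x hx hh
      exact hx (Finset.mem_coe.2 (Finset.mem_image.2 ⟨-x, hh, by simp⟩))
  · rw [hd]
    intro x
    have h1 := (h.locallyIntegrable (-x))
    obtain ⟨U, hU, hi⟩ := h1
    refine ⟨Neg.neg ⁻¹' U, continuous_neg.continuousAt.preimage_mem_nhds hU, ?_⟩
    have h2 : IntegrableOn (fun x => deriv γ (-x)) (Neg.neg ⁻¹' U) volume :=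
      ((Measure.measurePreserving_neg volume).integrableOn_comp_preimage
        (Homeomorph.neg ℝ).measurableEmbedding).2 hi
    exact (Complex.conjCLE.toContinuousLinearMap.integrable_comp h2).neg
  · exact (h.upper_end.comp tendsto_neg_atBot_atTop).congr fun x => by simp [FracEvol.reflect]
  · exact (h.lower_end.comp tendsto_neg_atTop_atBot).congr fun x => by simp [FracEvol.reflect]
  · obtain ⟨ψ, h0, h1, ht⟩ := h.upper_angle
    refine ⟨ψ, h0, h1, ?_⟩
    have := ((Complex.continuous_conj.tendsto _).comp (ht.comp tendsto_neg_atBot_atTop)).neg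
    convert this using 2 with x
    · simp [hd, neg_div]
    · rw [← Complex.exp_conj]; congr 2; simp; ring
  · obtain ⟨ψ, h0, h1, ht⟩ := h.lower_angle
    refine ⟨ψ, h0, h1, ?_⟩
    have := ((Complex.continuous_conj.tendsto _).comp (ht.comp tendsto_neg_atTop_atBot)).neg
    convert this using 2 with x
    · simp [hd, neg_div]
    · rw [map_neg, neg_neg, ← Complex.exp_conj]; congr 1; simp; ring

theorem IsContour.intervalIntegrable_deriv (h : IsContour θ γ) (a b : ℝ) :
    IntervalIntegrable (deriv γ) volume a b :=
  (h.locallyIntegrable.integrableOn_isCompact isCompact_uIcc).intervalIntegrable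

theorem IsContour.integral_deriv (h : IsContour θ γ) (a b : ℝ) :
    ∫ x in a..b, deriv γ x = γ b - γ a := by
  obtain ⟨S, hS, -⟩ := h.piecewise_c1
  exact integral_eq_of_hasDerivAt_off_countable _ _ S.countable_toSet h.continuous.continuousOn
    (fun x hx => (hS x hx.2).hasDerivAt) (h.intervalIntegrable_deriv a b)

/-- If a real linear functional is at least `c ‖γ'‖` along the end of a contour, then it is at least
`(c / 2) ‖γ‖` further out. -/
theorem IsContour.eventually_le_of_deriv (h : IsContour θ γ) (φ : ℂ →L[ℝ] ℝ) {c X : ℝ}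
    (hc : 0 < c) (hX : ∀ x ≥ X, c * ‖deriv γ x‖ ≤ φ (deriv γ x)) :
    ∀ᶠ x in atTop, c / 2 * ‖γ x‖ ≤ φ (γ x) := by
  have key : ∀ x ≥ X, c * ‖γ x - γ X‖ ≤ φ (γ x) - φ (γ X) := by
    intro x hx
    have hi := h.intervalIntegrable_deriv X x
    rw [← map_sub, ← h.integral_deriv X x, ← φ.intervalIntegral_comp_comm hi]
    calc c * ‖∫ y in X..x, deriv γ y‖ ≤ c * ∫ y in X..x, ‖deriv γ y‖ := by
          gcongr
          exact intervalIntegral.norm_integral_le_integral_norm hx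
      _ = ∫ y in X..x, c * ‖deriv γ y‖ := by rw [intervalIntegral.integral_const_mul]
      _ ≤ _ := intervalIntegral.integral_mono_on hx (hi.norm.const_mul c)
          ⟨φ.integrable_comp hi.1, φ.integrable_comp hi.2⟩ fun y hy => hX y hy.1
  filter_upwards [eventually_ge_atTop X,
    h.upper_end.eventually_ge_atTop (2 / c * (c * ‖γ X‖ + |φ (γ X)|))] with x hx hx'
  have h1 := key x hx
  have h2 : ‖γ x‖ ≤ ‖γ x - γ X‖ + ‖γ X‖ := by simpa using norm_add_le (γ x - γ X) (γ X)
  have h3 := neg_abs_le (φ (γ X))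
  have h4 : c * ‖γ X‖ + |φ (γ X)| ≤ c / 2 * ‖γ x‖ := by
    have := mul_le_mul_of_nonneg_left hx' (by positivity : 0 ≤ c / 2)
    rwa [← mul_assoc, show c / 2 * (2 / c) = 1 by field_simp, one_mul] at this
  nlinarith

/-- The upper end of a contour. -/
theorem IsContour.upper_estimates (h : IsContour θ γ) :
    ∃ c > 0, ∀ᶠ x in atTop, DifferentiableAt ℝ γ x ∧ c * ‖deriv γ x‖ ≤ -(deriv γ x).re ∧
      c * ‖γ x‖ ≤ -(γ x).re ∧ 0 < (γ x).im := by
  obtain ⟨ψ, h0, h1, ht⟩ := h.upper_angle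
  set e := Complex.exp (((Real.pi - ψ : ℝ) : ℂ) * Complex.I) with he
  have hre : e.re = -Real.cos ψ := by
    rw [he, Complex.exp_ofReal_mul_I_re, Real.cos_pi_sub]
  have him : e.im = Real.sin ψ := by
    rw [he, Complex.exp_ofReal_mul_I_im, Real.sin_pi_sub]
  have hcos : 0 < Real.cos ψ := Real.cos_pos_of_mem_Ioo ⟨by linarith, h1⟩
  have hsin : 0 < Real.sin ψ := Real.sin_pos_of_pos_of_lt_pi h0 (by linarith)
  set c := min (Real.cos ψ) (Real.sin ψ) / 2 with hcdef
  have hc : 0 < c := by positivity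
  have hc1 : c < Real.cos ψ := by
    have := min_le_left (Real.cos ψ) (Real.sin ψ); linarith [lt_min hcos hsin]
  have hc2 : c < Real.sin ψ := by
    have := min_le_right (Real.cos ψ) (Real.sin ψ); linarith [lt_min hcos hsin]
  have e1 : ∀ᶠ x in atTop, c * ‖deriv γ x‖ ≤ -(deriv γ x).re := by
    have := ((Complex.continuous_re.tendsto e).comp ht).eventually_lt_const
      (u := -c) (by rw [hre]; linarith)
    filter_upwards [this] with x hx
    simp only [Function.comp, Complex.div_ofReal_re] at hx
    rcases eq_or_lt_of_le (norm_nonneg (deriv γ x)) with h' | h'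
    · rw [norm_eq_zero.1 h'.symm]; simp
    · rw [div_lt_iff₀ h'] at hx; linarith
  have e2 : ∀ᶠ x in atTop, c * ‖deriv γ x‖ ≤ (deriv γ x).im := by
    have := ((Complex.continuous_im.tendsto e).comp ht).eventually_const_lt
      (u := c) (by rw [him]; linarith)
    filter_upwards [this] with x hx
    simp only [Function.comp, Complex.div_ofReal_im] at hx
    rcases eq_or_lt_of_le (norm_nonneg (deriv γ x)) with h' | h'
    · rw [norm_eq_zero.1 h'.symm]; simp
    · rw [lt_div_iff₀ h'] at hx; linarith
  obtain ⟨X1, hX1⟩ := eventually_atTop.1 e1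
  obtain ⟨X2, hX2⟩ := eventually_atTop.1 e2
  have f1 := h.eventually_le_of_deriv (-Complex.reCLM) hc (X := X1) (by simpa using hX1)
  have f2 := h.eventually_le_of_deriv Complex.imCLM hc (X := X2) (by simpa using hX2)
  obtain ⟨S, hS, -⟩ := h.piecewise_c1
  have e3 : ∀ᶠ x in atTop, x ∉ S := by
    obtain ⟨M, hM⟩ := S.bddAbove
    filter_upwards [eventually_gt_atTop M] with x hx hxS
    exact absurd (hM hxS) (not_le.2 hx)
  refine ⟨c / 2, by positivity, ?_⟩
  filter_upwards [e1, e3, f1, f2, h.upper_end.eventually_ge_atTop 1] with x g1 g2 g3 g4 g5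
  refine ⟨hS x g2, ?_, by simpa using g3, ?_⟩
  · nlinarith [norm_nonneg (deriv γ x)]
  · simp only [Complex.imCLM_apply] at g4
    nlinarith

theorem IsContour.lower_estimates (h₁ : θ ≤ Real.pi / 2) (h : IsContour θ γ) :
    ∃ c > 0, ∀ᶠ x in atTop, c * ‖γ (-x)‖ ≤ -(γ (-x)).re ∧ (γ (-x)).im < 0 := by
  obtain ⟨c, hc, hx⟩ := (h.reflect h₁).upper_estimates
  refine ⟨c, hc, hx.mono fun x hx => ?_⟩
  simpa [FracEvol.reflect] using hx.2.2

theorem IsContour.exists_norm_ge (h : IsContour θ γ) : ∃ δ > 0, ∀ x, δ ≤ ‖γ x‖ := by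
  have ht : Tendsto (fun x => ‖γ x‖) (cocompact ℝ) atTop := by
    rw [cocompact_eq_atBot_atTop]
    exact h.lower_end.sup h.upper_end
  obtain ⟨x₀, hx₀⟩ := h.continuous.norm.exists_forall_le ht
  exact ⟨_, norm_pos_iff.2 (h.mem_sector x₀).1, hx₀⟩

theorem IsContour.integrableOn_upper (h : IsContour θ γ) {t : ℝ} (ht : 0 < t) :
    ∃ X, ∀ Y ≥ X, IntegrableOn (fun x => Real.exp (t * (γ x).re) * ‖deriv γ x‖) (Ioi Y) := by
  obtain ⟨c, hc, hx⟩ := h.upper_estimates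
  obtain ⟨X, hX⟩ := eventually_atTop.1 hx
  refine ⟨X, fun Y hY => ?_⟩
  have hg : ∀ x ∈ Ici Y, HasDerivAt (fun x => Real.exp (t * (γ x).re))
      (Real.exp (t * (γ x).re) * (t * (deriv γ x).re)) x := fun x hx => by
    have h1 := (hX x (le_trans hY hx)).1.hasDerivAt
    have h2 : HasDerivAt (fun x => (γ x).re) (deriv γ x).re x :=
      Complex.reCLM.hasFDerivAt.comp_hasDerivAt x h1
    exact (h2.const_mul t).exp
  have hlim : Tendsto (fun x => Real.exp (t * (γ x).re)) atTop (𝓝 0) := by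
    refine Real.tendsto_exp_atBot.comp ?_
    have h3 : Tendsto (fun x => t * c * ‖γ x‖) atTop atTop :=
      h.upper_end.const_mul_atTop (by positivity)
    refine tendsto_atBot_mono' _ ?_ (tendsto_neg_atTop_atBot.comp h3)
    filter_upwards [hx] with x hx
    have := mul_le_mul_of_nonneg_left hx.2.2.1 ht.le
    simp only [Function.comp]; nlinarith
  have hint := integrableOn_Ioi_deriv_of_nonpos' hg (fun x hx => ?_) hlim
  · refine (hint.norm.const_mul (1 / (t * c))).mono' ?_ ?_
    · have := h.continuous
      have hm := measurable_deriv γ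
      fun_prop
    · refine (ae_restrict_iff' measurableSet_Ioi).2 (ae_of_all _ fun x hx => ?_)
      have h4 := (hX x (le_trans hY (le_of_lt hx))).2.1
      have h5 := neg_le_abs (deriv γ x).re
      simp only [norm_mul, Real.norm_eq_abs, abs_norm, Real.abs_exp, abs_of_pos ht]
      have : 1 / (t * c) * (Real.exp (t * (γ x).re) * (t * |(deriv γ x).re|)) =
        Real.exp (t * (γ x).re) * (|(deriv γ x).re| / c) := by field_simp
      rw [this]
      gcongr
      rw [le_div_iff₀ hc]; linarith
  · have h4 := (hX x (le_trans hY (le_of_lt hx))).2.1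
    have : (deriv γ x).re ≤ 0 := by nlinarith [norm_nonneg (deriv γ x)]
    exact mul_nonpos_of_nonneg_of_nonpos (Real.exp_pos _).le
      (mul_nonpos_of_nonneg_of_nonpos ht.le this)

theorem IsContour.integrable_exp_mul_norm_deriv (h₁ : θ ≤ Real.pi / 2) (h : IsContour θ γ) {t : ℝ}
    (ht : 0 < t) : Integrable (fun x => Real.exp (t * (γ x).re) * ‖deriv γ x‖) := by
  obtain ⟨X1, hX1⟩ := h.integrableOn_upper ht
  obtain ⟨X2, hX2⟩ := (h.reflect h₁).integrableOn_upper ht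
  set X := max X1 X2
  have hu := hX1 X (le_max_left _ _)
  have hl : IntegrableOn (fun x => Real.exp (t * (γ x).re) * ‖deriv γ x‖) (Iio (-X)) := by
    have h2 := hX2 X (le_max_right _ _)
    have h3 := ((Measure.measurePreserving_neg (volume : Measure ℝ)).integrableOn_comp_preimage
        (Homeomorph.neg ℝ).measurableEmbedding).2 h2
    rw [show Neg.neg ⁻¹' Ioi X = Iio (-X) by ext x; simp [lt_neg]] at h3
    refine h3.congr_fun (fun x _ => ?_) measurableSet_Iio
    simp [FracEvol.reflect, deriv_reflect]
  have hm : IntegrableOn (fun x => Real.exp (t * (γ x).re) * ‖deriv γ x‖) (Icc (-X) X) := by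
    have hd := (h.locallyIntegrable.integrableOn_isCompact (isCompact_Icc (a := -X) (b := X))).norm
    refine IntegrableOn.continuousOn_mul (g := fun x => Real.exp (t * (γ x).re)) ?_ hd isCompact_Icc
    have := h.continuous
    fun_prop
  rw [← integrableOn_univ]
  refine ((hl.union hm).union hu).mono_set fun x _ => ?_
  rcases lt_or_ge x (-X) with hx | hx
  · exact Or.inl (Or.inl hx)
  · rcases le_or_gt x X with hx' | hx'
    · exact Or.inl (Or.inr ⟨hx, hx'⟩)
    · exact Or.inr hx'

end Ends

section InverseLaplace

variable {E : Type*} [NormedAddCommGroup E] [NormedSpace ℂ E]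

/-- `L` is holomorphic on the sector of angle `θ` and bounded there by `C |z| ^ (-α)`. -/
structure HasDecay (L : ℂ → E) (θ α C : ℝ) : Prop where
  angle_pos : 0 < θ
  angle_le : θ ≤ Real.pi / 2
  exponent_pos : 0 < α
  const_nonneg : 0 ≤ C
  differentiableOn : DifferentiableOn ℂ L (sector θ)
  bound : ∀ z ∈ sector θ, ‖L z‖ ≤ C * ‖z‖ ^ (-α)

/-- The integrand of the inverse Laplace transform of `L` along `γ`. -/
def laplaceIntegrand (L : ℂ → E) (γ : ℝ → ℂ) (t x : ℝ) : E :=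
  (Complex.exp (γ x * (t : ℂ)) * deriv γ x) • L (γ x)

/-- The inverse Laplace transform of `L` along `γ`. -/
def invLaplace (L : ℂ → E) (γ : ℝ → ℂ) (t : ℝ) : E :=
  (1 / (2 * (Real.pi : ℂ) * Complex.I)) • ∫ x : ℝ, laplaceIntegrand L γ t x

variable {L : ℂ → E} {θ α C : ℝ} {γ : ℝ → ℂ}

theorem norm_exp_mul_ofReal (z : ℂ) (t : ℝ) :
    ‖Complex.exp (z * (t : ℂ))‖ = Real.exp (t * z.re) := by
  rw [Complex.norm_exp]; congr 1; simp [mul_comm]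

theorem norm_laplaceIntegrand (L : ℂ → E) (γ : ℝ → ℂ) (t x : ℝ) :
    ‖laplaceIntegrand L γ t x‖ = Real.exp (t * (γ x).re) * ‖deriv γ x‖ * ‖L (γ x)‖ := by
  rw [laplaceIntegrand, norm_smul, norm_mul, norm_exp_mul_ofReal]

theorem HasDecay.continuous_comp (hL : HasDecay L θ α C) (hγ : IsContour θ γ) :
    Continuous fun x => L (γ x) :=
  hL.differentiableOn.continuousOn.comp_continuous hγ.continuous hγ.mem_sector

theorem HasDecay.aestronglyMeasurable (hL : HasDecay L θ α C) (hγ : IsContour θ γ) (t : ℝ) :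
    AEStronglyMeasurable (laplaceIntegrand L γ t) := by
  have h1 : Continuous fun x => Complex.exp (γ x * (t : ℂ)) := by
    have := hγ.continuous; fun_prop
  exact (h1.aestronglyMeasurable.mul (measurable_deriv γ).aestronglyMeasurable).smul
    (hL.continuous_comp hγ).aestronglyMeasurable

theorem HasDecay.exists_norm_comp_le (hL : HasDecay L θ α C) (hγ : IsContour θ γ) :
    ∃ M, 0 ≤ M ∧ ∀ x, ‖L (γ x)‖ ≤ M := by
  obtain ⟨δ, hδ, h⟩ := hγ.exists_norm_ge
  refine ⟨C * δ ^ (-α), mul_nonneg hL.const_nonneg (by positivity), fun x => ?_⟩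
  refine (hL.bound _ (hγ.mem_sector x)).trans (mul_le_mul_of_nonneg_left ?_ hL.const_nonneg)
  exact Real.rpow_le_rpow_of_nonpos hδ (h x) (neg_nonpos.2 hL.exponent_pos.le)

theorem HasDecay.integrable (hL : HasDecay L θ α C) (hγ : IsContour θ γ) {t : ℝ} (ht : 0 < t) :
    Integrable (laplaceIntegrand L γ t) := by
  obtain ⟨M, -, hM⟩ := hL.exists_norm_comp_le hγ
  refine ((hγ.integrable_exp_mul_norm_deriv hL.angle_le ht).mul_const M).mono'
    (hL.aestronglyMeasurable hγ t) (ae_of_all _ fun x => ?_)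
  rw [norm_laplaceIntegrand]
  gcongr
  exact hM x

theorem HasDecay.continuousAt_invLaplace (hL : HasDecay L θ α C) (hγ : IsContour θ γ) {t : ℝ}
    (ht : 0 < t) : ContinuousAt (invLaplace L γ) t := by
  obtain ⟨M, -, hM⟩ := hL.exists_norm_comp_le hγ
  refine ContinuousAt.const_smul ?_ _
  have hb := ((hγ.integrable_exp_mul_norm_deriv hL.angle_le (half_pos ht)).add
    (hγ.integrable_exp_mul_norm_deriv hL.angle_le (mul_pos two_pos ht))).mul_const M
  refine continuousAt_of_dominated
    (Eventually.of_forall fun s => hL.aestronglyMeasurable hγ s) ?_ hb ?_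
  · filter_upwards [Icc_mem_nhds (show t / 2 < t by linarith) (show t < 2 * t by linarith)]
      with s hs
    refine ae_of_all _ fun x => ?_
    rw [norm_laplaceIntegrand]
    simp only [Pi.add_apply]
    rw [← add_mul]
    gcongr
    · rcases le_total 0 (γ x).re with h | h
      · exact (Real.exp_le_exp.2 (mul_le_mul_of_nonneg_right hs.2 h)).trans
          (le_add_of_nonneg_left (Real.exp_pos _).le)
      · exact (Real.exp_le_exp.2 (mul_le_mul_of_nonpos_right hs.1 h)).trans
          (le_add_of_nonneg_right (Real.exp_pos _).le)
    · exact hM x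
  · refine ae_of_all _ fun x => ContinuousAt.smul (Continuous.continuousAt ?_) continuousAt_const
    fun_prop

/-- The line integral of a function with a primitive. -/
theorem IsContour.integral_eq_sub [CompleteSpace E] {F G : ℂ → E} (hγ : IsContour θ γ)
    {U : Set ℂ} (hU : ∀ x, γ x ∈ U) (hG : ∀ z ∈ U, HasDerivAt G (F z) z)
    (hF : ContinuousOn F U) (a b : ℝ) :
    ∫ x in a..b, deriv γ x • F (γ x) = G (γ b) - G (γ a) := by
  obtain ⟨S, hS, -⟩ := hγ.piecewise_c1
  refine integral_eq_of_hasDerivAt_off_countable (fun x => G (γ x)) _ S.countable_toSet ?_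
    (fun x hx => ?_) ?_
  · exact (ContinuousOn.comp_continuous (s := U)
      (fun z hz => (hG z hz).continuousAt.continuousWithinAt) hγ.continuous hU).continuousOn
  · exact (hG _ (hU x)).scomp x (hS x hx.2).hasDerivAt
  · exact (hγ.intervalIntegrable_deriv a b).smul_continuousOn
      (hF.comp_continuous hγ.continuous hU).continuousOn

theorem HasDecay.norm_primitive_sub_le (hL : HasDecay L θ α C) {t : ℝ} (ht : 0 < t) {G : ℂ → E}
    (hG : ∀ z ∈ sector θ, HasDerivAt G (Complex.exp (z * (t : ℂ)) • L z) z) {σ m : ℝ}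
    (hσ : |σ| = 1) (hm : 0 < m) {z w : ℂ} (hz : z ∈ sector θ) (hw : w ∈ sector θ)
    (hzi : 0 < σ * z.im) (hwi : 0 < σ * w.im) (hzr : m ≤ -z.re) (hwr : m ≤ -w.re) :
    ‖G z - G w‖ ≤ C * m ^ (-α) * Real.exp (-(t * m)) * ‖z - w‖ := by
  set K : Set ℂ := {ζ | 0 < σ * ζ.im} ∩ {ζ | 0 < ζ.re * Real.cos θ + σ * ζ.im * Real.sin θ} ∩
    {ζ | m ≤ -ζ.re} with hK
  have habs : ∀ ζ : ℂ, 0 < σ * ζ.im → σ * ζ.im = |ζ.im| := fun ζ h => by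
    rw [← abs_of_pos h, abs_mul, hσ, one_mul]
  have hconv : Convex ℝ K := by
    have c1 := convex_halfSpace_gt (f := fun ζ : ℂ => σ * ζ.im)
      (σ • Complex.imLm).isLinear (0 : ℝ)
    have c2 := convex_halfSpace_gt (f := fun ζ : ℂ => ζ.re * Real.cos θ + σ * ζ.im * Real.sin θ)
      (show IsLinearMap ℝ _ from ⟨fun x y => by simp; ring, fun a x => by simp; ring⟩) (0 : ℝ)
    have c3 := convex_halfSpace_ge (f := fun ζ : ℂ => -ζ.re)
      (show IsLinearMap ℝ _ from ⟨fun x y => by simp; ring, fun a x => by simp⟩) m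
    exact (c1.inter c2).inter c3
  have hsub : K ⊆ sector θ := fun ζ hζ => by
    rw [mem_sector_iff hL.angle_pos hL.angle_le]
    right
    rw [← habs ζ hζ.1.1]; exact hζ.1.2
  have hmem : ∀ ζ ∈ sector θ, 0 < σ * ζ.im → m ≤ -ζ.re → ζ ∈ K := fun ζ h1 h2 h3 => by
    refine ⟨⟨h2, ?_⟩, h3⟩
    rcases (mem_sector_iff hL.angle_pos hL.angle_le ζ).1 h1 with h | h
    · linarith
    · change 0 < ζ.re * Real.cos θ + σ * ζ.im * Real.sin θ
      rw [habs ζ h2]; exact h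
  refine hconv.norm_image_sub_le_of_norm_hasDerivWithin_le
    (fun ζ hζ => (hG ζ (hsub hζ)).hasDerivWithinAt) (fun ζ hζ => ?_)
    (hmem w hw hwi hwr) (hmem z hz hzi hzr)
  have h3 : m ≤ -ζ.re := hζ.2
  have hn : m ≤ ‖ζ‖ := h3.trans ((neg_le_abs _).trans (Complex.abs_re_le_norm _))
  rw [norm_smul, norm_exp_mul_ofReal, mul_comm]
  have := hL.const_nonneg
  refine mul_le_mul ((hL.bound ζ (hsub hζ)).trans ?_) ?_ (Real.exp_pos _).le (by positivity)
  · gcongr C * ?_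
    exact Real.rpow_le_rpow_of_nonpos hm hn (neg_nonpos.2 hL.exponent_pos.le)
  · gcongr; nlinarith

theorem tendsto_mul_exp_neg_mul (a b k : ℝ) (hk : 0 < k) :
    Tendsto (fun r : ℝ => Real.exp (-(k * r)) * (a * r + b)) atTop (𝓝 0) := by
  have h1 : Tendsto (fun r : ℝ => k * r) atTop atTop := tendsto_id.const_mul_atTop hk
  have h2 := (Real.tendsto_pow_mul_exp_neg_atTop_nhds_zero 1).comp h1
  have h3 := (Real.tendsto_pow_mul_exp_neg_atTop_nhds_zero 0).comp h1
  have := (h2.const_mul (a / k)).add (h3.const_mul b)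
  simp only [mul_zero, add_zero] at this
  refine this.congr fun r => ?_
  simp only [Function.comp, pow_one, pow_zero]
  field_simp

theorem HasDecay.tendsto_primitive_sub (hL : HasDecay L θ α C) {t : ℝ} (ht : 0 < t) {G : ℂ → E}
    (hG : ∀ z ∈ sector θ, HasDerivAt G (Complex.exp (z * (t : ℂ)) • L z) z) {σ c ε : ℝ}
    (hσ : |σ| = 1) (hc : 0 < c) (hε : 0 < ε) {z : ℝ → ℂ} (hz : ∀ x, z x ∈ sector θ)
    (hn : Tendsto (fun x => ‖z x‖) atTop atTop)
    (hi : ∀ᶠ x in atTop, c * ‖z x‖ ≤ -(z x).re ∧ 0 < σ * (z x).im) :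
    Tendsto (fun x => G (z x) - G (wedge θ ε (σ * ‖z x‖))) atTop (𝓝 0) := by
  have hs := sin_half_pos hL.angle_pos hL.angle_le
  have hco := cos_half_pos hL.angle_pos hL.angle_le
  have hs1 := Real.sin_le_one (θ / 2)
  have hco1 := Real.cos_le_one (θ / 2)
  set s := Real.sin (θ / 2) with hsdef
  set k := min c (s / 2) with hk
  have hkpos : 0 < k := lt_min hc (by positivity)
  have hlim := ((tendsto_mul_exp_neg_mul 3 ε (t * k) (by positivity)).const_mul C).comp hn
  rw [mul_zero] at hlim
  have hC := hL.const_nonneg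
  refine squeeze_zero_norm' ?_ hlim
  filter_upwards [hi, hn.eventually_ge_atTop (2 * ε / s), hn.eventually_ge_atTop (1 / k)]
    with x hx h1 h2
  set r := ‖z x‖ with hr
  have hr0 : 0 < r := lt_of_lt_of_le (by positivity) h2
  rw [div_le_iff₀ hs] at h1
  rw [div_le_iff₀ hkpos] at h2
  have habs : |σ * r| = r := by rw [abs_mul, hσ, one_mul, abs_of_pos hr0]
  have hσ2 : σ * σ = 1 := by rw [← abs_mul_abs_self, hσ, one_mul]
  have hwr : (wedge θ ε (σ * r)).re = ε - s * r := by simp [wedge, habs, hsdef]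
  have hwi : (wedge θ ε (σ * r)).im = Real.cos (θ / 2) * (σ * r) := by simp [wedge]
  have hkc : k ≤ c := min_le_left _ _
  have hks : k ≤ s / 2 := min_le_right _ _
  have key := hL.norm_primitive_sub_le ht hG hσ (m := k * r) (by positivity) (hz x)
    (wedge_mem_sector hL.angle_pos hL.angle_le hε (σ * r)) hx.2
    (by rw [hwi, show σ * (Real.cos (θ / 2) * (σ * r)) = Real.cos (θ / 2) * r * (σ * σ) by ring,
          hσ2]; positivity)
    (le_trans (by nlinarith) hx.1) (by rw [hwr]; nlinarith)
  refine key.trans ?_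
  have hw : ‖wedge θ ε (σ * r)‖ ≤ ε + 2 * r := by
    refine (Complex.norm_le_abs_re_add_abs_im _).trans ?_
    rw [hwr, hwi, abs_mul, habs, abs_of_pos hco]
    have : |ε - s * r| ≤ ε + s * r := by
      rw [abs_le]; constructor <;> nlinarith
    nlinarith
  have hzw : ‖z x - wedge θ ε (σ * r)‖ ≤ 3 * r + ε := by
    refine (norm_sub_le _ _).trans ?_
    linarith
  have hp : (k * r) ^ (-α) ≤ 1 :=
    Real.rpow_le_one_of_one_le_of_nonpos (by linarith) (neg_nonpos.2 hL.exponent_pos.le)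
  simp only [Function.comp]
  rw [← hr, mul_assoc t k r]
  calc C * (k * r) ^ (-α) * Real.exp (-(t * (k * r))) * ‖z x - wedge θ ε (σ * r)‖
      ≤ C * 1 * Real.exp (-(t * (k * r))) * (3 * r + ε) := by gcongr
    _ = _ := by ring

/-- The contour may be replaced by a wedge. -/
theorem HasDecay.integral_eq_wedge [CompleteSpace E] (hL : HasDecay L θ α C) (hγ : IsContour θ γ)
    {t ε : ℝ} (ht : 0 < t) (hε : 0 < ε) :
    ∫ x, laplaceIntegrand L γ t x = ∫ x, laplaceIntegrand L (wedge θ ε) t x := by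
  have hF : DifferentiableOn ℂ (fun z => Complex.exp (z * (t : ℂ)) • L z) (sector θ) :=
    DifferentiableOn.smul (by fun_prop) hL.differentiableOn
  obtain ⟨G, hG⟩ := exists_primitive_sector hL.angle_le hF
  have hw := isContour_wedge hL.angle_pos hL.angle_le hε
  have hint : ∀ {γ : ℝ → ℂ}, IsContour θ γ → ∀ a b,
      ∫ x in a..b, laplaceIntegrand L γ t x = G (γ b) - G (γ a) := by
    intro γ hγ a b
    rw [← hγ.integral_eq_sub hγ.mem_sector hG hF.continuousOn]
    refine intervalIntegral.integral_congr fun x _ => ?_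
    simp only [laplaceIntegrand, smul_smul, mul_comm]
  obtain ⟨c₁, hc₁, h₁⟩ := hγ.upper_estimates
  obtain ⟨c₂, hc₂, h₂⟩ := hγ.lower_estimates hL.angle_le
  have hn₂ : Tendsto (fun x => ‖γ (-x)‖) atTop atTop := hγ.lower_end.comp tendsto_neg_atTop_atBot
  have T₁ := hL.tendsto_primitive_sub ht hG (σ := 1) (by simp) hc₁ hε hγ.mem_sector hγ.upper_end
    (h₁.mono fun x hx => ⟨hx.2.2.1, by simpa using hx.2.2.2⟩)
  have T₂ := hL.tendsto_primitive_sub ht hG (σ := -1) (by simp) hc₂ hε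
    (fun x => hγ.mem_sector (-x)) hn₂ (h₂.mono fun x hx => ⟨hx.1, by simpa using hx.2⟩)
  have I₁ := intervalIntegral_tendsto_integral (hL.integrable hγ ht) tendsto_neg_atTop_atBot
    tendsto_id
  have I₂ := intervalIntegral_tendsto_integral (hL.integrable hw ht)
    (tendsto_neg_atTop_atBot.comp hn₂) hγ.upper_end
  refine tendsto_nhds_unique I₁ ?_
  have := I₂.add (T₁.sub T₂)
  simp only [sub_zero, add_zero] at this
  refine this.congr fun x => ?_
  rw [hint hγ, hint hw]
  simp only [Function.comp, id, one_mul, neg_mul]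
  abel

theorem HasDecay.invLaplace_eq_wedge [CompleteSpace E] (hL : HasDecay L θ α C)
    (hγ : IsContour θ γ) {t ε : ℝ} (ht : 0 < t) (hε : 0 < ε) :
    invLaplace L γ t = invLaplace L (wedge θ ε) t := by
  rw [invLaplace, invLaplace, hL.integral_eq_wedge hγ ht hε]

theorem ae_norm_deriv_wedge (θ ε : ℝ) : ∀ᵐ x : ℝ, ‖deriv (wedge θ ε) x‖ = 1 := by
  filter_upwards [compl_mem_ae_iff.2 (measure_singleton (0 : ℝ))] with x hx
  exact norm_deriv_wedge (by simpa using hx)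

theorem integrable_exp_wedge (h₀ : 0 < θ) (h₁ : θ ≤ Real.pi / 2) {ε t : ℝ} (hε : 0 < ε)
    (ht : 0 < t) : Integrable (fun x => Real.exp (t * (ε - Real.sin (θ / 2) * |x|))) := by
  refine ((isContour_wedge h₀ h₁ hε).integrable_exp_mul_norm_deriv h₁ ht).congr ?_
  filter_upwards [ae_norm_deriv_wedge θ ε] with x hx
  rw [hx, mul_one, wedge]

theorem mul_le_norm_wedge (h₀ : 0 < θ) (h₁ : θ ≤ Real.pi / 2) {ε y x : ℝ}
    (h : y ^ 2 ≤ ε ^ 2 + x ^ 2) :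
    √(1 - Real.sin (θ / 2)) * y ≤ ‖wedge θ ε x‖ := by
  have h2 := sin_half_lt_one h₀ h₁
  refine le_of_sq_le_sq ?_ (norm_nonneg _)
  rw [mul_pow, Real.sq_sqrt (by linarith)]
  refine le_trans ?_ (le_norm_wedge_sq h₀ h₁ x)
  gcongr

theorem HasDecay.exists_norm_invLaplace_le [CompleteSpace E] (hL : HasDecay L θ α C)
    (hγ : IsContour θ γ) :
    ∃ M, 0 ≤ M ∧ ∀ t > 0, ‖invLaplace L γ t‖ ≤ M * t ^ (α - 1) := by
  have hC := hL.const_nonneg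
  have hκ : 0 < √(1 - Real.sin (θ / 2)) :=
    Real.sqrt_pos.2 (by linarith [sin_half_lt_one hL.angle_pos hL.angle_le])
  set κ := √(1 - Real.sin (θ / 2)) with hκdef
  set J := ∫ x : ℝ, Real.exp (1 - Real.sin (θ / 2) * |x|) with hJ
  have hJ0 : 0 ≤ J := integral_nonneg fun x => (Real.exp_pos _).le
  refine ⟨(2 * Real.pi)⁻¹ * (C * κ ^ (-α) * J), by positivity, fun t ht => ?_⟩
  have hε : 0 < t⁻¹ := inv_pos.2 ht
  have hw := isContour_wedge hL.angle_pos hL.angle_le hε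
  rw [hL.invLaplace_eq_wedge hγ ht hε, invLaplace, norm_smul]
  have h1 : ‖1 / (2 * (Real.pi : ℂ) * Complex.I)‖ = (2 * Real.pi)⁻¹ := by
    simp [abs_of_pos Real.pi_pos]
  rw [h1, mul_assoc]
  gcongr
  have hb : ∀ᵐ x : ℝ, ‖laplaceIntegrand L (wedge θ t⁻¹) t x‖ ≤
      Real.exp (t * (t⁻¹ - Real.sin (θ / 2) * |x|)) * (C * (κ * t⁻¹) ^ (-α)) := by
    filter_upwards [ae_norm_deriv_wedge θ t⁻¹] with x hx
    rw [norm_laplaceIntegrand, hx, mul_one]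
    refine mul_le_mul (by simp [wedge]) ((hL.bound _ (hw.mem_sector x)).trans ?_)
      (norm_nonneg _) (Real.exp_pos _).le
    gcongr C * ?_
    refine Real.rpow_le_rpow_of_nonpos (by positivity) ?_ (neg_nonpos.2 hL.exponent_pos.le)
    exact mul_le_norm_wedge hL.angle_pos hL.angle_le (by nlinarith)
  refine (norm_integral_le_of_norm_le
    ((integrable_exp_wedge hL.angle_pos hL.angle_le hε ht).mul_const _) hb).trans ?_
  rw [integral_mul_const]
  have h2 : ∫ x : ℝ, Real.exp (t * (t⁻¹ - Real.sin (θ / 2) * |x|)) = t⁻¹ * J := by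
    have := Measure.integral_comp_mul_left (fun x => Real.exp (1 - Real.sin (θ / 2) * |x|)) t
    rw [abs_of_pos hε, smul_eq_mul] at this
    rw [hJ, ← this]
    congr 1 with x
    rw [abs_mul, abs_of_pos ht]
    congr 1
    field_simp
  rw [h2, Real.mul_rpow hκ.le hε.le, Real.inv_rpow ht.le, Real.rpow_neg ht.le, inv_inv,
    Real.rpow_sub_one ht.ne']
  apply le_of_eq
  field_simp

end InverseLaplace

section LaplaceTransform

variable {E : Type*} [NormedAddCommGroup E] [NormedSpace ℂ E]
variable {L : ℂ → E} {θ α C : ℝ} {γ : ℝ → ℂ}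

theorem wedge_neg (θ ε x : ℝ) : wedge θ ε (-x) = (starRingEnd ℂ) (wedge θ ε x) := by
  apply Complex.ext <;> simp [wedge]

theorem wedge_re_le (h₀ : 0 < θ) (h₁ : θ ≤ Real.pi / 2) (ε x : ℝ) : (wedge θ ε x).re ≤ ε := by
  have := mul_nonneg (sin_half_pos h₀ h₁).le (abs_nonneg x)
  simp only [wedge]; linarith

theorem norm_sub_conj_le_of_arc {θ r K : ℝ} (h₁ : θ ≤ Real.pi / 2) {G N : ℂ → E}
    (hG : ∀ z ∈ sector θ, HasDerivAt G (N z) z)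
    (hN : ∀ z ∈ sector θ, ‖z‖ = r → ‖N z‖ ≤ K) {w : ℂ} (hw : w ∈ sector θ) (hr : ‖w‖ = r) :
    ‖G w - G ((starRingEnd ℂ) w)‖ ≤ r * K * (2 * Real.pi) := by
  have hr0 : 0 < r := hr ▸ norm_pos_iff.2 hw.1
  have hK : 0 ≤ K := (norm_nonneg _).trans (hN w hw hr)
  set a := |w.arg| with ha
  set f : ℝ → ℂ := fun τ => (r : ℂ) * Complex.exp (τ * Complex.I) with hf
  have hmem : ∀ τ ∈ Icc (-a) a, f τ ∈ sector θ := fun τ hτ =>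
    polar_mem_sector h₁ hr0 (lt_of_le_of_lt (abs_le.2 hτ) hw.2)
  have hfn : ∀ τ, ‖f τ‖ = r := fun τ => by
    simp [hf, Complex.norm_exp_ofReal_mul_I, abs_of_pos hr0]
  have hfd : ∀ τ, HasDerivAt f (f τ * Complex.I) τ := fun τ => by
    have h1 : HasDerivAt (fun τ : ℝ => (τ : ℂ) * Complex.I) (1 * Complex.I) τ :=
      (Complex.ofRealCLM.hasDerivAt (x := τ)).mul_const _
    have := h1.cexp.const_mul (r : ℂ)
    rw [one_mul, ← mul_assoc] at this
    exact this
  have hd : ∀ τ ∈ Icc (-a) a,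
      HasDerivWithinAt (fun τ => G (f τ)) ((f τ * Complex.I) • N (f τ)) (Icc (-a) a) τ :=
    fun τ hτ => ((hG _ (hmem τ hτ)).scomp τ (hfd τ)).hasDerivWithinAt
  have hb : ∀ τ ∈ Icc (-a) a, ‖(f τ * Complex.I) • N (f τ)‖ ≤ r * K := fun τ hτ => by
    rw [norm_smul, norm_mul, hfn, Complex.norm_I, mul_one]
    gcongr
    exact hN _ (hmem τ hτ) (hfn τ)
  have h1 : w = f w.arg := by
    rw [hf, ← hr]; exact (Complex.norm_mul_exp_arg_mul_I w).symm
  have h2 : (starRingEnd ℂ) w = f (-w.arg) := by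
    conv_lhs => rw [h1]
    simp [hf, ← Complex.exp_conj]
  have m1 : w.arg ∈ Icc (-a) a := ⟨neg_abs_le _, le_abs_self _⟩
  have m2 : -w.arg ∈ Icc (-a) a := ⟨by simpa using le_abs_self w.arg, neg_le_abs _⟩
  have key := (convex_Icc (-a) a).norm_image_sub_le_of_norm_hasDerivWithin_le hd hb m2 m1
  rw [← h1, ← h2] at key
  refine key.trans ?_
  gcongr
  rw [sub_neg_eq_add, ← two_mul, norm_mul, Real.norm_eq_abs, Real.norm_eq_abs, abs_two]
  gcongr
  exact Complex.abs_arg_le_pi w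

theorem tendsto_log_sub_log (z : ℂ) {w : ℝ → ℂ} (hw : Tendsto (fun x => ‖w x‖) atTop atTop)
    (hre : ∀ᶠ x in atTop, (w x).re < 0) :
    Tendsto (fun x => Complex.log (-w x) - Complex.log (z - w x)) atTop (𝓝 0) := by
  have h0 : Tendsto (fun x => 1 - z / w x) atTop (𝓝 1) := by
    have : Tendsto (fun x => z / w x) atTop (𝓝 0) := by
      rw [tendsto_zero_iff_norm_tendsto_zero]
      simp only [norm_div]
      exact hw.const_div_atTop _
    simpa using this.const_sub 1
  have hlog : Tendsto (fun x => Complex.log (1 - z / w x)) atTop (𝓝 0) := by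
    have := (continuousAt_clog Complex.one_mem_slitPlane).tendsto.comp h0
    simpa [Function.comp_def] using this
  have hre1 : ∀ᶠ x in atTop, 0 < (1 - z / w x).re :=
    ((Complex.continuous_re.tendsto _).comp h0).eventually_const_lt (by simp)
  rw [← neg_zero]
  refine hlog.neg.congr' ?_
  filter_upwards [hre, hre1] with x h1 h2
  have hne : w x ≠ 0 := fun h => by simp [h] at h1
  have hne2 : (1 - z / w x) ≠ 0 := fun h => by simp [h] at h2
  have e : z - w x = -w x * (1 - z / w x) := by field_simp; ring
  have a1 := abs_lt.1 (Complex.abs_arg_lt_pi_div_two_iff.2 (Or.inl (show 0 < (-w x).re by simpa)))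
  have a2 := abs_lt.1 (Complex.abs_arg_lt_pi_div_two_iff.2 (Or.inl h2))
  rw [e, Complex.log_mul (neg_ne_zero.2 hne) hne2 ⟨by linarith, by linarith⟩]
  ring

theorem log_eq_log_neg_add {w : ℂ} (hw : 0 < w.im) :
    Complex.log w = Complex.log (-w) + Real.pi * Complex.I := by
  apply Complex.ext
  · simp [Complex.log_re]
  · simp [Complex.log_im, Complex.arg_neg_eq_arg_sub_pi_of_im_pos hw]

theorem log_eq_log_neg_sub {w : ℂ} (hw : w.im < 0) :
    Complex.log w = Complex.log (-w) - Real.pi * Complex.I := by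
  apply Complex.ext
  · simp [Complex.log_re]
  · simp [Complex.log_im, Complex.arg_neg_eq_arg_add_pi_of_im_neg hw]

theorem tendsto_log_wedge (h₀ : 0 < θ) (h₁ : θ ≤ Real.pi / 2) (z : ℂ) (ε : ℝ) :
    Tendsto (fun y => (Complex.log (wedge θ ε y) - Complex.log (z - wedge θ ε y)) -
      (Complex.log (wedge θ ε (-y)) - Complex.log (z - wedge θ ε (-y)))) atTop
      (𝓝 (2 * Real.pi * Complex.I)) := by
  have hs := sin_half_pos h₀ h₁
  have hc := cos_half_pos h₀ h₁
  have hre : ∀ᶠ y : ℝ in atTop, (wedge θ ε y).re < 0 := by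
    filter_upwards [eventually_gt_atTop (ε / Real.sin (θ / 2)), eventually_ge_atTop 0] with y h h'
    rw [div_lt_iff₀ hs] at h
    simp only [wedge, abs_of_nonneg h']; linarith
  have t1 := tendsto_log_sub_log z (tendsto_norm_wedge (ε := ε) h₀ h₁).1 hre
  have t2 := tendsto_log_sub_log z (w := fun y => wedge θ ε (-y))
    ((tendsto_norm_wedge h₀ h₁).2.comp tendsto_neg_atTop_atBot)
    (hre.mono fun y hy => by rw [wedge_neg]; simpa using hy)
  have := (t1.sub t2).add_const (2 * Real.pi * Complex.I)
  simp only [sub_zero, zero_add] at this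
  refine this.congr' ?_
  filter_upwards [eventually_gt_atTop 0] with y hy
  have i1 : 0 < (wedge θ ε y).im := by simp only [wedge]; positivity
  have i2 : (wedge θ ε (-y)).im < 0 := by rw [wedge_neg]; simpa using i1
  rw [log_eq_log_neg_add i1, log_eq_log_neg_sub i2]
  ring

theorem one_add_abs_le_wedge (h₀ : 0 < θ) (h₁ : θ ≤ Real.pi / 2) {ε : ℝ} (hε : 0 < ε) :
    ∃ k > 0, ∀ x, k * (1 + |x|) ≤ ‖wedge θ ε x‖ ∧ k * (1 + |x|) ≤ ε + Real.sin (θ / 2) * |x| := by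
  have hs := sin_half_pos h₀ h₁
  have hκ : 0 < √(1 - Real.sin (θ / 2)) :=
    Real.sqrt_pos.2 (by linarith [sin_half_lt_one h₀ h₁])
  set κ := √(1 - Real.sin (θ / 2)) with hκdef
  set m := min 1 ε / 2 with hm
  have hm0 : 0 < m := by positivity
  have hm1 : m ≤ 1 / 2 := by have := min_le_left 1 ε; linarith
  have hm2 : m ≤ ε / 2 := by have := min_le_right 1 ε; linarith
  set k := min (κ * m) (min ε (Real.sin (θ / 2))) with hk
  have k1 : k ≤ κ * m := min_le_left _ _
  have k2 : k ≤ ε := (min_le_right _ _).trans (min_le_left _ _)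
  have k3 : k ≤ Real.sin (θ / 2) := (min_le_right _ _).trans (min_le_right _ _)
  refine ⟨k, by positivity, fun x => ⟨?_, ?_⟩⟩
  · have : κ * (m * (1 + |x|)) ≤ ‖wedge θ ε x‖ := by
      refine mul_le_norm_wedge h₀ h₁ ?_
      have e1 : (m * (1 + |x|)) ^ 2 ≤ m ^ 2 * 2 * (1 + x ^ 2) := by
        have := sq_abs x
        nlinarith [sq_nonneg (1 - |x|), sq_nonneg m, mul_nonneg (sq_nonneg m) (sq_nonneg (1 - |x|))]
      have e2 : m ^ 2 * 2 ≤ 1 := by nlinarith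
      have e3 : m ^ 2 * 2 ≤ ε ^ 2 := by nlinarith
      nlinarith [sq_nonneg x]
    refine le_trans ?_ this
    rw [← mul_assoc]
    gcongr
  · have := abs_nonneg x
    nlinarith

theorem HasDecay.integrable_wedge (hL : HasDecay L θ α C) {ε : ℝ} (hε : 0 < ε) :
    Integrable fun x => (ε + Real.sin (θ / 2) * |x|)⁻¹ * ‖L (wedge θ ε x)‖ := by
  obtain ⟨k, hk, h⟩ := one_add_abs_le_wedge hL.angle_pos hL.angle_le hε
  have hs := sin_half_pos hL.angle_pos hL.angle_le
  have hw := isContour_wedge hL.angle_pos hL.angle_le hε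
  have hC := hL.const_nonneg
  have hα := hL.exponent_pos
  have hi := (integrable_one_add_norm (E := ℝ) (μ := volume) (r := 1 + α)
    (by simpa using hα)).const_mul (k⁻¹ * (C * k ^ (-α)))
  refine hi.mono' ?_ (ae_of_all _ fun x => ?_)
  · have := hL.continuous_comp hw
    exact (Continuous.mul (Continuous.inv₀ (by fun_prop) fun x => by positivity)
      this.norm).aestronglyMeasurable
  · have h0 : 0 < 1 + |x| := by positivity
    rw [norm_mul, norm_norm, norm_inv, Real.norm_eq_abs,
      abs_of_pos (by positivity : 0 < ε + Real.sin (θ / 2) * |x|), Real.norm_eq_abs, neg_add,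
      Real.rpow_add h0, Real.rpow_neg_one]
    have e1 : (ε + Real.sin (θ / 2) * |x|)⁻¹ ≤ k⁻¹ * (1 + |x|)⁻¹ := by
      rw [← mul_inv]
      exact inv_anti₀ (by positivity) (h x).2
    have e2 : ‖L (wedge θ ε x)‖ ≤ C * k ^ (-α) * (1 + |x|) ^ (-α) := by
      refine (hL.bound _ (hw.mem_sector x)).trans ?_
      rw [mul_assoc, ← Real.mul_rpow hk.le h0.le]
      gcongr C * ?_
      exact Real.rpow_le_rpow_of_nonpos (by positivity) (h x).1 (neg_nonpos.2 hα.le)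
    calc _ ≤ (k⁻¹ * (1 + |x|)⁻¹) * (C * k ^ (-α) * (1 + |x|) ^ (-α)) :=
          mul_le_mul e1 e2 (norm_nonneg _) (by positivity)
      _ = _ := by ring

theorem HasDecay.integrable_cauchy (hL : HasDecay L θ α C) {ε : ℝ} (hε : 0 < ε) {z : ℂ}
    (hz : z.re = 2 * ε) :
    Integrable fun x => ((z - wedge θ ε x)⁻¹ * deriv (wedge θ ε) x) • L (wedge θ ε x) := by
  have hs := sin_half_pos hL.angle_pos hL.angle_le
  have hw := isContour_wedge hL.angle_pos hL.angle_le hε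
  refine (hL.integrable_wedge hε).mono' ?_ ?_
  · have h1 : Measurable fun x => (z - wedge θ ε x)⁻¹ :=
      (measurable_const.sub hw.continuous.measurable).inv
    exact (h1.aestronglyMeasurable.mul (measurable_deriv _).aestronglyMeasurable).smul
      (hL.continuous_comp hw).aestronglyMeasurable
  · filter_upwards [ae_norm_deriv_wedge θ ε] with x hx
    rw [norm_smul, norm_mul, hx, mul_one, norm_inv]
    gcongr
    refine le_trans (le_of_eq ?_) ((le_abs_self _).trans (Complex.abs_re_le_norm _))
    simp only [Complex.sub_re, wedge, hz]; ring

/-- Cauchy's formula for the part of the sector to the right of a wedge. -/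
theorem HasDecay.integral_cauchy [CompleteSpace E] (hL : HasDecay L θ α C) {ε : ℝ} (hε : 0 < ε)
    {z : ℂ} (hz : z.re = 2 * ε) :
    ∫ x, ((z - wedge θ ε x)⁻¹ * deriv (wedge θ ε) x) • L (wedge θ ε x) =
      (2 * Real.pi * Complex.I) • L z := by
  have h₀ := hL.angle_pos
  have h₁ := hL.angle_le
  have hw := isContour_wedge h₀ h₁ hε
  have hzs : z ∈ sector θ := mem_sector_of_re_pos h₀ (by linarith)
  have hz0 := hzs.1
  set M : ℂ → E := fun ζ => L ζ - (z / ζ) • L z with hM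
  have hMd : DifferentiableOn ℂ M (sector θ) := by
    refine hL.differentiableOn.sub (DifferentiableOn.smul_const ?_ _)
    exact DifferentiableOn.div (by fun_prop) (by fun_prop) fun ζ hζ => hζ.1
  have hMz : M z = 0 := by simp [hM, div_self hz0]
  have hNd : DifferentiableOn ℂ (dslope M z) (sector θ) :=
    (Complex.differentiableOn_dslope ((isOpen_sector h₀ h₁).mem_nhds hzs)).2 hMd
  have hN : ∀ ζ, ζ ≠ z → dslope M z ζ = (ζ - z)⁻¹ • M ζ := fun ζ hζ => by
    rw [dslope_of_ne _ hζ, slope_def_module, hMz, sub_zero]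
  obtain ⟨G, hG⟩ := exists_primitive_sector h₁ hNd
  have hGlim : Tendsto (fun y => G (wedge θ ε y) - G (wedge θ ε (-y))) atTop (𝓝 0) := by
    have hr := (tendsto_norm_wedge (ε := ε) h₀ h₁).1
    have hlim : Tendsto (fun r : ℝ => 2 * (C * r ^ (-α) + ‖z‖ * ‖L z‖ / r) * (2 * Real.pi))
        atTop (𝓝 0) := by
      have l1 := (tendsto_rpow_neg_atTop hL.exponent_pos).const_mul C
      have l2 : Tendsto (fun r : ℝ => ‖z‖ * ‖L z‖ / r) atTop (𝓝 0) := tendsto_id.const_div_atTop _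
      simpa using ((l1.add l2).const_mul 2).mul_const (2 * Real.pi)
    refine squeeze_zero_norm' ?_ (hlim.comp hr)
    filter_upwards [hr.eventually_ge_atTop (2 * ‖z‖)] with y hy
    have hwpos : 0 < ‖wedge θ ε y‖ := norm_pos_iff.2 (hw.mem_sector y).1
    have hzpos : 0 < ‖z‖ := norm_pos_iff.2 hz0
    rw [wedge_neg]
    set r := ‖wedge θ ε y‖ with hrdef
    have hC := hL.const_nonneg
    have := norm_sub_conj_le_of_arc (r := r) (K := (r / 2)⁻¹ * (C * r ^ (-α) + ‖z‖ * ‖L z‖ / r))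
      h₁ hG ?_ (hw.mem_sector y) rfl
    · refine this.trans (le_of_eq ?_)
      simp only [Function.comp]
      rw [← hrdef]
      field_simp
    · intro ζ hζ hζr
      have hne : ζ ≠ z := fun h => by rw [h] at hζr; linarith
      rw [hN ζ hne, norm_smul, norm_inv]
      have e1 : r / 2 ≤ ‖ζ - z‖ := by
        have := norm_sub_norm_le ζ z
        linarith
      have e2 : ‖M ζ‖ ≤ C * r ^ (-α) + ‖z‖ * ‖L z‖ / r := by
        refine (norm_sub_le _ _).trans (add_le_add ?_ ?_)
        · simpa [hζr] using hL.bound ζ hζ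
        · rw [norm_smul, norm_div, hζr]; apply le_of_eq; ring
      gcongr
  have hne : ∀ x, wedge θ ε x ≠ z := fun x h => by
    have := wedge_re_le h₀ h₁ ε x
    rw [h] at this; linarith
  set U : Set ℂ := {ζ | ζ ∈ sector θ ∧ ζ.re < z.re} with hU
  have hwU : ∀ x, wedge θ ε x ∈ U := fun x =>
    ⟨hw.mem_sector x, lt_of_le_of_lt (wedge_re_le h₀ h₁ ε x) (by linarith)⟩
  have hlogd : ∀ ζ ∈ U, HasDerivAt (fun ζ => Complex.log ζ - Complex.log (z - ζ))
      (ζ⁻¹ + (z - ζ)⁻¹) ζ := fun ζ hζ => by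
    have d1 := Complex.hasDerivAt_log (sector_subset_slitPlane h₁ hζ.1)
    have d2 : HasDerivAt (fun ζ => Complex.log (z - ζ)) (-1 / (z - ζ)) ζ :=
      ((hasDerivAt_id ζ).const_sub z).clog
        (Or.inl (by simpa using hζ.2))
    have d3 := d1.sub d2
    rw [neg_div, sub_neg_eq_add, one_div] at d3
    exact d3
  have hlogc : ContinuousOn (fun ζ : ℂ => ζ⁻¹ + (z - ζ)⁻¹) U := by
    refine (continuousOn_id.inv₀ fun ζ hζ => hζ.1.1).add
      ((continuousOn_const.sub continuousOn_id).inv₀ fun ζ hζ => ?_)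
    intro h
    have := hζ.2
    rw [sub_eq_zero.1 (show z - ζ = 0 from h)] at this
    exact lt_irrefl _ this
  have I₁ := intervalIntegral_tendsto_integral (hL.integrable_cauchy hε hz)
    tendsto_neg_atTop_atBot tendsto_id
  refine tendsto_nhds_unique I₁ ?_
  have hfin := ((tendsto_log_wedge h₀ h₁ z ε).smul_const (L z)).sub hGlim
  rw [sub_zero] at hfin
  refine hfin.congr fun y => ?_
  rw [← hw.integral_eq_sub hw.mem_sector hG hNd.continuousOn,
    ← hw.integral_eq_sub hwU hlogd hlogc, ← intervalIntegral.integral_smul_const,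
    ← intervalIntegral.integral_sub]
  · refine intervalIntegral.integral_congr fun x _ => ?_
    rw [hN _ (hne x)]
    have n1 : z - wedge θ ε x ≠ 0 := sub_ne_zero.2 (hne x).symm
    have n2 : wedge θ ε x - z ≠ 0 := sub_ne_zero.2 (hne x)
    have n3 := (hw.mem_sector x).1
    rw [hM]
    simp only [smul_sub, smul_smul, smul_eq_mul]
    rw [show (wedge θ ε x - z)⁻¹ = -(z - wedge θ ε x)⁻¹ by rw [← neg_sub, inv_neg]]
    rw [sub_sub_eq_add_sub, ← sub_eq_zero]
    have e : deriv (wedge θ ε) x * ((wedge θ ε x)⁻¹ + (z - wedge θ ε x)⁻¹) =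
        -(deriv (wedge θ ε) x * (-(z - wedge θ ε x)⁻¹ * (z / wedge θ ε x))) := by
      field_simp; ring
    rw [e]
    module
  · exact ((hw.intervalIntegrable_deriv _ _).smul_continuousOn
      (hlogc.comp_continuous hw.continuous hwU).continuousOn).smul_continuousOn
      continuousOn_const
  · exact (hw.intervalIntegrable_deriv _ _).smul_continuousOn
      (hNd.continuousOn.comp_continuous hw.continuous hw.mem_sector).continuousOn

end LaplaceTransform

section LaplaceTransform

variable {E : Type*} [NormedAddCommGroup E] [NormedSpace ℂ E]
variable {L : ℂ → E} {θ α C : ℝ} {γ : ℝ → ℂ}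

theorem integrableOn_rpow_mul_exp {a b : ℝ} (ha : 0 < a) (hb : 0 < b) :
    IntegrableOn (fun t : ℝ => t ^ (a - 1) * Real.exp (-(b * t))) (Ioi 0) := by
  have := integrableOn_rpow_mul_exp_neg_mul_rpow (p := 1) (s := a - 1) (b := b) (by linarith)
    one_pos hb
  simpa using this

/-- A kernel with a singularity of order `α - 1` has an absolutely convergent Laplace transform. -/
theorem integrableOn_exp_smul {p : ℝ → E} {M : ℝ} (hα : 0 < α) (hp : ContinuousOn p (Ioi 0))
    (hM : ∀ t > 0, ‖p t‖ ≤ M * t ^ (α - 1)) {z : ℂ} (hz : 0 < z.re) :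
    IntegrableOn (fun t : ℝ => Complex.exp (-z * (t : ℂ)) • p t) (Ioi 0) := by
  refine ((integrableOn_rpow_mul_exp hα hz).const_mul M).mono' ?_ ?_
  · refine ContinuousOn.aestronglyMeasurable (ContinuousOn.smul ?_ hp) measurableSet_Ioi
    fun_prop
  · refine (ae_restrict_iff' measurableSet_Ioi).2 (ae_of_all _ fun t ht => ?_)
    rw [norm_smul, norm_exp_mul_ofReal, mul_comm, ← mul_assoc,
      show t * (-z).re = -(z.re * t) by simp [mul_comm]]
    gcongr
    exact hM t ht

theorem HasDecay.integrableOn_laplace [CompleteSpace E] (hL : HasDecay L θ α C)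
    (hγ : IsContour θ γ) {z : ℂ} (hz : 0 < z.re) :
    IntegrableOn (fun t : ℝ => Complex.exp (-z * (t : ℂ)) • invLaplace L γ t) (Ioi 0) := by
  obtain ⟨M, -, hM⟩ := hL.exists_norm_invLaplace_le hγ
  exact integrableOn_exp_smul hL.exponent_pos
    (fun t ht => (hL.continuousAt_invLaplace hγ ht).continuousWithinAt) hM hz

theorem integral_exp_neg_mul_Ioi {b : ℝ} (hb : 0 < b) :
    ∫ t in Ioi (0 : ℝ), Real.exp (-(b * t)) = b⁻¹ := by
  have := Real.integral_rpow_mul_exp_neg_mul_Ioi (a := 1) one_pos hb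
  simpa using this

theorem integral_cexp_neg_mul_Ioi {z : ℂ} (hz : 0 < z.re) :
    ∫ t in Ioi (0 : ℝ), Complex.exp (-z * (t : ℂ)) = z⁻¹ := by
  rw [integral_exp_mul_complex_Ioi (by simpa using hz) 0]
  simp [neg_div_neg_eq]

theorem integrableOn_cexp_neg_mul_Ioi {z : ℂ} (hz : 0 < z.re) :
    IntegrableOn (fun t : ℝ => Complex.exp (-z * (t : ℂ))) (Ioi 0) :=
  integrableOn_exp_mul_complex_Ioi (by simpa using hz) 0

/-- The Laplace transform of the inverse Laplace transform. -/
theorem HasDecay.laplace_invLaplace [CompleteSpace E] (hL : HasDecay L θ α C)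
    (hγ : IsContour θ γ) {z : ℂ} (hz : 0 < z.re) :
    ∫ t in Ioi (0 : ℝ), Complex.exp (-z * (t : ℂ)) • invLaplace L γ t = L z := by
  have h₀ := hL.angle_pos
  have h₁ := hL.angle_le
  obtain ⟨ε, hε, hzε⟩ : ∃ ε > 0, z.re = 2 * ε := ⟨z.re / 2, by positivity, by ring⟩
  have hw := isContour_wedge h₀ h₁ hε
  have hs := sin_half_pos h₀ h₁
  set w := wedge θ ε with hwdef
  set f : ℝ → ℝ → E := fun t x => Complex.exp (-z * (t : ℂ)) • laplaceIntegrand L w t x with hf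
  have hzw : ∀ x, (z - w x).re = ε + Real.sin (θ / 2) * |x| := fun x => by
    simp only [hwdef, wedge, Complex.sub_re, hzε]; ring
  have hzwpos : ∀ x, 0 < (z - w x).re := fun x => by rw [hzw]; positivity
  have hfeq : ∀ t x, f t x =
      Complex.exp (-(z - w x) * (t : ℂ)) • (deriv w x • L (w x)) := fun t x => by
    simp only [hf, laplaceIntegrand, smul_smul, ← mul_assoc, ← Complex.exp_add]
    congr 3; ring
  have hmeas : AEStronglyMeasurable (Function.uncurry f)
      ((volume.restrict (Ioi (0 : ℝ))).prod volume) := by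
    have e1 : Continuous fun q : ℝ × ℝ => Complex.exp (-(z - w q.2) * (q.1 : ℂ)) := by
      have := hw.continuous; fun_prop
    have e2 : AEStronglyMeasurable (fun x => deriv w x • L (w x)) volume :=
      (measurable_deriv _).aestronglyMeasurable.smul (hL.continuous_comp hw).aestronglyMeasurable
    have := e1.aestronglyMeasurable (μ := (volume.restrict (Ioi (0 : ℝ))).prod volume) |>.smul
      (e2.comp_snd (μ := volume.restrict (Ioi (0 : ℝ))))
    refine this.congr (ae_of_all _ fun q => ?_)
    simp [Function.uncurry, hfeq]
  have hint : Integrable (Function.uncurry f) ((volume.restrict (Ioi (0 : ℝ))).prod volume) := by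
    rw [integrable_prod_iff' hmeas]
    refine ⟨ae_of_all _ fun x => ?_, ?_⟩
    · simp only [Function.uncurry, hfeq]
      exact (integrableOn_cexp_neg_mul_Ioi (hzwpos x)).smul_const _
    · refine (hL.integrable_wedge hε).congr ?_
      filter_upwards [ae_norm_deriv_wedge θ ε] with x hx
      simp only [Function.uncurry, hfeq, norm_smul, norm_exp_mul_ofReal]
      rw [hx, one_mul, integral_mul_const, ← hzw x, ← integral_exp_neg_mul_Ioi (hzwpos x)]
      congr 1
      refine setIntegral_congr_fun measurableSet_Ioi fun t _ => ?_
      congr 1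
      simp only [Complex.neg_re]; ring
  have h1 : ∫ t in Ioi (0 : ℝ), Complex.exp (-z * (t : ℂ)) • invLaplace L γ t =
      (1 / (2 * (Real.pi : ℂ) * Complex.I)) • ∫ t in Ioi (0 : ℝ), ∫ x, f t x := by
    rw [← integral_smul]
    refine setIntegral_congr_fun measurableSet_Ioi fun t ht => ?_
    simp only [hf]
    rw [hL.invLaplace_eq_wedge hγ ht hε, invLaplace, smul_comm, integral_smul]
  rw [h1, integral_integral_swap hint]
  have h2 : ∫ x, ∫ t in Ioi (0 : ℝ), f t x = (2 * Real.pi * Complex.I) • L z := by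
    rw [← hL.integral_cauchy hε hzε]
    congr 1 with x
    simp only [hfeq]
    rw [integral_smul_const, integral_cexp_neg_mul_Ioi (hzwpos x), smul_smul]
  rw [h2, smul_smul, one_div, inv_mul_cancel₀ Complex.two_pi_I_ne_zero, one_smul]

end LaplaceTransform

section PowerKernel

theorem cpow_ofReal_ofReal_mul {r : ℝ} (hr : 0 < r) (z : ℂ) (y : ℝ) :
    ((r : ℂ) * z) ^ (y : ℂ) = ((r ^ y : ℝ) : ℂ) * z ^ (y : ℂ) := by
  rw [Complex.cpow_ofReal, Complex.cpow_ofReal, Complex.arg_real_mul _ hr, norm_mul,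
    Complex.norm_of_nonneg hr.le, Real.mul_rpow hr.le (norm_nonneg _)]
  push_cast
  ring

theorem hasDecay_cpow {β : ℝ} (hβ : 0 < β) :
    HasDecay (fun z : ℂ => z ^ ((-β : ℝ) : ℂ)) (Real.pi / 2) β 1 := by
  refine ⟨by positivity, le_rfl, hβ, zero_le_one, ?_, fun z _ => ?_⟩
  · exact DifferentiableOn.cpow_const differentiableOn_id
      fun z hz => sector_subset_slitPlane le_rfl hz
  · rw [Complex.norm_cpow_real, one_mul]

theorem wedge_inv {t : ℝ} (ht : 0 < t) (θ x : ℝ) :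
    wedge θ t⁻¹ x = ((t⁻¹ : ℝ) : ℂ) * wedge θ 1 (t * x) := by
  apply Complex.ext
  · simp [wedge, abs_mul, abs_of_pos ht]; field_simp
  · simp [wedge]; field_simp

theorem deriv_wedge_inv {t : ℝ} (ht : 0 < t) (θ : ℝ) {x : ℝ} (hx : x ≠ 0) :
    deriv (wedge θ t⁻¹) x = deriv (wedge θ 1) (t * x) := by
  rcases lt_or_gt_of_ne hx with hx | hx
  · rw [(hasDerivAt_wedge_of_neg hx).deriv,
      (hasDerivAt_wedge_of_neg (mul_neg_of_pos_of_neg ht hx)).deriv]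
  · rw [(hasDerivAt_wedge_of_pos hx).deriv, (hasDerivAt_wedge_of_pos (mul_pos ht hx)).deriv]

theorem invLaplace_cpow {β t : ℝ} (hβ : 0 < β) (ht : 0 < t) :
    invLaplace (fun z : ℂ => z ^ ((-β : ℝ) : ℂ)) (wedge (Real.pi / 2) 1) t =
      ((t ^ (β - 1) : ℝ) : ℂ) *
        invLaplace (fun z : ℂ => z ^ ((-β : ℝ) : ℂ)) (wedge (Real.pi / 2) 1) 1 := by
  have hL := hasDecay_cpow hβ
  have hw := isContour_wedge hL.angle_pos hL.angle_le one_pos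
  rw [hL.invLaplace_eq_wedge hw ht (inv_pos.2 ht), invLaplace, invLaplace]
  simp only [smul_eq_mul]
  rw [mul_left_comm]
  congr 1
  have h1 : ∀ᵐ x : ℝ, laplaceIntegrand (fun z : ℂ => z ^ ((-β : ℝ) : ℂ))
      (wedge (Real.pi / 2) t⁻¹) t x = ((t ^ β : ℝ) : ℂ) *
        laplaceIntegrand (fun z : ℂ => z ^ ((-β : ℝ) : ℂ)) (wedge (Real.pi / 2) 1) 1 (t * x) := by
    filter_upwards [compl_mem_ae_iff.2 (measure_singleton (0 : ℝ))] with x hx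
    have ht' : (t : ℂ) ≠ 0 := by exact_mod_cast ht.ne'
    simp only [laplaceIntegrand, smul_eq_mul]
    rw [deriv_wedge_inv ht _ (by simpa using hx), wedge_inv ht,
      cpow_ofReal_ofReal_mul (inv_pos.2 ht), Real.inv_rpow ht.le, Real.rpow_neg ht.le, inv_inv]
    have : ((t⁻¹ : ℝ) : ℂ) * wedge (Real.pi / 2) 1 (t * x) * (t : ℂ) =
        wedge (Real.pi / 2) 1 (t * x) * ((1 : ℝ) : ℂ) := by
      push_cast; field_simp
    rw [this]
    ring
  rw [integral_congr_ae h1, integral_const_mul,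
    Measure.integral_comp_mul_left (fun x => laplaceIntegrand (fun z : ℂ => z ^ ((-β : ℝ) : ℂ))
      (wedge (Real.pi / 2) 1) 1 x) t, abs_of_pos (inv_pos.2 ht), Real.rpow_sub_one ht.ne',
    Complex.real_smul]
  push_cast
  ring

theorem Phi_of_pos {β t : ℝ} (ht : 0 < t) : Phi β t = t ^ (β - 1) / Real.Gamma β := if_pos ht

theorem Phi_one_of_pos {t : ℝ} (ht : 0 < t) : Phi 1 t = 1 := by
  rw [Phi_of_pos ht]; simp

theorem Phi_nonneg {β : ℝ} (hβ : 0 < β) (t : ℝ) : 0 ≤ Phi β t := by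
  rw [Phi]
  split_ifs with h
  · have := Real.Gamma_pos_of_pos hβ; positivity
  · exact le_rfl

theorem measurable_Phi (β : ℝ) : Measurable (Phi β) :=
  Measurable.ite measurableSet_Ioi (by fun_prop) measurable_const

theorem continuousAt_Phi {β t : ℝ} (ht : 0 < t) : ContinuousAt (Phi β) t := by
  have h : ContinuousAt (fun t : ℝ => t ^ (β - 1) / Real.Gamma β) t :=
    (Real.continuousAt_rpow_const t _ (Or.inl ht.ne')).div_const _
  refine h.congr ?_
  filter_upwards [lt_mem_nhds ht] with s hs
  exact (Phi_of_pos hs).symm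

theorem norm_Phi_le {β : ℝ} (hβ : 0 < β) {t : ℝ} (ht : 0 < t) :
    ‖((Phi β t : ℝ) : ℂ)‖ ≤ (Real.Gamma β)⁻¹ * t ^ (β - 1) := by
  rw [Complex.norm_of_nonneg (Phi_nonneg hβ t), Phi_of_pos ht, div_eq_inv_mul]

theorem integrableOn_exp_Phi {β : ℝ} (hβ : 0 < β) {z : ℂ} (hz : 0 < z.re) :
    IntegrableOn (fun t : ℝ => Complex.exp (-z * (t : ℂ)) • ((Phi β t : ℝ) : ℂ)) (Ioi 0) :=
  integrableOn_exp_smul hβ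
    (fun _ ht => (Complex.continuous_ofReal.continuousAt.comp
      (continuousAt_Phi ht)).continuousWithinAt) (fun _ ht => norm_Phi_le hβ ht) hz

/-- The Laplace transform of `Phi β`. -/
theorem laplace_Phi {β : ℝ} (hβ : 0 < β) {z : ℂ} (hz : 0 < z.re) :
    ∫ t in Ioi (0 : ℝ), Complex.exp (-z * (t : ℂ)) • ((Phi β t : ℝ) : ℂ) =
      z ^ ((-β : ℝ) : ℂ) := by
  have hL := hasDecay_cpow hβ
  have hw := isContour_wedge hL.angle_pos hL.angle_le one_pos
  have hΓ := Real.Gamma_pos_of_pos hβ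
  set p := invLaplace (fun z : ℂ => z ^ ((-β : ℝ) : ℂ)) (wedge (Real.pi / 2) 1) 1 with hp
  have key : ∀ z : ℂ, 0 < z.re →
      Real.Gamma β * p * ∫ t in Ioi (0 : ℝ), Complex.exp (-z * (t : ℂ)) • ((Phi β t : ℝ) : ℂ) =
        z ^ ((-β : ℝ) : ℂ) := fun z hz => by
    rw [← hL.laplace_invLaplace hw hz, ← integral_const_mul]
    refine setIntegral_congr_fun measurableSet_Ioi fun t ht => ?_
    have hΓ' : (Real.Gamma β : ℂ) ≠ 0 := by exact_mod_cast hΓ.ne'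
    simp only [smul_eq_mul]
    rw [invLaplace_cpow hβ ht, Phi_of_pos ht, ← hp]
    push_cast
    field_simp
  have h1 := key 1 (by simp)
  have h2 : ∫ t in Ioi (0 : ℝ), Complex.exp (-1 * (t : ℂ)) • ((Phi β t : ℝ) : ℂ) = 1 := by
    have h3 : ∫ t in Ioi (0 : ℝ), Complex.exp (-1 * (t : ℂ)) • ((Phi β t : ℝ) : ℂ) =
        ∫ t in Ioi (0 : ℝ), (((Real.Gamma β)⁻¹ * (t ^ (β - 1) * Real.exp (-(1 * t))) : ℝ) : ℂ) := by
      refine setIntegral_congr_fun measurableSet_Ioi fun t ht => ?_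
      simp only [smul_eq_mul]
      rw [Phi_of_pos ht]
      push_cast
      rw [one_mul, neg_one_mul]; ring
    rw [h3, integral_complex_ofReal, integral_const_mul,
      Real.integral_rpow_mul_exp_neg_mul_Ioi hβ one_pos]
    simp [hΓ.ne']
  rw [h2, mul_one, Complex.one_cpow] at h1
  rw [← key z hz, h1, one_mul]

/-- The Beta integral converges. -/
theorem intervalIntegrable_beta {a b : ℝ} (ha : 0 < a) (hb : 0 < b) :
    IntervalIntegrable (fun s : ℝ => (1 - s) ^ (b - 1) * s ^ (a - 1)) volume 0 1 := by
  have h := (Complex.betaIntegral_convergent (u := a) (v := b) (by simpa) (by simpa)).norm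
  rw [intervalIntegrable_iff_integrableOn_Ioo_of_le zero_le_one] at h ⊢
  refine h.congr_fun (fun s hs => ?_) measurableSet_Ioo
  have h1 : (1 : ℂ) - (s : ℂ) = ((1 - s : ℝ) : ℂ) := by push_cast; rfl
  simp only [norm_mul]
  rw [h1, Complex.norm_cpow_eq_rpow_re_of_pos hs.1,
    Complex.norm_cpow_eq_rpow_re_of_pos (by linarith [hs.2])]
  simp [mul_comm]

theorem intervalIntegrable_beta_scaled {a b t : ℝ} (ha : 0 < a) (hb : 0 < b) (ht : 0 < t) :
    IntervalIntegrable (fun s : ℝ => (t - s) ^ (b - 1) * s ^ (a - 1)) volume 0 t := by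
  have h := ((intervalIntegrable_beta ha hb).comp_mul_left (c := t⁻¹)).const_mul
    (t ^ (b - 1) * t ^ (a - 1))
  simp only [zero_div, one_div, inv_inv] at h
  rw [intervalIntegrable_iff_integrableOn_Ioo_of_le ht.le] at h ⊢
  refine h.congr_fun (fun s hs => ?_) measurableSet_Ioo
  have h1 : 1 - t⁻¹ * s = t⁻¹ * (t - s) := by field_simp
  have h2 : 0 < t - s := by linarith [hs.2]
  simp only
  rw [h1, Real.mul_rpow (by positivity) h2.le, Real.mul_rpow (by positivity) hs.1.le,
    Real.inv_rpow ht.le, Real.inv_rpow ht.le]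
  have p1 := Real.rpow_pos_of_pos ht (b - 1)
  have p2 := Real.rpow_pos_of_pos ht (a - 1)
  field_simp

end PowerKernel

section PhiConv

variable {E : Type*} [NormedAddCommGroup E] [NormedSpace ℂ E]

theorem phiConv_one (f : ℝ → E) {t : ℝ} (ht : 0 ≤ t) : phiConv 1 f t = ∫ s in (0 : ℝ)..t, f s := by
  rw [phiConv, intervalIntegral.integral_of_le ht, intervalIntegral.integral_of_le ht,
    integral_Ioc_eq_integral_Ioo, integral_Ioc_eq_integral_Ioo]
  refine setIntegral_congr_fun measurableSet_Ioo fun s hs => ?_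
  rw [Phi_one_of_pos (by linarith [hs.2]), one_smul]

theorem intervalIntegrable_phiConv {p : ℝ → E} {M a β t : ℝ} (ha : 0 < a) (hβ : 0 < β)
    (ht : 0 < t) (hp : ContinuousOn p (Ioo 0 t)) (hM : ∀ s ∈ Ioo 0 t, ‖p s‖ ≤ M * s ^ (a - 1)) :
    IntervalIntegrable (fun s => Phi β (t - s) • p s) volume 0 t := by
  have h := (intervalIntegrable_beta_scaled ha hβ ht).const_mul ((Real.Gamma β)⁻¹ * M)
  rw [intervalIntegrable_iff_integrableOn_Ioo_of_le ht.le] at h ⊢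
  refine h.mono' ?_ ((ae_restrict_iff' measurableSet_Ioo).2 (ae_of_all _ fun s hs => ?_))
  · have hm : Measurable fun s => Phi β (t - s) :=
      (measurable_Phi β).comp (measurable_const.sub measurable_id)
    exact hm.aestronglyMeasurable.smul (hp.aestronglyMeasurable measurableSet_Ioo)
  · have hts : 0 < t - s := by linarith [hs.2]
    have hΓ := Real.Gamma_pos_of_pos hβ
    rw [norm_smul, Real.norm_of_nonneg (Phi_nonneg hβ _), Phi_of_pos hts]
    calc _ ≤ (t - s) ^ (β - 1) / Real.Gamma β * (M * s ^ (a - 1)) := by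
          gcongr; exact hM s hs
      _ = _ := by rw [div_eq_inv_mul]; ring

theorem continuousAt_phiConv {p : ℝ → E} {M a β t : ℝ} (ha : 0 < a) (hβ : 0 < β) (ht : 0 < t)
    (hp : ContinuousOn p (Ioi 0)) (hM : ∀ s > 0, ‖p s‖ ≤ M * s ^ (a - 1)) :
    ContinuousAt (phiConv β p) t := by
  have hscale : ∀ s, phiConv β p s = s • ∫ x in (0 : ℝ)..1, Phi β (s - s * x) • p (s * x) := by
    intro s
    rw [intervalIntegral.smul_integral_comp_mul_left (f := fun x => Phi β (s - x) • p x)]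
    simp [phiConv]
  rw [show phiConv β p = fun s => s • ∫ x in (0 : ℝ)..1, Phi β (s - s * x) • p (s * x) from
    funext hscale]
  refine continuousAt_id.smul ?_
  have hΓ := Real.Gamma_pos_of_pos hβ
  have hM0 : 0 ≤ M := by simpa using (norm_nonneg _).trans (hM 1 one_pos)
  have hcont : ContinuousOn (fun s : ℝ => s ^ (β - 1) * s ^ (a - 1)) (Icc (t / 2) (2 * t)) := by
    refine ContinuousOn.mul ?_ ?_ <;>
    · intro s hs
      exact (Real.continuousAt_rpow_const s _ (Or.inl (by linarith [hs.1]))).continuousWithinAt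
  obtain ⟨B, hB⟩ := (isCompact_Icc.image_of_continuousOn hcont).bddAbove
  refine intervalIntegral.continuousAt_of_dominated_interval
    (bound := fun x => (Real.Gamma β)⁻¹ * M * B * ((1 - x) ^ (β - 1) * x ^ (a - 1))) ?_ ?_
    ((intervalIntegrable_beta ha hβ).const_mul _) ?_
  · filter_upwards [lt_mem_nhds ht] with s hs
    rw [uIoc_of_le zero_le_one]
    have hm : Measurable fun x => Phi β (s - s * x) := (measurable_Phi β).comp (by fun_prop)
    exact hm.aestronglyMeasurable.smul
      (ContinuousOn.aestronglyMeasurable (hp.comp (by fun_prop) fun x hx => mul_pos hs hx.1)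
        measurableSet_Ioc)
  · filter_upwards [Icc_mem_nhds (show t / 2 < t by linarith) (show t < 2 * t by linarith)]
      with s hs
    have hs0 : 0 < s := by linarith [hs.1]
    filter_upwards [compl_mem_ae_iff.2 (measure_singleton (1 : ℝ))] with x hx1 hx
    rw [uIoc_of_le zero_le_one] at hx
    have hx2 : x < 1 := lt_of_le_of_ne hx.2 (by simpa using hx1)
    have h1 : s - s * x = s * (1 - x) := by ring
    have h2 : 0 < 1 - x := by linarith
    have h3 : 0 < x := hx.1
    rw [norm_smul, Real.norm_of_nonneg (Phi_nonneg hβ _), h1, Phi_of_pos (mul_pos hs0 h2)]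
    have hBs : s ^ (β - 1) * s ^ (a - 1) ≤ B := hB ⟨s, hs, rfl⟩
    calc _ ≤ (s * (1 - x)) ^ (β - 1) / Real.Gamma β * (M * (s * x) ^ (a - 1)) := by
          gcongr; exact hM _ (mul_pos hs0 hx.1)
      _ = (Real.Gamma β)⁻¹ * M * (s ^ (β - 1) * s ^ (a - 1)) *
          ((1 - x) ^ (β - 1) * x ^ (a - 1)) := by
          rw [Real.mul_rpow hs0.le h2.le, Real.mul_rpow hs0.le hx.1.le]; ring
      _ ≤ _ := by gcongr
  · filter_upwards [compl_mem_ae_iff.2 (measure_singleton (1 : ℝ))] with x hx1 hx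
    rw [uIoc_of_le zero_le_one] at hx
    have hx2 : x < 1 := lt_of_le_of_ne hx.2 (by simpa using hx1)
    have h1 : ContinuousAt (fun s => Phi β (s - s * x)) t :=
      ContinuousAt.comp' (f := fun s => s - s * x) (continuousAt_Phi (by nlinarith))
        (Continuous.continuousAt (by fun_prop))
    exact h1.smul (ContinuousAt.comp' (f := fun s => s * x)
      (hp.continuousAt (Ioi_mem_nhds (mul_pos ht hx.1))) (Continuous.continuousAt (by fun_prop)))

theorem exp_smul_phiConv (β : ℝ) (p : ℝ → E) (z : ℂ) (t : ℝ) :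
    Complex.exp (-z * (t : ℂ)) • phiConv β p t =
      ∫ s in (0 : ℝ)..t, (ContinuousLinearMap.lsmul ℝ ℂ : ℂ →L[ℝ] E →L[ℝ] E).flip
        (Complex.exp (-z * (s : ℂ)) • p s)
        (Complex.exp (-z * ((t - s : ℝ) : ℂ)) • ((Phi β (t - s) : ℝ) : ℂ)) := by
  rw [phiConv, ← intervalIntegral.integral_smul]
  refine intervalIntegral.integral_congr fun s _ => ?_
  simp only [ContinuousLinearMap.flip_apply, ContinuousLinearMap.lsmul_apply, smul_eq_mul,
    smul_smul]
  rw [show Phi β (t - s) • p s = ((Phi β (t - s) : ℝ) : ℂ) • p s from (Complex.coe_smul _ _).symm,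
    smul_smul]
  congr 1
  rw [mul_right_comm, ← Complex.exp_add]
  congr 2
  push_cast; ring

theorem integrableOn_exp_phiConv {β : ℝ} (hβ : 0 < β) {p : ℝ → E} {z : ℂ} (hz : 0 < z.re)
    (hp : IntegrableOn (fun t : ℝ => Complex.exp (-z * (t : ℂ)) • p t) (Ioi 0)) :
    IntegrableOn (fun t : ℝ => Complex.exp (-z * (t : ℂ)) • phiConv β p t) (Ioi 0) := by
  have := integrable_posConvolution hp (integrableOn_exp_Phi hβ hz)
    (ContinuousLinearMap.lsmul ℝ ℂ : ℂ →L[ℝ] E →L[ℝ] E).flip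
  rw [posConvolution, integrable_indicator_iff measurableSet_Ioi] at this
  simpa only [exp_smul_phiConv] using this

theorem laplace_phiConv [CompleteSpace E] {β : ℝ} (hβ : 0 < β) {p : ℝ → E} {z : ℂ}
    (hz : 0 < z.re)
    (hp : IntegrableOn (fun t : ℝ => Complex.exp (-z * (t : ℂ)) • p t) (Ioi 0)) :
    ∫ t in Ioi (0 : ℝ), Complex.exp (-z * (t : ℂ)) • phiConv β p t =
      z ^ ((-β : ℝ) : ℂ) • ∫ t in Ioi (0 : ℝ), Complex.exp (-z * (t : ℂ)) • p t := by
  have := integral_posConvolution hp (integrableOn_exp_Phi hβ hz)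
    (ContinuousLinearMap.lsmul ℝ ℂ : ℂ →L[ℝ] E →L[ℝ] E).flip
  simp only [← exp_smul_phiConv, laplace_Phi hβ hz] at this
  exact this

open FourierTransform in
/-- A continuous function on `(0, ∞)` is determined by its Laplace transform. -/
theorem eq_zero_of_laplace_eq_zero [CompleteSpace E] {f : ℝ → E} (hf : ContinuousOn f (Ioi 0))
    (hi : IntegrableOn (fun t : ℝ => Complex.exp (-1 * (t : ℂ)) • f t) (Ioi 0))
    (h0 : ∀ z : ℂ, 0 < z.re → ∫ t in Ioi (0 : ℝ), Complex.exp (-z * (t : ℂ)) • f t = 0)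
    {t : ℝ} (ht : 0 < t) : f t = 0 := by
  set F : ℝ → E := indicator (Ioi 0) fun t => Complex.exp (-1 * (t : ℂ)) • f t with hF
  have hFi : Integrable F := (integrable_indicator_iff measurableSet_Ioi).2 hi
  have hFF : 𝓕 F = 0 := by
    ext ξ
    rw [Real.fourier_real_eq_integral_exp_smul]
    have h1 : (fun v : ℝ => Complex.exp (((-2 * Real.pi * v * ξ : ℝ) : ℂ) * Complex.I) • F v) =
        indicator (Ioi (0 : ℝ)) fun v : ℝ =>
          Complex.exp (-(1 + 2 * Real.pi * ξ * Complex.I) * (v : ℂ)) • f v := by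
      ext v
      by_cases hv : v ∈ Ioi (0 : ℝ)
      · rw [indicator_of_mem hv, hF, indicator_of_mem hv, smul_smul, ← Complex.exp_add]
        congr 2
        push_cast; ring
      · rw [indicator_of_notMem hv, hF, indicator_of_notMem hv, smul_zero]
    rw [h1, integral_indicator measurableSet_Ioi]
    exact h0 _ (by simp)
  have hc : ContinuousAt F t := by
    have h1 : ContinuousAt (fun t : ℝ => Complex.exp (-1 * (t : ℂ)) • f t) t :=
      ContinuousAt.smul (Continuous.continuousAt (by fun_prop)) (hf.continuousAt (Ioi_mem_nhds ht))
    refine h1.congr ?_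
    filter_upwards [lt_mem_nhds ht] with s hs
    rw [hF, indicator_of_mem (show s ∈ Ioi (0 : ℝ) from hs)]
  have hinv := hFi.fourierInv_fourier_eq (by rw [hFF]; exact integrable_zero _ _ _) hc
  rw [hFF, Real.fourierInv_eq] at hinv
  simp only [Pi.zero_apply, smul_zero, integral_zero] at hinv
  rw [hF, indicator_of_mem (show t ∈ Ioi (0 : ℝ) from ht)] at hinv
  exact (smul_eq_zero.1 hinv.symm).resolve_left (Complex.exp_ne_zero _)

end PhiConv

section Resolvent

variable {X : Type*} [NormedAddCommGroup X] [NormedSpace ℂ X] {A : X →ₗ.[ℂ] X}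

theorem isResolventAt_res {z : ℂ} (hz : z ∈ resolventSet A) : IsResolventAt A z (res A z) := by
  have h : ∃ R : X →L[ℂ] X, IsResolventAt A z R := hz
  rw [res, dif_pos h]
  exact h.choose_spec

theorem one_mem_sector {θ : ℝ} (h : 0 < θ) : (1 : ℂ) ∈ sector θ :=
  mem_sector_of_re_pos h (by simp)

theorem IsSectorial.isResolventAt {θ₀ : ℝ} (hA : IsSectorial A θ₀) {z : ℂ} (hz : z ∈ sector θ₀) :
    IsResolventAt A z (res A z) :=
  isResolventAt_res (hA.subset_resolventSet hz)

/-- The graph of `A` in terms of a resolvent. -/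
theorem IsResolventAt.apply_sub_eq_iff {R : X →L[ℂ] X} (hR : IsResolventAt A 1 R) {x y : X} :
    R (x - y) = x ↔ x ∈ A.domain ∧ opApply A x = y := by
  constructor
  · intro h
    have h1 := hR.1 (x - y)
    rw [h, one_smul] at h1
    exact ⟨h1.1, sub_right_injective h1.2⟩
  · rintro ⟨hx, rfl⟩
    simpa using hR.2 x hx

theorem IsResolventAt.comm {R S : X →L[ℂ] X} {z w : ℂ} (hR : IsResolventAt A z R)
    (hS : IsResolventAt A w S) (v : X) : S (R v) = R (S v) := by
  have hsub : ∀ {a b c : X}, a - b = c → a - c = b := fun h => by rw [← h]; abel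
  obtain ⟨hx, hxv⟩ := hS.1 v
  obtain ⟨hy, hyv⟩ := hR.1 (S v)
  have h1 := hS.2 _ hy
  have h2 := hR.2 _ hx
  have h3 : w • R (S v) - opApply A (R (S v)) = R v := by
    have e1 : opApply A (R (S v)) = z • R (S v) - S v := (hsub hyv).symm
    have e2 : opApply A (S v) = w • S v - v := (hsub hxv).symm
    rw [e2, map_sub, map_sub, map_smul, map_smul] at h2
    have h4 : z • R (S v) - S v = w • R (S v) - R v := hsub h2
    rw [e1, h4]; abel
  rw [← h3, h1]

theorem IsSectorial.hasDecay {θ₀ α : ℝ} (hA : IsSectorial A θ₀) (hα₀ : 0 < α) (hα₁ : α < 1) :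
    ∃ C, HasDecay (fun z => res A (z ^ (α : ℂ))) (angleOne α θ₀) α C := by
  obtain ⟨C, hC, hb⟩ := hA.bound
  have hmaps : ∀ z ∈ sector (angleOne α θ₀), z ^ (α : ℂ) ∈ sector θ₀ :=
    fun z hz => cpow_mem_sector hα₀ hA.angle_le hz
  refine ⟨C, angleOne_pos hα₀ hα₁ hA.angle_pos, angleOne_le _ _, hα₀, hC.le, ?_, fun z hz => ?_⟩
  · refine hA.analytic.comp ?_ hmaps
    exact DifferentiableOn.cpow_const differentiableOn_id
      fun z hz => sector_subset_slitPlane (angleOne_le _ _) hz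
  · refine (hb _ (hmaps z hz)).trans (le_of_eq ?_)
    rw [Complex.norm_cpow_real, Real.rpow_neg (norm_nonneg _), div_eq_mul_inv]

end Resolvent

section Kernel

variable {X : Type*} [NormedAddCommGroup X] [NormedSpace ℂ X]

/-- The properties of the solution kernel `P` on which the solution theory rests. The operator is
represented by its resolvent `R` at the point `1`: a pair `(x, y)` lies in its graph if and only if
`R (x - y) = x`. -/
structure IsFracKernel (P : ℝ → X →L[ℂ] X) (R : X →L[ℂ] X) (α M : ℝ) : Prop where
  pos : 0 < α
  lt_one : α < 1
  continuousOn : ContinuousOn P (Ioi 0)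
  bound : ∀ t > 0, ‖P t‖ ≤ M * t ^ (α - 1)
  comm : ∀ t > 0, ∀ v, R (P t v) = P t (R v)
  injective : Function.Injective R
  phiConv_eq : ∀ x y : X, R (x - y) = x → ∀ t > 0,
    phiConv (1 - α) (fun s => P s x) t = x + phiConv 1 (fun s => P s y) t

theorem comm_invLaplace [CompleteSpace X] {L : ℂ → X →L[ℂ] X} {θ α C : ℝ} {γ : ℝ → ℂ}
    (hL : HasDecay L θ α C) (hγ : IsContour θ γ) {R : X →L[ℂ] X}
    (hR : ∀ z ∈ sector θ, ∀ v, R (L z v) = L z (R v)) {t : ℝ} (ht : 0 < t) (v : X) :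
    R (invLaplace L γ t v) = invLaplace L γ t (R v) := by
  have hi := hL.integrable hγ ht
  have h1 := ((ContinuousLinearMap.compL ℂ X X X) R).integral_comp_comm hi
  have h2 := ((ContinuousLinearMap.compL ℂ X X X).flip R).integral_comp_comm hi
  have h3 : ((ContinuousLinearMap.compL ℂ X X X) R) (∫ x, laplaceIntegrand L γ t x) =
      ((ContinuousLinearMap.compL ℂ X X X).flip R) (∫ x, laplaceIntegrand L γ t x) := by
    rw [← h1, ← h2]
    congr 1 with x w
    simp [laplaceIntegrand, hR _ (hγ.mem_sector x)]
  have h4 := congrArg (fun B : X →L[ℂ] X => B v) h3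
  simp only [ContinuousLinearMap.flip_apply, ContinuousLinearMap.compL_apply,
    ContinuousLinearMap.comp_apply] at h4
  simp [invLaplace, h4]

variable {A : X →ₗ.[ℂ] X}

theorem IsSectorial.phiConv_invLaplace [CompleteSpace X] {θ₀ α : ℝ} {γ : ℝ → ℂ}
    (hA : IsSectorial A θ₀) (hα₀ : 0 < α) (hα₁ : α < 1) (hγ : IsContour (angleOne α θ₀) γ)
    {x y : X} (hxy : res A 1 (x - y) = x) {t : ℝ} (ht : 0 < t) :
    phiConv (1 - α) (fun s => opP A α γ s x) t = x + phiConv 1 (fun s => opP A α γ s y) t := by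
  obtain ⟨C, hL⟩ := hA.hasDecay hα₀ hα₁
  have hP : opP A α γ = invLaplace (fun z => res A (z ^ (α : ℂ))) γ := rfl
  rw [hP]
  obtain ⟨M, hM0, hM⟩ := hL.exists_norm_invLaplace_le hγ
  set P := invLaplace (fun z => res A (z ^ (α : ℂ))) γ with hPdef
  have hα' : 0 < 1 - α := by linarith
  have hcont : ∀ v, ContinuousOn (fun s => P s v) (Ioi 0) := fun v s hs =>
    ((hL.continuousAt_invLaplace hγ hs).clm_apply continuousAt_const).continuousWithinAt
  have hb : ∀ v, ∀ s > 0, ‖P s v‖ ≤ M * ‖v‖ * s ^ (α - 1) := fun v s hs => by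
    refine ((P s).le_opNorm v).trans ?_
    rw [mul_right_comm]
    gcongr
    exact hM s hs
  have hint : ∀ v, ∀ z : ℂ, 0 < z.re →
      IntegrableOn (fun s : ℝ => Complex.exp (-z * (s : ℂ)) • P s v) (Ioi 0) := fun v z hz =>
    integrableOn_exp_smul hα₀ (hcont v) (hb v) hz
  have hlap : ∀ v, ∀ z : ℂ, 0 < z.re →
      ∫ s in Ioi (0 : ℝ), Complex.exp (-z * (s : ℂ)) • P s v = res A (z ^ (α : ℂ)) v := by
    intro v z hz
    have := hL.laplace_invLaplace hγ hz
    rw [← this, ContinuousLinearMap.integral_apply (hL.integrableOn_laplace hγ hz)]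
    rfl
  have hcx : ∀ z : ℂ, 0 < z.re →
      IntegrableOn (fun s : ℝ => Complex.exp (-z * (s : ℂ)) • x) (Ioi 0) := fun z hz =>
    (integrableOn_cexp_neg_mul_Ioi hz).smul_const x
  have key := eq_zero_of_laplace_eq_zero
    (f := fun t => phiConv (1 - α) (fun s => P s x) t - (x + phiConv 1 (fun s => P s y) t))
    ?_ ?_ ?_ ht
  · exact sub_eq_zero.1 key
  · intro s hs
    exact ((continuousAt_phiConv hα₀ hα' hs (hcont x) (hb x)).sub (continuousAt_const.add
      (continuousAt_phiConv hα₀ one_pos hs (hcont y) (hb y)))).continuousWithinAt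
  · have h1 : (0 : ℝ) < (1 : ℂ).re := by simp
    simp only [smul_sub, smul_add]
    exact (integrableOn_exp_phiConv hα' h1 (hint x 1 h1)).sub
      ((hcx 1 h1).add (integrableOn_exp_phiConv one_pos h1 (hint y 1 h1)))
  · intro z hz
    have i1 := integrableOn_exp_phiConv hα' hz (hint x z hz)
    have i2 := integrableOn_exp_phiConv one_pos hz (hint y z hz)
    simp only [smul_sub, smul_add]
    have e1 := integral_sub i1 ((hcx z hz).add i2)
    have e2 := integral_add (hcx z hz) i2
    simp only [Pi.add_apply] at e1
    rw [e1, e2, laplace_phiConv hα' hz (hint x z hz), laplace_phiConv one_pos hz (hint y z hz),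
      hlap x z hz, hlap y z hz, integral_smul_const, integral_cexp_neg_mul_Ioi hz]
    have hzs : z ∈ sector (angleOne α θ₀) := mem_sector_of_re_pos hL.angle_pos hz
    have hz0 := hzs.1
    have hr := hA.isResolventAt (cpow_mem_sector hα₀ hA.angle_le hzs)
    obtain ⟨hx, rfl⟩ := (hA.isResolventAt (one_mem_sector hA.angle_pos)).apply_sub_eq_iff.1 hxy
    have h2 := hr.2 x hx
    rw [map_sub, map_smul, sub_eq_iff_eq_add] at h2
    have e3 : z ^ (((-(1 - α)) : ℝ) : ℂ) = z⁻¹ * z ^ (α : ℂ) := by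
      rw [show (((-(1 - α)) : ℝ) : ℂ) = (-1 : ℂ) + (α : ℂ) by push_cast; ring,
        Complex.cpow_add _ _ hz0, Complex.cpow_neg_one]
    have e4 : z ^ (((-1 : ℝ)) : ℂ) = z⁻¹ := by
      rw [show (((-1 : ℝ)) : ℂ) = (-1 : ℂ) by push_cast; ring, Complex.cpow_neg_one]
    rw [e3, e4, mul_smul, h2, smul_add, sub_self]

theorem IsSectorial.isFracKernel [CompleteSpace X] {θ₀ α : ℝ} {γ : ℝ → ℂ}
    (hA : IsSectorial A θ₀) (hα₀ : 0 < α) (hα₁ : α < 1) (hγ : IsContour (angleOne α θ₀) γ) :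
    ∃ M, IsFracKernel (opP A α γ) (res A 1) α M := by
  obtain ⟨C, hL⟩ := hA.hasDecay hα₀ hα₁
  obtain ⟨M, -, hM⟩ := hL.exists_norm_invLaplace_le hγ
  have h1 := hA.isResolventAt (one_mem_sector hA.angle_pos)
  refine ⟨M, hα₀, hα₁,
    fun t ht => (hL.continuousAt_invLaplace hγ ht).continuousWithinAt, hM, fun t ht v => ?_,
    fun v w hvw => ?_, fun x y hxy t ht => hA.phiConv_invLaplace hα₀ hα₁ hγ hxy ht⟩
  · exact comm_invLaplace hL hγ (fun z hz v =>
      (hA.isResolventAt (cpow_mem_sector hα₀ hA.angle_le hz)).comm h1 v) ht v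
  · rw [← (h1.1 v).2, ← (h1.1 w).2, hvw]

end Kernel

section Convolution

variable {X : Type*} [NormedAddCommGroup X] [NormedSpace ℂ X]

/-- An operator valued kernel on `(0, ∞)` with a singularity of order `c - 1` at the origin. -/
structure IsKernel (a : ℝ → X →L[ℂ] X) (c K : ℝ) : Prop where
  pos : 0 < c
  continuousOn : ContinuousOn a (Ioi 0)
  bound : ∀ t > 0, ‖a t‖ ≤ K * t ^ (c - 1)

/-- The convolution of an operator valued kernel with a function over `(0, t)`. -/
def kConv (a : ℝ → X →L[ℂ] X) (h : ℝ → X) (t : ℝ) : X :=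
  ∫ s in (0 : ℝ)..t, a (t - s) (h s)

/-- The scalar kernel `Phi β` as an operator valued kernel. -/
def phiOp (X : Type*) [NormedAddCommGroup X] [NormedSpace ℂ X] (β t : ℝ) : X →L[ℂ] X :=
  Phi β t • ContinuousLinearMap.id ℂ X

theorem phiOp_apply (β t : ℝ) (x : X) : phiOp X β t x = Phi β t • x := by
  simp [phiOp]

theorem kConv_phiOp (β : ℝ) (h : ℝ → X) : kConv (phiOp X β) h = phiConv β h := by
  ext t
  simp only [kConv, phiConv, phiOp_apply]

theorem isKernel_phiOp {β : ℝ} (hβ : 0 < β) : IsKernel (phiOp X β) β (Real.Gamma β)⁻¹ := by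
  have hΓ := Real.Gamma_pos_of_pos hβ
  refine ⟨hβ, fun t ht => ?_, fun t ht => ?_⟩
  · have h := continuousAt_Phi (β := β) ht
    exact (h.smul continuousAt_const).continuousWithinAt
  · rw [phiOp, norm_smul, Real.norm_of_nonneg (Phi_nonneg hβ t), Phi_of_pos ht, div_eq_inv_mul]
    have : (Real.Gamma β)⁻¹ * t ^ (β - 1) * ‖ContinuousLinearMap.id ℂ X‖ ≤
        (Real.Gamma β)⁻¹ * t ^ (β - 1) * 1 := by
      have ht' : 0 < t := ht
      gcongr; exact ContinuousLinearMap.norm_id_le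
    simpa using this

theorem IsFracKernel.isKernel {P : ℝ → X →L[ℂ] X} {R : X →L[ℂ] X} {α M : ℝ}
    (h : IsFracKernel P R α M) : IsKernel P α M :=
  ⟨h.pos, h.continuousOn, h.bound⟩

variable {a b : ℝ → X →L[ℂ] X} {c K c' K' : ℝ}

theorem IsKernel.const_nonneg (ha : IsKernel a c K) : 0 ≤ K := by
  simpa using (norm_nonneg _).trans (ha.bound 1 one_pos)

theorem IsKernel.integrableOn (ha : IsKernel a c K) {t : ℝ} (ht : 0 < t) :
    IntegrableOn a (Ioo 0 t) := by
  have h : IntegrableOn (fun s : ℝ => K * s ^ (c - 1)) (Ioo 0 t) :=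
    ((intervalIntegrable_iff_integrableOn_Ioo_of_le ht.le).1
      (intervalIntegral.intervalIntegrable_rpow' (by linarith [ha.pos]))).const_mul K
  refine h.mono' ((ha.continuousOn.mono fun s hs => hs.1).aestronglyMeasurable measurableSet_Ioo)
    ((ae_restrict_iff' measurableSet_Ioo).2 (ae_of_all _ fun s hs => ha.bound s hs.1))

theorem IsKernel.integrable_indicator (ha : IsKernel a c K) {t : ℝ} (ht : 0 < t) :
    Integrable ((Ioo 0 t).indicator fun s => ‖a s‖) :=
  (integrable_indicator_iff measurableSet_Ioo).2 (ha.integrableOn ht).norm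

theorem IsKernel.aestronglyMeasurable (ha : IsKernel a c K) :
    AEStronglyMeasurable ((Ioi 0).indicator a) :=
  (aestronglyMeasurable_indicator_iff measurableSet_Ioi).2
    (ha.continuousOn.aestronglyMeasurable measurableSet_Ioi)

theorem aestronglyMeasurable_clm_apply {S : Type*} [MeasurableSpace S] {μ : Measure S}
    {B : S → X →L[ℂ] X} {f : S → X} (hB : AEStronglyMeasurable B μ)
    (hf : AEStronglyMeasurable f μ) : AEStronglyMeasurable (fun s => B s (f s)) μ :=
  (ContinuousLinearMap.id ℂ (X →L[ℂ] X)).aestronglyMeasurable_comp₂ hB hf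

theorem IsKernel.intervalIntegrable (ha : IsKernel a c K) {h : ℝ → X} {t : ℝ} (ht : 0 ≤ t)
    (hh : ContinuousOn h (Icc 0 t)) :
    IntervalIntegrable (fun s => a (t - s) (h s)) volume 0 t := by
  rcases eq_or_lt_of_le ht with rfl | ht
  · simp
  obtain ⟨B, hB⟩ := isCompact_Icc.exists_bound_of_continuousOn hh
  have h1 : IntervalIntegrable a volume 0 t :=
    (intervalIntegrable_iff_integrableOn_Ioo_of_le ht.le).2 (ha.integrableOn ht)
  have h2 := (h1.comp_sub_left t).symm
  simp only [sub_self, sub_zero] at h2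
  rw [intervalIntegrable_iff_integrableOn_Ioo_of_le ht.le] at h2 ⊢
  refine (h2.norm.mul_const B).mono' ?_ ?_
  · exact aestronglyMeasurable_clm_apply h2.aestronglyMeasurable
      ((hh.mono Ioo_subset_Icc_self).aestronglyMeasurable measurableSet_Ioo)
  · refine (ae_restrict_iff' measurableSet_Ioo).2 (ae_of_all _ fun s hs => ?_)
    refine ((a (t - s)).le_opNorm _).trans ?_
    gcongr
    exact hB s (Ioo_subset_Icc_self hs)

theorem kConv_congr {h k : ℝ → X} {t : ℝ} (ht : 0 ≤ t) (hhk : ∀ s ∈ Ioo 0 t, h s = k s) :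
    kConv a h t = kConv a k t := by
  rw [kConv, kConv, intervalIntegral.integral_of_le ht, intervalIntegral.integral_of_le ht,
    integral_Ioc_eq_integral_Ioo, integral_Ioc_eq_integral_Ioo]
  refine setIntegral_congr_fun measurableSet_Ioo fun s hs => ?_
  simp only [hhk s hs]

theorem IsKernel.continuousOn_kConv (ha : IsKernel a c K) {h : ℝ → X} {T : ℝ}
    (hh : ContinuousOn h (Ico 0 T)) : ContinuousOn (kConv a h) (Ico 0 T) := by
  intro t₀ ht₀
  obtain ⟨T', hT₁, hT₂⟩ := exists_between ht₀.2
  have hT0 : 0 < T' := ht₀.1.trans_lt hT₁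
  set k : ℝ → X := IccExtend hT0.le ((Icc 0 T').domRestrict h) with hk
  have hcont : Continuous k :=
    (continuousOn_iff_continuous_domRestrict.1
      (hh.mono fun s hs => ⟨hs.1, hs.2.trans_lt hT₂⟩)).Icc_extend'
  have hkh : ∀ s ∈ Icc 0 T', k s = h s := fun s hs => by
    rw [hk, IccExtend_of_mem _ _ hs]; rfl
  obtain ⟨B, hB⟩ : ∃ B, ∀ s, ‖k s‖ ≤ B := by
    obtain ⟨B, hB⟩ := isCompact_Icc.exists_bound_of_continuousOn
      (hh.mono fun s (hs : s ∈ Icc 0 T') => ⟨hs.1, hs.2.trans_lt hT₂⟩)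
    exact ⟨B, fun s => hB _ (projIcc 0 T' hT0.le s).2⟩
  have hB0 : 0 ≤ B := (norm_nonneg _).trans (hB 0)
  set F : ℝ → ℝ → X := fun t s => if s < t then a s (k (t - s)) else 0 with hF
  have hrepr : ∀ t ∈ Icc 0 T', kConv a h t = ∫ s in (0 : ℝ)..T', F t s := by
    intro t ht
    have h1 : kConv a h t = kConv a k t :=
      kConv_congr ht.1 fun s hs => (hkh s ⟨hs.1.le, hs.2.le.trans ht.2⟩).symm
    have h2 : kConv a k t = ∫ s in (0 : ℝ)..t, a s (k (t - s)) := by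
      have := intervalIntegral.integral_comp_sub_left (a := 0) (b := t)
        (fun s => a s (k (t - s))) t
      simp only [sub_sub_cancel, sub_self, sub_zero] at this
      rw [kConv, this]
    rw [h1, h2, intervalIntegral.integral_of_le ht.1, intervalIntegral.integral_of_le hT0.le,
      integral_Ioc_eq_integral_Ioo, ← integral_indicator measurableSet_Ioo,
      ← integral_indicator measurableSet_Ioc]
    congr 1 with s
    simp only [indicator, hF, mem_Ioo, mem_Ioc]
    by_cases h3 : s < t
    · by_cases h4 : 0 < s
      · simp [h3, h4, h3.le.trans ht.2]
      · simp [h4]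
    · simp [h3]
  have hcF : ContinuousWithinAt (fun t => ∫ s in (0 : ℝ)..T', F t s) (Ico 0 T) t₀ := by
    refine intervalIntegral.continuousWithinAt_of_dominated_interval
      (bound := fun s => K * s ^ (c - 1) * B) ?_ ?_ ?_ ?_
    · refine Eventually.of_forall fun t => ?_
      rw [uIoc_of_le hT0.le]
      have h1 : AEStronglyMeasurable (fun s => a s (k (t - s))) (volume.restrict (Ioc 0 T')) :=
        aestronglyMeasurable_clm_apply
          ((ha.continuousOn.mono fun s hs => hs.1).aestronglyMeasurable measurableSet_Ioc)
          (Continuous.aestronglyMeasurable (by fun_prop))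
      exact (h1.indicator (measurableSet_Iio (a := t))).congr
        (ae_of_all _ fun s => by simp [hF, indicator])
    · refine Eventually.of_forall fun t => ae_of_all _ fun s hs => ?_
      rw [uIoc_of_le hT0.le] at hs
      have hK := ha.const_nonneg
      have hs0 : 0 < s := hs.1
      simp only [hF]
      split_ifs
      · refine ((a s).le_opNorm _).trans ?_
        gcongr
        · exact ha.bound s hs.1
        · exact hB _
      · rw [norm_zero]; positivity
    · exact ((intervalIntegral.intervalIntegrable_rpow'
        (by linarith [ha.pos])).const_mul K).mul_const B
    · filter_upwards [compl_mem_ae_iff.2 (measure_singleton t₀)] with s hs _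
      refine ContinuousAt.continuousWithinAt ?_
      rcases lt_or_gt_of_ne (show s ≠ t₀ by simpa using hs) with h1 | h1
      · have h2 : ContinuousAt (fun t => a s (k (t - s))) t₀ :=
          Continuous.continuousAt (by fun_prop)
        refine h2.congr ?_
        filter_upwards [lt_mem_nhds h1] with t ht
        simp [hF, ht]
      · refine (continuousAt_const (y := (0 : X))).congr ?_
        filter_upwards [gt_mem_nhds h1] with t ht
        simp [hF, not_lt.2 ht.le]
  refine hcF.congr_of_eventuallyEq ?_ (hrepr t₀ ⟨ht₀.1, hT₁.le⟩)
  filter_upwards [self_mem_nhdsWithin, mem_nhdsWithin_of_mem_nhds (gt_mem_nhds hT₁)] with t ht ht'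
  exact hrepr t ⟨ht.1, ht'.le⟩

/-- The open triangle `0 < r < s < t` in the `(s, r)` plane. -/
def triangle (t : ℝ) : Set (ℝ × ℝ) := {q | 0 < q.2 ∧ q.2 < q.1 ∧ q.1 < t}

theorem measurableSet_triangle (t : ℝ) : MeasurableSet (triangle t) :=
  (measurableSet_lt measurable_const measurable_snd).inter
    ((measurableSet_lt measurable_snd measurable_fst).inter
      (measurableSet_lt measurable_fst measurable_const))

theorem indicator_triangle_left {Y : Type*} [Zero Y] (F : ℝ × ℝ → Y) {t s : ℝ}
    (hs : s ∈ Ioo 0 t) (r : ℝ) :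
    (triangle t).indicator F (s, r) = (Ioo 0 s).indicator (fun r => F (s, r)) r := by
  by_cases h : r ∈ Ioo 0 s
  · rw [indicator_of_mem h, indicator_of_mem (show (s, r) ∈ triangle t from ⟨h.1, h.2, hs.2⟩)]
  · rw [indicator_of_notMem h,
      indicator_of_notMem (show (s, r) ∉ triangle t from fun h' => h ⟨h'.1, h'.2.1⟩)]

theorem indicator_triangle_right {Y : Type*} [Zero Y] (F : ℝ × ℝ → Y) {t r : ℝ}
    (hr : r ∈ Ioo 0 t) (s : ℝ) :
    (triangle t).indicator F (s, r) = (Ioo r t).indicator (fun s => F (s, r)) s := by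
  by_cases h : s ∈ Ioo r t
  · rw [indicator_of_mem h, indicator_of_mem (show (s, r) ∈ triangle t from ⟨hr.1, h.1, h.2⟩)]
  · rw [indicator_of_notMem h,
      indicator_of_notMem (show (s, r) ∉ triangle t from fun h' => h ⟨h'.2.1, h'.2.2⟩)]

theorem IsKernel.aestronglyMeasurable_triangle (hb : IsKernel b c K) {f : ℝ → X} {t : ℝ}
    (hf : AEStronglyMeasurable f (volume.restrict (Ioo 0 t))) :
    AEStronglyMeasurable (fun q : ℝ × ℝ => b (q.1 - q.2) (f q.2))
      ((volume.prod volume).restrict (triangle t)) := by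
  have h1 : AEStronglyMeasurable (fun q : ℝ × ℝ => (Ioi 0).indicator b (q.1 - q.2))
      (volume.prod volume) :=
    hb.aestronglyMeasurable.comp_quasiMeasurePreserving
      (quasiMeasurePreserving_sub_of_right_invariant volume volume)
  have h2 : AEStronglyMeasurable ((Ioo 0 t).indicator f) :=
    (aestronglyMeasurable_indicator_iff measurableSet_Ioo).2 hf
  refine (aestronglyMeasurable_clm_apply h1 (h2.comp_snd (μ := volume))).restrict.congr ?_
  refine (ae_restrict_iff' (measurableSet_triangle t)).2 (ae_of_all _ fun q hq => ?_)
  have e1 : q.1 - q.2 ∈ Ioi (0 : ℝ) := sub_pos.2 hq.2.1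
  have e2 : q.2 ∈ Ioo 0 t := ⟨hq.1, hq.2.1.trans hq.2.2⟩
  simp only [indicator_of_mem e1, indicator_of_mem e2]

theorem IsKernel.aestronglyMeasurable_triangle' (ha : IsKernel a c' K') (hb : IsKernel b c K)
    {f : ℝ → X} {t : ℝ} (hf : AEStronglyMeasurable f (volume.restrict (Ioo 0 t))) :
    AEStronglyMeasurable (fun q : ℝ × ℝ => a (t - q.1) (b (q.1 - q.2) (f q.2)))
      ((volume.prod volume).restrict (triangle t)) := by
  have h1 : AEStronglyMeasurable (fun s : ℝ => (Ioi 0).indicator a (t - s)) :=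
    ha.aestronglyMeasurable.comp_quasiMeasurePreserving
      (quasiMeasurePreserving_sub_left_of_right_invariant volume t)
  refine (aestronglyMeasurable_clm_apply (h1.comp_fst (ν := volume)).restrict
    (hb.aestronglyMeasurable_triangle hf)).congr ?_
  refine (ae_restrict_iff' (measurableSet_triangle t)).2 (ae_of_all _ fun q hq => ?_)
  have e1 : t - q.1 ∈ Ioi (0 : ℝ) := sub_pos.2 hq.2.2
  simp only [indicator_of_mem e1]

theorem IsKernel.integrable_triangle (hb : IsKernel b c K) {f : ℝ → X} {t : ℝ} (ht : 0 < t)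
    (hf : IntegrableOn f (Ioo 0 t)) :
    IntegrableOn (fun q : ℝ × ℝ => b (q.1 - q.2) (f q.2)) (triangle t) (volume.prod volume) := by
  have h1 := ((integrable_indicator_iff measurableSet_Ioo).2 hf).norm.convolution_integrand
    (ContinuousLinearMap.mul ℝ ℝ) (hb.integrable_indicator ht)
  refine h1.integrableOn.mono' (hb.aestronglyMeasurable_triangle hf.aestronglyMeasurable) ?_
  refine (ae_restrict_iff' (measurableSet_triangle t)).2 (ae_of_all _ fun q hq => ?_)
  have e1 : q.1 - q.2 ∈ Ioo 0 t := ⟨sub_pos.2 hq.2.1, by linarith [hq.1, hq.2.2]⟩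
  have e2 : q.2 ∈ Ioo 0 t := ⟨hq.1, hq.2.1.trans hq.2.2⟩
  simp only [indicator_of_mem e1, indicator_of_mem e2, ContinuousLinearMap.mul_apply']
  rw [mul_comm]
  exact (b (q.1 - q.2)).le_opNorm _

/-- Associativity of convolution, given the integrability that Fubini's theorem needs. -/
theorem IsKernel.kConv_kConv [CompleteSpace X] (hb : IsKernel b c K) {f : ℝ → X} {t : ℝ}
    (ht : 0 < t) (hf : IntegrableOn f (Ioo 0 t))
    (hint : IntegrableOn (fun q : ℝ × ℝ => a (t - q.1) (b (q.1 - q.2) (f q.2))) (triangle t)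
      (volume.prod volume)) :
    IntervalIntegrable (fun r => ∫ s in (0 : ℝ)..(t - r), a (t - r - s) (b s (f r))) volume 0 t ∧
    kConv a (kConv b f) t =
      ∫ r in (0 : ℝ)..t, ∫ s in (0 : ℝ)..(t - r), a (t - r - s) (b s (f r)) := by
  set G : ℝ × ℝ → X := (triangle t).indicator
    fun q : ℝ × ℝ => a (t - q.1) (b (q.1 - q.2) (f q.2)) with hG
  have hGi : Integrable G (volume.prod volume) :=
    (integrable_indicator_iff (measurableSet_triangle t)).2 hint
  have hbi := (integrable_indicator_iff (measurableSet_triangle t)).2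
    (hb.integrable_triangle ht hf)
  have hleft : ∀ᵐ s : ℝ,
      ∫ r, G (s, r) = (Ioo 0 t).indicator (fun s => a (t - s) (kConv b f s)) s := by
    filter_upwards [hbi.prod_right_ae] with s hs
    by_cases hst : s ∈ Ioo 0 t
    · rw [indicator_of_mem hst]
      simp only [indicator_triangle_left _ hst] at hs
      rw [integrable_indicator_iff measurableSet_Ioo] at hs
      rw [kConv, intervalIntegral.integral_of_le hst.1.le, integral_Ioc_eq_integral_Ioo,
        ← ContinuousLinearMap.integral_comp_comm _ hs, ← integral_indicator measurableSet_Ioo]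
      simp only [hG, indicator_triangle_left _ hst]
    · rw [indicator_of_notMem hst]
      refine integral_eq_zero_of_ae (ae_of_all _ fun r => ?_)
      simp only [hG, Pi.zero_apply]
      refine indicator_of_notMem (fun h => hst ⟨h.1.trans h.2.1, h.2.2⟩) _
  have hright : ∀ r : ℝ, ∫ s, G (s, r) = (Ioo 0 t).indicator
      (fun r => ∫ s in (0 : ℝ)..(t - r), a (t - r - s) (b s (f r))) r := by
    intro r
    by_cases hr : r ∈ Ioo 0 t
    · rw [indicator_of_mem hr]
      have h1 := intervalIntegral.integral_comp_sub_right (a := r) (b := t)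
        (fun s => a (t - r - s) (b s (f r))) r
      simp only [sub_self] at h1
      rw [← h1, intervalIntegral.integral_of_le hr.2.le, integral_Ioc_eq_integral_Ioo,
        ← integral_indicator measurableSet_Ioo]
      simp only [hG, indicator_triangle_right _ hr]
      have h3 : ∀ s, t - r - (s - r) = t - s := fun s => by ring
      simp only [h3]
    · rw [indicator_of_notMem hr]
      refine integral_eq_zero_of_ae (ae_of_all _ fun s => ?_)
      simp only [hG, Pi.zero_apply]
      refine indicator_of_notMem (fun h => hr ⟨h.1, h.2.1.trans h.2.2⟩) _
  constructor
  · have h1 := hGi.integral_prod_right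
    rw [intervalIntegrable_iff_integrableOn_Ioo_of_le ht.le, ← integrable_indicator_iff
      measurableSet_Ioo]
    exact h1.congr (ae_of_all _ hright)
  · have hswap := integral_integral_swap (f := fun s r => G (s, r)) hGi
    rw [integral_congr_ae hleft, integral_congr_ae (ae_of_all _ hright),
      integral_indicator measurableSet_Ioo, integral_indicator measurableSet_Ioo] at hswap
    rw [kConv, intervalIntegral.integral_of_le ht.le, intervalIntegral.integral_of_le ht.le,
      integral_Ioc_eq_integral_Ioo, integral_Ioc_eq_integral_Ioo]
    exact hswap

theorem IsKernel.integrable_triangle_of_bounded (ha : IsKernel a c' K') (hb : IsKernel b c K)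
    {f : ℝ → X} {t B : ℝ} (ht : 0 < t) (hf : AEStronglyMeasurable f (volume.restrict (Ioo 0 t)))
    (hB : ∀ s ∈ Ioo 0 t, ‖f s‖ ≤ B) :
    IntegrableOn (fun q : ℝ × ℝ => a (t - q.1) (b (q.1 - q.2) (f q.2))) (triangle t)
      (volume.prod volume) := by
  have hA : Integrable fun s => (Ioo 0 t).indicator (fun s => ‖a s‖) (t - s) :=
    (ha.integrable_indicator ht).comp_sub_left t
  have hB' : Integrable fun s => (Ioo 0 t).indicator (fun s => ‖b s‖) (-s) :=
    (hb.integrable_indicator ht).comp_neg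
  have h1 := ((hA.convolution_integrand (ContinuousLinearMap.mul ℝ ℝ) hB').swap).mul_const B
  refine h1.integrableOn.mono' (ha.aestronglyMeasurable_triangle' hb hf) ?_
  refine (ae_restrict_iff' (measurableSet_triangle t)).2 (ae_of_all _ fun q hq => ?_)
  have e1 : q.1 - q.2 ∈ Ioo 0 t := ⟨sub_pos.2 hq.2.1, by linarith [hq.1, hq.2.2]⟩
  have e2 : q.2 ∈ Ioo 0 t := ⟨hq.1, hq.2.1.trans hq.2.2⟩
  have e3 : t - q.1 ∈ Ioo 0 t := ⟨sub_pos.2 hq.2.2, by linarith [hq.1, hq.2.1]⟩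
  simp only [Function.comp, Prod.fst_swap, Prod.snd_swap, neg_sub, indicator_of_mem e1,
    indicator_of_mem e3, ContinuousLinearMap.mul_apply']
  refine ((a (t - q.1)).le_opNorm _).trans ?_
  rw [mul_assoc]
  gcongr
  refine ((b (q.1 - q.2)).le_opNorm _).trans ?_
  gcongr
  exact hB _ e2

end Convolution

section Commutation

variable {X : Type*} [NormedAddCommGroup X] [NormedSpace ℂ X]
variable {a b : ℝ → X →L[ℂ] X} {c K c' K' : ℝ}

theorem IsKernel.kConv_add (ha : IsKernel a c K) {h k : ℝ → X} {t : ℝ} (ht : 0 ≤ t)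
    (hh : ContinuousOn h (Icc 0 t)) (hk : ContinuousOn k (Icc 0 t)) :
    kConv a (fun s => h s + k s) t = kConv a h t + kConv a k t := by
  simp only [kConv, map_add]
  exact intervalIntegral.integral_add (ha.intervalIntegrable ht hh) (ha.intervalIntegrable ht hk)

theorem IsKernel.kConv_sub (ha : IsKernel a c K) {h k : ℝ → X} {t : ℝ} (ht : 0 ≤ t)
    (hh : ContinuousOn h (Icc 0 t)) (hk : ContinuousOn k (Icc 0 t)) :
    kConv a (fun s => h s - k s) t = kConv a h t - kConv a k t := by
  simp only [kConv, map_sub]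
  exact intervalIntegral.integral_sub (ha.intervalIntegrable ht hh) (ha.intervalIntegrable ht hk)

theorem phiOp_comm (β s : ℝ) (B : X →L[ℂ] X) (x : X) :
    phiOp X β s (B x) = B (phiOp X β s x) := by
  rw [phiOp_apply, phiOp_apply, ← Complex.coe_smul, ← Complex.coe_smul, map_smul]

/-- Commuting kernels commute under convolution. -/
theorem kConv_comm [CompleteSpace X] (ha : IsKernel a c' K') (hb : IsKernel b c K)
    (hab : ∀ s r x, a s (b r x) = b r (a s x)) {f : ℝ → X} {t : ℝ} (ht : 0 < t)
    (hf : IntegrableOn f (Ioo 0 t))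
    (h1 : IntegrableOn (fun q : ℝ × ℝ => a (t - q.1) (b (q.1 - q.2) (f q.2))) (triangle t)
      (volume.prod volume))
    (h2 : IntegrableOn (fun q : ℝ × ℝ => b (t - q.1) (a (q.1 - q.2) (f q.2))) (triangle t)
      (volume.prod volume)) :
    kConv a (kConv b f) t = kConv b (kConv a f) t := by
  rw [(hb.kConv_kConv ht hf h1).2, (ha.kConv_kConv ht hf h2).2]
  refine intervalIntegral.integral_congr fun r _ => ?_
  have := intervalIntegral.integral_comp_sub_left (a := 0) (b := t - r)
    (fun s => b (t - r - s) (a s (f r))) (t - r)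
  simp only [sub_sub_cancel, sub_self, sub_zero] at this
  simp only [← this, hab]

theorem phiOp_one_of_mem_triangle_left {t : ℝ} {q : ℝ × ℝ} (hq : q ∈ triangle t) (x : X) :
    phiOp X 1 (t - q.1) x = x := by
  rw [phiOp_apply, Phi_one_of_pos (sub_pos.2 hq.2.2), one_smul]

theorem phiOp_one_of_mem_triangle_right {t : ℝ} {q : ℝ × ℝ} (hq : q ∈ triangle t) (x : X) :
    phiOp X 1 (q.1 - q.2) x = x := by
  rw [phiOp_apply, Phi_one_of_pos (sub_pos.2 hq.2.1), one_smul]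

/-- Integration commutes with fractional integration. -/
theorem phiConv_phiConv_one [CompleteSpace X] {β : ℝ} (hβ : 0 < β) {f : ℝ → X} {t : ℝ}
    (ht : 0 < t) (hf : IntegrableOn f (Ioo 0 t)) :
    phiConv β (phiConv 1 f) t = phiConv 1 (phiConv β f) t := by
  have kβ := isKernel_phiOp (X := X) hβ
  have k1 := isKernel_phiOp (X := X) one_pos
  simp only [← kConv_phiOp]
  refine kConv_comm kβ k1 (fun s r x => phiOp_comm _ _ _ _) ht hf ?_ ?_
  · have h1 : Integrable fun s => (Ioo 0 t).indicator (fun s => ‖phiOp X β s‖) (t - s) :=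
      (kβ.integrable_indicator ht).comp_sub_left t
    have h2 : Integrable ((Ioo 0 t).indicator fun s => ‖f s‖) :=
      (integrable_indicator_iff measurableSet_Ioo).2 hf.norm
    refine (h1.mul_prod h2).integrableOn.mono'
      (kβ.aestronglyMeasurable_triangle' k1 hf.aestronglyMeasurable) ?_
    refine (ae_restrict_iff' (measurableSet_triangle t)).2 (ae_of_all _ fun q hq => ?_)
    have e2 : q.2 ∈ Ioo 0 t := ⟨hq.1, hq.2.1.trans hq.2.2⟩
    have e3 : t - q.1 ∈ Ioo 0 t := ⟨sub_pos.2 hq.2.2, by linarith [hq.1, hq.2.1]⟩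
    rw [phiOp_one_of_mem_triangle_right hq, indicator_of_mem e2, indicator_of_mem e3]
    exact (phiOp X β (t - q.1)).le_opNorm _
  · refine (kβ.integrable_triangle ht hf).congr_fun (fun q hq => ?_) (measurableSet_triangle t)
    rw [phiOp_one_of_mem_triangle_left hq]

end Commutation

section Calculus

variable {X : Type*} [NormedAddCommGroup X] [NormedSpace ℂ X]

theorem Icc_subset_Ico_of_mem {t T : ℝ} (ht : t ∈ Ico 0 T) : Icc 0 t ⊆ Ico 0 T :=
  fun _ hs => ⟨hs.1, hs.2.trans_lt ht.2⟩

theorem intervalIntegrable_of_continuousOn_Ico {Y : Type*} [NormedAddCommGroup Y]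
    {f : ℝ → Y} {t T : ℝ} (hf : ContinuousOn f (Ico 0 T)) (ht : t ∈ Ico 0 T) :
    IntervalIntegrable f volume 0 t :=
  (hf.mono (by rw [uIcc_of_le ht.1]; exact Icc_subset_Ico_of_mem ht)).intervalIntegrable

theorem hasDerivWithinAt_integral_Ico [CompleteSpace X] {f : ℝ → X} {t T : ℝ}
    (hf : ContinuousOn f (Ico 0 T)) (ht : t ∈ Ico 0 T) :
    HasDerivWithinAt (fun t => ∫ s in (0 : ℝ)..t, f s) (f t) (Ico 0 T) t := by
  obtain ⟨T', hT₁, hT₂⟩ := exists_between ht.2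
  have hT0 : 0 < T' := ht.1.trans_lt hT₁
  set k : ℝ → X := IccExtend hT0.le ((Icc 0 T').domRestrict f) with hk
  have hcont : Continuous k :=
    (continuousOn_iff_continuous_domRestrict.1
      (hf.mono fun s hs => ⟨hs.1, hs.2.trans_lt hT₂⟩)).Icc_extend'
  have hkf : ∀ s ∈ Icc 0 T', k s = f s := fun s hs => by
    rw [hk, IccExtend_of_mem _ _ hs]; rfl
  have heq : ∀ s ∈ Icc 0 T', ∫ r in (0 : ℝ)..s, f r = ∫ r in (0 : ℝ)..s, k r := fun s hs => by
    refine intervalIntegral.integral_congr fun r hr => ?_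
    rw [uIcc_of_le hs.1] at hr
    exact (hkf r ⟨hr.1, hr.2.trans hs.2⟩).symm
  have h1 : HasDerivWithinAt (fun t => ∫ s in (0 : ℝ)..t, k s) (k t) (Ico 0 T) t :=
    (hcont.integral_hasStrictDerivAt 0 t).hasDerivAt.hasDerivWithinAt
  rw [hkf t ⟨ht.1, hT₁.le⟩] at h1
  refine h1.congr_of_eventuallyEq ?_ (heq t ⟨ht.1, hT₁.le⟩)
  filter_upwards [self_mem_nhdsWithin, mem_nhdsWithin_of_mem_nhds (gt_mem_nhds hT₁)] with s hs hs'
  exact heq s ⟨hs.1, hs'.le⟩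

theorem contDiffOn_integral_Ico [CompleteSpace X] {f F : ℝ → X} {T : ℝ}
    (hf : ContinuousOn f (Ico 0 T)) (hF : ∀ t ∈ Ico 0 T, F t = ∫ s in (0 : ℝ)..t, f s) :
    ContDiffOn ℝ 1 F (Ico 0 T) := by
  refine ContDiffOn.congr ?_ hF
  rw [contDiffOn_one_iff_derivWithin (uniqueDiffOn_Ico 0 T)]
  refine ⟨fun t ht => (hasDerivWithinAt_integral_Ico hf ht).differentiableWithinAt,
    hf.congr fun t ht => ?_⟩
  exact (hasDerivWithinAt_integral_Ico hf ht).derivWithin (uniqueDiffOn_Ico 0 T t ht)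

theorem hasDerivAt_integral_Ioo [CompleteSpace X] {f : ℝ → X} {t T : ℝ}
    (hf : ContinuousOn f (Ioo 0 T)) (hi : IntervalIntegrable f volume 0 t) (ht : t ∈ Ioo 0 T) :
    HasDerivAt (fun t => ∫ s in (0 : ℝ)..t, f s) (f t) t :=
  intervalIntegral.integral_hasDerivAt_right hi
    (hf.stronglyMeasurableAtFilter isOpen_Ioo t ht) (hf.continuousAt (isOpen_Ioo.mem_nhds ht))

end Calculus

section Solution

variable {X : Type*} [NormedAddCommGroup X] [NormedSpace ℂ X]
variable {P : ℝ → X →L[ℂ] X} {R : X →L[ℂ] X} {α M T : ℝ}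

theorem IsFracKernel.one_sub_pos (hP : IsFracKernel P R α M) : 0 < 1 - α := by
  linarith [hP.lt_one]

theorem IsFracKernel.continuousOn_apply (hP : IsFracKernel P R α M) (x : X) :
    ContinuousOn (fun s => P s x) (Ioi 0) := hP.continuousOn.clm_apply continuousOn_const

theorem IsFracKernel.norm_apply_le (hP : IsFracKernel P R α M) (x : X) :
    ∀ s > 0, ‖P s x‖ ≤ M * ‖x‖ * s ^ (α - 1) := fun s hs => by
  refine ((P s).le_opNorm x).trans ?_
  rw [mul_right_comm]
  gcongr
  exact hP.bound s hs

theorem IsFracKernel.intervalIntegrable_phiConv_apply (hP : IsFracKernel P R α M) {β : ℝ}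
    (hβ : 0 < β) (x : X) {t : ℝ} (ht : 0 < t) :
    IntervalIntegrable (fun s => Phi β (t - s) • P s x) volume 0 t :=
  intervalIntegrable_phiConv hP.pos hβ ht ((hP.continuousOn_apply x).mono fun _ hs => hs.1)
    fun s hs => hP.norm_apply_le x s hs.1

theorem phiConv_intervalIntegrable {β : ℝ} (hβ : 0 < β) {h : ℝ → X} {t : ℝ} (ht : 0 ≤ t)
    (hh : ContinuousOn h (Icc 0 t)) :
    IntervalIntegrable (fun s => Phi β (t - s) • h s) volume 0 t := by
  simpa only [phiOp_apply] using (isKernel_phiOp (X := X) hβ).intervalIntegrable ht hh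

theorem continuousOn_phiConv {β : ℝ} (hβ : 0 < β) {h : ℝ → X} (hh : ContinuousOn h (Ico 0 T)) :
    ContinuousOn (phiConv β h) (Ico 0 T) := by
  rw [← kConv_phiOp]
  exact (isKernel_phiOp hβ).continuousOn_kConv hh

variable {g g' k k' : ℝ → X}

theorem IsFracKernel.phiConv_derivative (hP : IsFracKernel P R α M)
    (hg' : ContinuousOn g' (Ico 0 T)) {β t : ℝ} (hβ : 0 < β) (ht : t ∈ Ioo 0 T) (x : X) :
    IntervalIntegrable (fun s => Phi β (t - s) • (P s x + kConv P g' s)) volume 0 t ∧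
    phiConv β (fun s => P s x + kConv P g' s) t =
      phiConv β (fun s => P s x) t + phiConv β (kConv P g') t := by
  have i1 := hP.intervalIntegrable_phiConv_apply hβ x ht.1
  have i2 := phiConv_intervalIntegrable hβ ht.1.le
    ((hP.isKernel.continuousOn_kConv hg').mono (Icc_subset_Ico_of_mem ⟨ht.1.le, ht.2⟩))
  simp only [phiConv, smul_add]
  exact ⟨i1.add i2, intervalIntegral.integral_add i1 i2⟩

theorem IsFracKernel.intervalIntegrable_derivative (hP : IsFracKernel P R α M)
    (hg' : ContinuousOn g' (Ico 0 T)) {t : ℝ} (ht : t ∈ Ioo 0 T) (x : X) :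
    IntervalIntegrable (fun s => P s x + kConv P g' s) volume 0 t := by
  have h := (hP.phiConv_derivative hg' one_pos ht x).1
  rw [intervalIntegrable_iff_integrableOn_Ioo_of_le ht.1.le] at h ⊢
  refine h.congr_fun (fun s hs => ?_) measurableSet_Ioo
  simp only [Phi_one_of_pos (sub_pos.2 hs.2), one_smul]

variable [CompleteSpace X]

theorem IsFracKernel.phiConv_kConv (hP : IsFracKernel P R α M) {β : ℝ} (hβ : 0 < β) {h : ℝ → X}
    {t : ℝ} (ht : 0 ≤ t) (hh : ContinuousOn h (Icc 0 t)) :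
    phiConv β (kConv P h) t = kConv P (phiConv β h) t := by
  rcases eq_or_lt_of_le ht with rfl | ht
  · simp [phiConv, kConv]
  have kβ := isKernel_phiOp (X := X) hβ
  have kP := hP.isKernel
  obtain ⟨B, hB⟩ := isCompact_Icc.exists_bound_of_continuousOn hh
  have hm := (hh.mono Ioo_subset_Icc_self).aestronglyMeasurable (μ := volume) measurableSet_Ioo
  have hf : IntegrableOn h (Ioo 0 t) :=
    (hh.integrableOn_Icc).mono_set Ioo_subset_Icc_self
  have hB' : ∀ s ∈ Ioo 0 t, ‖h s‖ ≤ B := fun s hs => hB s (Ioo_subset_Icc_self hs)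
  simp only [← kConv_phiOp]
  exact kConv_comm kβ kP (fun s r x => phiOp_comm _ _ _ _) ht hf
    (kβ.integrable_triangle_of_bounded kP ht hm hB')
    (kP.integrable_triangle_of_bounded kβ ht hm hB')

theorem IsFracKernel.phiConv_kConv_eq_integral (hP : IsFracKernel P R α M) {β : ℝ} (hβ : 0 < β)
    {h : ℝ → X} {t : ℝ} (ht : 0 < t) (hh : ContinuousOn h (Icc 0 t)) :
    IntervalIntegrable (fun r => phiConv β (fun s => P s (h r)) (t - r)) volume 0 t ∧
    phiConv β (kConv P h) t = ∫ r in (0 : ℝ)..t, phiConv β (fun s => P s (h r)) (t - r) := by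
  have kβ := isKernel_phiOp (X := X) hβ
  have kP := hP.isKernel
  obtain ⟨B, hB⟩ := isCompact_Icc.exists_bound_of_continuousOn hh
  have hm := (hh.mono Ioo_subset_Icc_self).aestronglyMeasurable (μ := volume) measurableSet_Ioo
  have hf : IntegrableOn h (Ioo 0 t) :=
    (hh.integrableOn_Icc).mono_set Ioo_subset_Icc_self
  have hB' : ∀ s ∈ Ioo 0 t, ‖h s‖ ≤ B := fun s hs => hB s (Ioo_subset_Icc_self hs)
  have := kP.kConv_kConv ht hf (kβ.integrable_triangle_of_bounded kP ht hm hB')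
  rw [kConv_phiOp] at this
  simpa only [phiOp_apply, phiConv] using this

/-- The fractional integral of order `1 - α` of `P * h`, for `h` with values in the domain. -/
theorem IsFracKernel.phiConv_kConv_of_pair (hP : IsFracKernel P R α M) {h k : ℝ → X} {t : ℝ}
    (ht : 0 ≤ t) (hh : ContinuousOn h (Icc 0 t)) (hk : ContinuousOn k (Icc 0 t))
    (hhk : ∀ s ∈ Icc 0 t, R (h s - k s) = h s) :
    phiConv (1 - α) (kConv P h) t = (∫ s in (0 : ℝ)..t, h s) + phiConv 1 (kConv P k) t := by
  rcases eq_or_lt_of_le ht with rfl | ht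
  · simp [phiConv]
  obtain ⟨-, h1⟩ := hP.phiConv_kConv_eq_integral hP.one_sub_pos ht hh
  obtain ⟨i2, h2⟩ := hP.phiConv_kConv_eq_integral one_pos ht hk
  have hi : IntervalIntegrable h volume 0 t :=
    ContinuousOn.intervalIntegrable (by rwa [uIcc_of_le ht.le])
  rw [h1, h2, ← intervalIntegral.integral_add hi i2, intervalIntegral.integral_of_le ht.le,
    intervalIntegral.integral_of_le ht.le, integral_Ioc_eq_integral_Ioo,
    integral_Ioc_eq_integral_Ioo]
  refine setIntegral_congr_fun measurableSet_Ioo fun r hr => ?_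
  exact hP.phiConv_eq _ _ (hhk r (Ioo_subset_Icc_self hr)) _ (sub_pos.2 hr.2)

theorem IsFracKernel.kConv_pair (hP : IsFracKernel P R α M) {h k : ℝ → X} {t : ℝ}
    (ht : 0 ≤ t) (hh : ContinuousOn h (Icc 0 t)) (hk : ContinuousOn k (Icc 0 t))
    (hhk : ∀ s ∈ Icc 0 t, R (h s - k s) = h s) :
    R (kConv P h t - kConv P k t) = kConv P h t := by
  rw [← hP.isKernel.kConv_sub ht hh hk, kConv, kConv,
    ← R.intervalIntegral_comp_comm
      (hP.isKernel.intervalIntegrable (h := fun s => h s - k s) ht (hh.sub hk)),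
    intervalIntegral.integral_of_le ht, intervalIntegral.integral_of_le ht,
    integral_Ioc_eq_integral_Ioo, integral_Ioc_eq_integral_Ioo]
  refine setIntegral_congr_fun measurableSet_Ioo fun s hs => ?_
  rw [hP.comm _ (sub_pos.2 hs.2), hhk s (Ioo_subset_Icc_self hs)]

/-- The sum of `P * g'` and `P g(0)` has the integral `P * g`. -/
theorem IsFracKernel.kConv_eq_phiConv_one (hP : IsFracKernel P R α M)
    (hg' : ContinuousOn g' (Ico 0 T))
    (hgg : ∀ t ∈ Ico 0 T, g t = g 0 + ∫ s in (0 : ℝ)..t, g' s) {t : ℝ} (ht : t ∈ Ioo 0 T) :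
    kConv P g t = phiConv 1 (fun s => P s (g 0)) t + phiConv 1 (kConv P g') t := by
  have hsub : Icc 0 t ⊆ Ico 0 T := Icc_subset_Ico_of_mem ⟨ht.1.le, ht.2⟩
  have h1 : kConv P g t = kConv P (fun s => g 0 + phiConv 1 g' s) t :=
    kConv_congr ht.1.le fun s hs => by
      rw [phiConv_one _ hs.1.le, hgg s (hsub (Ioo_subset_Icc_self hs))]
  rw [h1, hP.isKernel.kConv_add ht.1.le continuousOn_const
    ((continuousOn_phiConv one_pos hg').mono hsub),
    hP.phiConv_kConv one_pos ht.1.le (hg'.mono hsub), phiConv_one _ ht.1.le]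
  congr 1
  have := intervalIntegral.integral_comp_sub_left (a := 0) (b := t) (fun s => P s (g 0)) t
  simp only [sub_self, sub_zero] at this
  rw [kConv, this]

theorem IsFracKernel.kConv_eq_integral (hP : IsFracKernel P R α M)
    (hg' : ContinuousOn g' (Ico 0 T))
    (hgg : ∀ t ∈ Ico 0 T, g t = g 0 + ∫ s in (0 : ℝ)..t, g' s) {t : ℝ} (ht : t ∈ Ioo 0 T) :
    kConv P g t = ∫ s in (0 : ℝ)..t, (P s (g 0) + kConv P g' s) := by
  rw [hP.kConv_eq_phiConv_one hg' hgg ht, ← (hP.phiConv_derivative hg' one_pos ht _).2,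
    phiConv_one _ ht.1.le]

theorem IsFracKernel.hasDerivAt_kConv (hP : IsFracKernel P R α M)
    (hg' : ContinuousOn g' (Ico 0 T))
    (hgg : ∀ t ∈ Ico 0 T, g t = g 0 + ∫ s in (0 : ℝ)..t, g' s) {t : ℝ} (ht : t ∈ Ioo 0 T) :
    HasDerivAt (kConv P g) (P t (g 0) + kConv P g' t) t := by
  have hc : ContinuousOn (fun s => P s (g 0) + kConv P g' s) (Ioo 0 T) :=
    ((hP.continuousOn_apply _).mono fun _ hs => hs.1).add
      ((hP.isKernel.continuousOn_kConv hg').mono Ioo_subset_Ico_self)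
  refine (hasDerivAt_integral_Ioo hc
    (hP.intervalIntegrable_derivative hg' ht (g 0)) ht).congr_of_eventuallyEq ?_
  filter_upwards [isOpen_Ioo.mem_nhds ht] with s hs
  exact hP.kConv_eq_integral hg' hgg hs

/-- The fractional derivative of `P * g`. -/
theorem IsFracKernel.phiConv_derivative_eq (hP : IsFracKernel P R α M)
    (hg' : ContinuousOn g' (Ico 0 T)) (hk' : ContinuousOn k' (Ico 0 T))
    (hpair : R (g 0 - k 0) = g 0) (hpair' : ∀ t ∈ Ico 0 T, R (g' t - k' t) = g' t)
    (hgg : ∀ t ∈ Ico 0 T, g t = g 0 + ∫ s in (0 : ℝ)..t, g' s)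
    (hkk : ∀ t ∈ Ico 0 T, k t = k 0 + ∫ s in (0 : ℝ)..t, k' s) {t : ℝ} (ht : t ∈ Ioo 0 T) :
    phiConv (1 - α) (fun s => P s (g 0) + kConv P g' s) t = kConv P k t + g t := by
  have hsub : Icc 0 t ⊆ Ico 0 T := Icc_subset_Ico_of_mem ⟨ht.1.le, ht.2⟩
  rw [(hP.phiConv_derivative hg' hP.one_sub_pos ht _).2, hP.phiConv_eq _ _ hpair t ht.1,
    hP.phiConv_kConv_of_pair ht.1.le (hg'.mono hsub) (hk'.mono hsub)
      (fun s hs => hpair' s (hsub hs)), hP.kConv_eq_phiConv_one hk' hkk ht,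
    hgg t (Ioo_subset_Ico_self ht)]
  abel

/-- The homogeneous equation in regularized form has only the trivial solution. -/
theorem IsFracKernel.eq_zero_of_hasDerivAt (hP : IsFracKernel P R α M) {w z : ℝ → X}
    (hw : ContinuousOn w (Ico 0 T)) (hwz : ∀ t ∈ Ioo 0 T, R (w t - z t) = w t)
    (hd : ∀ t ∈ Ioo 0 T, HasDerivAt (phiConv (1 - α) w) (z t) t) :
    ∀ t ∈ Ioo 0 T, w t = 0 := by
  have hRw : ContinuousOn (fun t => R (w t)) (Ico 0 T) := R.continuous.comp_continuousOn hw
  have hκ : ContinuousOn (fun t => R (w t) - w t) (Ico 0 T) := hRw.sub hw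
  have hphi : ∀ t ∈ Ico 0 T, phiConv (1 - α) (fun s => R (w s)) t = R (phiConv (1 - α) w t) := by
    intro t ht
    have hi := phiConv_intervalIntegrable hP.one_sub_pos ht.1 (hw.mono (Icc_subset_Ico_of_mem ht))
    rw [phiConv, phiConv, ← R.intervalIntegral_comp_comm hi]
    refine intervalIntegral.integral_congr fun s _ => ?_
    rw [← Complex.coe_smul, ← Complex.coe_smul, map_smul]
  have hint : ∀ t ∈ Ico 0 T,
      phiConv (1 - α) (fun s => R (w s)) t = phiConv 1 (fun s => R (w s) - w s) t := by
    intro t ht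
    have hsub := Icc_subset_Ico_of_mem ht
    rw [phiConv_one _ ht.1, intervalIntegral.integral_eq_sub_of_hasDerivAt_of_le ht.1
      ((continuousOn_phiConv hP.one_sub_pos hRw).mono hsub) (fun s hs => ?_)
      (intervalIntegrable_of_continuousOn_Ico hκ ht)]
    · simp [phiConv]
    · have hsT : s ∈ Ioo 0 T := ⟨hs.1, hs.2.trans ht.2⟩
      have h1 : HasDerivAt (fun t => R (phiConv (1 - α) w t)) (R (z s)) s :=
        (R.restrictScalars ℝ).hasFDerivAt.comp_hasDerivAt s (hd s hsT)
      have h2 : R (z s) = R (w s) - w s := by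
        have := hwz s hsT
        rw [map_sub, sub_eq_iff_eq_add] at this
        exact eq_sub_of_add_eq' this.symm
      rw [h2] at h1
      refine h1.congr_of_eventuallyEq ?_
      filter_upwards [isOpen_Ioo.mem_nhds hsT] with r hr
      exact hphi r (Ioo_subset_Ico_self hr)
  have hzero : ∀ t ∈ Ico 0 T, ∫ s in (0 : ℝ)..t, R (w s) = 0 := by
    intro t ht
    have hsub := Icc_subset_Ico_of_mem ht
    have h1 := hP.phiConv_kConv_of_pair ht.1 (hRw.mono hsub) (hκ.mono hsub)
      (fun s _ => by rw [sub_sub_cancel])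
    rw [hP.phiConv_kConv hP.one_sub_pos ht.1 (hRw.mono hsub),
      kConv_congr ht.1 (fun s hs => hint s (hsub (Ioo_subset_Icc_self hs))),
      ← hP.phiConv_kConv one_pos ht.1 (hκ.mono hsub)] at h1
    simpa using h1
  intro t ht
  have h1 := (hasDerivWithinAt_integral_Ico hRw (Ioo_subset_Ico_self ht)).hasDerivAt
    (mem_of_superset (isOpen_Ioo.mem_nhds ht) Ioo_subset_Ico_self)
  have h2 : HasDerivAt (fun t => ∫ s in (0 : ℝ)..t, R (w s)) 0 t := by
    refine (hasDerivAt_const t (0 : X)).congr_of_eventuallyEq ?_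
    filter_upwards [isOpen_Ioo.mem_nhds ht] with r hr
    exact hzero r (Ioo_subset_Ico_self hr)
  have h3 := h1.unique h2
  exact hP.injective (by rw [h3, map_zero])

end Solution

section Graph

variable {X : Type*} [NormedAddCommGroup X] [NormedSpace ℂ X] {T : ℝ}

theorem eq_add_integral_derivWithin [CompleteSpace X] {f : ℝ → X}
    (hf : ContDiffOn ℝ 1 f (Ico 0 T)) :
    ∀ t ∈ Ico 0 T, f t = f 0 + ∫ s in (0 : ℝ)..t, derivWithin f (Ico 0 T) s := by
  intro t ht
  have h := (contDiffOn_one_iff_derivWithin (uniqueDiffOn_Ico 0 T)).1 hf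
  rw [intervalIntegral.integral_eq_sub_of_hasDerivAt_of_le ht.1
    (hf.continuousOn.mono (Icc_subset_Ico_of_mem ht)) (fun s hs => ?_)
    (intervalIntegrable_of_continuousOn_Ico h.2 ht)]
  · abel
  · have hs' : s ∈ Ioo 0 T := ⟨hs.1, hs.2.trans ht.2⟩
    exact (h.1 s (Ioo_subset_Ico_self hs')).hasDerivWithinAt.hasDerivAt
      (mem_of_superset (isOpen_Ioo.mem_nhds hs') Ioo_subset_Ico_self)

/-- A bounded operator identity between `C¹` functions passes to the derivatives. -/
theorem apply_sub_derivWithin {R : X →L[ℂ] X} {g k : ℝ → X} (hg : ContDiffOn ℝ 1 g (Ico 0 T))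
    (hk : ContDiffOn ℝ 1 k (Ico 0 T)) (h : ∀ t ∈ Ico 0 T, R (g t - k t) = g t) :
    ∀ t ∈ Ico 0 T, R (derivWithin g (Ico 0 T) t - derivWithin k (Ico 0 T) t) =
      derivWithin g (Ico 0 T) t := by
  intro t ht
  have hg' := (hg.differentiableOn one_ne_zero t ht).hasDerivWithinAt
  have hk' := (hk.differentiableOn one_ne_zero t ht).hasDerivWithinAt
  have h1 : HasDerivWithinAt (fun t => R (g t - k t))
      (R (derivWithin g (Ico 0 T) t - derivWithin k (Ico 0 T) t)) (Ico 0 T) t :=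
    (R.restrictScalars ℝ).hasFDerivAt.comp_hasDerivWithinAt t (hg'.sub hk')
  exact (uniqueDiffOn_Ico 0 T t ht).eq_deriv _ (h1.congr (fun s hs => (h s hs).symm) (h t ht).symm)
    hg'

end Graph

section Equation

variable {X : Type*} [NormedAddCommGroup X] [NormedSpace ℂ X] {α T : ℝ}

theorem rpow_neg_eq_Gamma_mul_Phi (hα : α < 1) {r : ℝ} (hr : 0 < r) :
    r ^ (-α) = Real.Gamma (1 - α) * Phi (1 - α) r := by
  have hΓ := (Real.Gamma_pos_of_pos (show 0 < 1 - α by linarith)).ne'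
  rw [Phi_of_pos hr, show 1 - α - 1 = -α by ring]
  field_simp

theorem caputoDeriv_eq_phiConv (hα : α < 1) (u : ℝ → X) {t : ℝ} (ht : 0 ≤ t) :
    caputoDeriv α u t = phiConv (1 - α) (deriv u) t := by
  have hΓ := (Real.Gamma_pos_of_pos (show 0 < 1 - α by linarith)).ne'
  rw [caputoDeriv, phiConv, ← intervalIntegral.integral_smul,
    intervalIntegral.integral_of_le ht, intervalIntegral.integral_of_le ht,
    integral_Ioc_eq_integral_Ioo, integral_Ioc_eq_integral_Ioo]
  refine setIntegral_congr_fun measurableSet_Ioo fun s hs => ?_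
  simp only [rpow_neg_eq_Gamma_mul_Phi hα (sub_pos.2 hs.2), smul_smul]
  congr 1
  field_simp

/-- A kernel convolution of an integrable function is integrable. -/
theorem IsKernel.intervalIntegrable_kConv {b : ℝ → X →L[ℂ] X} {c K : ℝ} (hb : IsKernel b c K)
    {f : ℝ → X} {t : ℝ} (ht : 0 < t) (hf : IntegrableOn f (Ioo 0 t)) :
    IntervalIntegrable (kConv b f) volume 0 t := by
  have h := ((integrable_indicator_iff (measurableSet_triangle t)).2
    (hb.integrable_triangle ht hf)).integral_prod_left
  rw [intervalIntegrable_iff_integrableOn_Ioo_of_le ht.le]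
  refine h.integrableOn.congr_fun (fun s hs => ?_) measurableSet_Ioo
  simp only [indicator_triangle_left _ hs]
  rw [integral_indicator measurableSet_Ioo, kConv, intervalIntegral.integral_of_le hs.1.le,
    integral_Ioc_eq_integral_Ioo]

theorem integrableOn_of_rpow_neg_smul (hα : 0 < α) {f : ℝ → X} {t : ℝ} (ht : 0 ≤ t)
    (hf : IntervalIntegrable (fun s => (t - s) ^ (-α) • f s) volume 0 t) :
    IntegrableOn f (Ioo 0 t) := by
  rw [intervalIntegrable_iff_integrableOn_Ioo_of_le ht] at hf
  have hc : ContinuousOn (fun s : ℝ => (t - s) ^ α) (Ioo 0 t) :=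
    (continuousOn_const.sub continuousOn_id).rpow_const fun s hs => Or.inr hα.le
  have h1 : AEStronglyMeasurable (fun s => (t - s) ^ α • ((t - s) ^ (-α) • f s))
      (volume.restrict (Ioo 0 t)) :=
    (hc.aestronglyMeasurable measurableSet_Ioo).smul hf.aestronglyMeasurable
  have h2 : IntegrableOn (fun s => (t - s) ^ α • ((t - s) ^ (-α) • f s)) (Ioo 0 t) := by
    refine (hf.norm.const_mul (t ^ α)).mono' h1 ?_
    refine (ae_restrict_iff' measurableSet_Ioo).2 (ae_of_all _ fun s hs => ?_)
    rw [norm_smul]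
    have : 0 < t - s := sub_pos.2 hs.2
    rw [Real.norm_of_nonneg (by positivity)]
    gcongr
    linarith [hs.1]
  refine h2.congr_fun (fun s hs => ?_) measurableSet_Ioo
  have : 0 < t - s := sub_pos.2 hs.2
  simp only [smul_smul]
  rw [← Real.rpow_add this, add_neg_cancel, Real.rpow_zero, one_smul]

variable {A : X →ₗ.[ℂ] X}

/-- A strong solution solves the equation with the regularized derivative. -/
theorem IsStrongSolution.isRegularizedStrongSolution [CompleteSpace X] {g u : ℝ → X}
    (hα₀ : 0 < α) (hα₁ : α < 1) (hg : ContinuousOn g (Ioo 0 T))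
    (hu : IsStrongSolution A α T 0 g u) : IsRegularizedStrongSolution A α T 0 g u := by
  refine ⟨hu.regularity, fun t ht => ?_⟩
  simp only [sub_zero]
  have hβ : 0 < 1 - α := by linarith
  have hcont : ContinuousOn u (Ico 0 T) := by
    have := hu.regularity.continuousOn
    rwa [Ioo_insert_left (ht.1.trans ht.2)] at this
  have hd : ∀ s ∈ Ioo 0 T, HasDerivAt u (deriv u s) s := fun s hs =>
    (hu.differentiable s hs).hasDerivAt
  have hi : ∀ s ∈ Ioo 0 T, IntegrableOn (deriv u) (Ioo 0 s) := fun s hs =>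
    integrableOn_of_rpow_neg_smul hα₀ hs.1.le (hu.integrable s hs)
  have hint : ∀ s ∈ Ioo 0 T, u s = phiConv 1 (deriv u) s := by
    intro s hs
    rw [phiConv_one _ hs.1.le, intervalIntegral.integral_eq_sub_of_hasDerivAt_of_le hs.1.le
      (hcont.mono (Icc_subset_Ico_of_mem (Ioo_subset_Ico_self hs)))
      (fun r hr => hd r ⟨hr.1, hr.2.trans hs.2⟩)
      ((intervalIntegrable_iff_integrableOn_Ioo_of_le hs.1.le).2 (hi s hs)),
      hu.regularity.initial, sub_zero]
  have heq : ∀ s ∈ Ioo 0 T, phiConv (1 - α) u s =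
      ∫ r in (0 : ℝ)..s, phiConv (1 - α) (deriv u) r := by
    intro s hs
    rw [← phiConv_one _ hs.1.le, ← phiConv_phiConv_one hβ hs.1 (hi s hs),
      ← kConv_phiOp (1 - α) u, ← kConv_phiOp (1 - α) (phiConv 1 (deriv u))]
    exact kConv_congr hs.1.le fun r hr => hint r ⟨hr.1, hr.2.trans hs.2⟩
  have hval : ∀ s ∈ Ioo 0 T, phiConv (1 - α) (deriv u) s = opApply A (u s) + g s :=
    fun s hs => by rw [← caputoDeriv_eq_phiConv hα₁ u hs.1.le, hu.equation s hs]
  have hc : ContinuousOn (phiConv (1 - α) (deriv u)) (Ioo 0 T) :=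
    (hu.regularity.domain.2.snd.add hg).congr hval
  have hii : IntervalIntegrable (phiConv (1 - α) (deriv u)) volume 0 t := by
    rw [← kConv_phiOp]
    exact (isKernel_phiOp hβ).intervalIntegrable_kConv ht.1 (hi t ht)
  have h := (hasDerivAt_integral_Ioo hc hii ht).congr_of_eventuallyEq
    (f₁ := phiConv (1 - α) u) (by
      filter_upwards [isOpen_Ioo.mem_nhds ht] with s hs
      exact heq s hs)
  rw [h.deriv, hval t ht]

end Equation

section WellPosedness

variable {X : Type*} [NormedAddCommGroup X] [NormedSpace ℂ X]
variable {A : X →ₗ.[ℂ] X} {P : ℝ → X →L[ℂ] X} {R : X →L[ℂ] X} {α M T : ℝ} {g : ℝ → X}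

theorem C1OnDomain.continuousOnDomain {J : Set ℝ} (hg : C1OnDomain A g J) :
    ContinuousOnDomain A g J := ⟨hg.1, hg.2.continuousOn⟩

theorem ContinuousOnDomain.apply_sub {J : Set ℝ} (hg : ContinuousOnDomain A g J)
    (hR : IsResolventAt A 1 R) : ∀ t ∈ J, R (g t - opApply A (g t)) = g t :=
  fun t ht => hR.apply_sub_eq_iff.2 ⟨hg.1 t ht, rfl⟩

theorem HasStrongRegularity.interior {u₀ : X} {u : ℝ → X}
    (h : HasStrongRegularity A α (Ico 0 T) u₀ u) : HasStrongRegularity A α (Ioo 0 T) u₀ u :=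
  ⟨h.initial, h.continuousOn.mono (insert_subset_insert Ioo_subset_Ico_self),
    ⟨fun t ht => h.domain.1 t (Ioo_subset_Ico_self ht), h.domain.2.mono Ioo_subset_Ico_self⟩,
    h.conv_c1.mono Ioo_subset_Ico_self⟩

variable [CompleteSpace X]

/-- The operator `A` commutes with the convolution by the solution kernel. -/
theorem IsFracKernel.opApply_kConv (hP : IsFracKernel P R α M) (hR : IsResolventAt A 1 R)
    (hg : ContinuousOnDomain A g (Ico 0 T)) {t : ℝ} (ht : t ∈ Ico 0 T) :
    kConv P g t ∈ A.domain ∧ opApply A (kConv P g t) = kConv P (fun s => opApply A (g s)) t := by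
  have hsub := Icc_subset_Ico_of_mem ht
  exact hR.apply_sub_eq_iff.1 (hP.kConv_pair ht.1 (hg.2.fst.mono hsub) (hg.2.snd.mono hsub)
    fun s hs => hg.apply_sub hR s (hsub hs))

theorem IsFracKernel.phiConv_kConv_eq_integral_add (hP : IsFracKernel P R α M)
    (hR : IsResolventAt A 1 R) (hg : ContinuousOnDomain A g (Ico 0 T)) :
    ∀ t ∈ Ico 0 T, phiConv (1 - α) (kConv P g) t =
      ∫ s in (0 : ℝ)..t, (g s + kConv P (fun s => opApply A (g s)) s) := by
  intro t ht
  have hsub := Icc_subset_Ico_of_mem ht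
  rw [hP.phiConv_kConv_of_pair ht.1 (hg.2.fst.mono hsub) (hg.2.snd.mono hsub)
    (fun s hs => hg.apply_sub hR s (hsub hs)), phiConv_one _ ht.1]
  exact (intervalIntegral.integral_add (intervalIntegrable_of_continuousOn_Ico hg.2.fst ht)
    (intervalIntegrable_of_continuousOn_Ico (hP.isKernel.continuousOn_kConv hg.2.snd) ht)).symm

theorem IsFracKernel.hasStrongRegularity (hP : IsFracKernel P R α M) (hR : IsResolventAt A 1 R)
    (hg : ContinuousOnDomain A g (Ico 0 T)) (hT : 0 < T) :
    HasStrongRegularity A α (Ico 0 T) 0 (kConv P g) := by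
  have hu := hP.isKernel.continuousOn_kConv hg.2.fst
  have hAu := hP.isKernel.continuousOn_kConv hg.2.snd
  refine ⟨by simp [kConv], ?_, ⟨fun t ht => (hP.opApply_kConv hR hg ht).1, ?_⟩, ?_⟩
  · rwa [insert_eq_of_mem (left_mem_Ico.2 hT)]
  · exact hu.prodMk (hAu.congr fun t ht => (hP.opApply_kConv hR hg ht).2)
  · simp only [sub_zero]
    exact contDiffOn_integral_Ico (hg.2.fst.add hAu) (hP.phiConv_kConv_eq_integral_add hR hg)

/-- The convolution of the solution kernel with the inhomogeneity is a strong solution. -/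
theorem IsFracKernel.isStrongSolution (hP : IsFracKernel P R α M) (hR : IsResolventAt A 1 R)
    (hg : C1OnDomain A g (Ico 0 T)) (hT : 0 < T) : IsStrongSolution A α T 0 g (kConv P g) := by
  have hg₀ := hg.continuousOnDomain
  have hg1 : ContDiffOn ℝ 1 g (Ico 0 T) := hg.2.fst
  have hk1 : ContDiffOn ℝ 1 (fun t => opApply A (g t)) (Ico 0 T) := hg.2.snd
  have hpair := hg₀.apply_sub hR
  have hpair' := apply_sub_derivWithin hg1 hk1 hpair
  have hg' := ((contDiffOn_one_iff_derivWithin (uniqueDiffOn_Ico 0 T)).1 hg1).2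
  have hk' := ((contDiffOn_one_iff_derivWithin (uniqueDiffOn_Ico 0 T)).1 hk1).2
  have hgg := eq_add_integral_derivWithin hg1
  have hd := fun t ht => hP.hasDerivAt_kConv hg' hgg (t := t) ht
  refine ⟨(hP.hasStrongRegularity hR hg₀ hT).interior,
    fun t ht => (hd t ht).differentiableAt, fun t ht => ?_, fun t ht => ?_⟩
  · have h := ((hP.phiConv_derivative hg' hP.one_sub_pos ht (g 0)).1).smul (Real.Gamma (1 - α))
    rw [intervalIntegrable_iff_integrableOn_Ioo_of_le ht.1.le] at h ⊢
    refine h.congr_fun (fun s hs => ?_) measurableSet_Ioo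
    simp only [Pi.smul_apply]
    rw [(hd s ⟨hs.1, hs.2.trans ht.2⟩).deriv, smul_smul,
      rpow_neg_eq_Gamma_mul_Phi hP.lt_one (sub_pos.2 hs.2)]
  · rw [caputoDeriv_eq_phiConv hP.lt_one _ ht.1.le,
      (hP.opApply_kConv hR hg₀ (Ioo_subset_Ico_self ht)).2,
      ← hP.phiConv_derivative_eq hg' hk' (hpair 0 (left_mem_Ico.2 hT)) hpair' hgg
        (eq_add_integral_derivWithin hk1) ht, ← kConv_phiOp, ← kConv_phiOp]
    exact kConv_congr ht.1.le fun s hs => (hd s ⟨hs.1, hs.2.trans ht.2⟩).deriv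

/-- Uniqueness for the equation with the regularized derivative. -/
theorem IsFracKernel.eqOn_kConv (hP : IsFracKernel P R α M) (hR : IsResolventAt A 1 R)
    (hg : ContinuousOnDomain A g (Ico 0 T)) {v : ℝ → X}
    (hv : IsRegularizedStrongSolution A α T 0 g v) : EqOn v (kConv P g) (Ico 0 T) := by
  intro t ht
  have hT : 0 < T := ht.1.trans_lt ht.2
  have hu := hP.isKernel.continuousOn_kConv hg.2.fst
  have hAu := hP.isKernel.continuousOn_kConv hg.2.snd
  have hvc : ContinuousOn v (Ico 0 T) := by
    have := hv.regularity.continuousOn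
    rwa [Ioo_insert_left hT] at this
  rcases eq_or_lt_of_le ht.1 with rfl | ht0
  · rw [hv.regularity.initial]; simp [kConv]
  refine sub_eq_zero.1 (hP.eq_zero_of_hasDerivAt (w := fun t => v t - kConv P g t)
    (z := fun t => opApply A (v t) - kConv P (fun s => opApply A (g s)) t) (T := T)
    (hvc.sub hu) (fun s hs => ?_) (fun s hs => ?_) t ⟨ht0, ht.2⟩)
  · have h1 := hv.regularity.domain.apply_sub hR s hs
    have h2 := hR.apply_sub_eq_iff.2 (hP.opApply_kConv hR hg (Ioo_subset_Ico_self hs))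
    rw [sub_sub_sub_comm, map_sub, h1, h2]
  · have hc1 := hv.regularity.conv_c1
    have heq := hv.equation s hs
    simp only [sub_zero] at hc1 heq
    have h1 := ((hc1.differentiableOn one_ne_zero).differentiableAt
      (isOpen_Ioo.mem_nhds hs)).hasDerivAt
    rw [heq] at h1
    have h2 : HasDerivAt (phiConv (1 - α) (kConv P g))
        (g s + kConv P (fun s => opApply A (g s)) s) s := by
      refine ((hasDerivWithinAt_integral_Ico (hg.2.fst.add hAu)
        (Ioo_subset_Ico_self hs)).hasDerivAt
        (mem_of_superset (isOpen_Ioo.mem_nhds hs) Ioo_subset_Ico_self)).congr_of_eventuallyEq ?_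
      filter_upwards [isOpen_Ioo.mem_nhds hs] with r hr
      exact hP.phiConv_kConv_eq_integral_add hR hg r (Ioo_subset_Ico_self hr)
    have h3 := h1.sub h2
    rw [add_comm (g s), add_sub_add_right_eq_sub] at h3
    refine h3.congr_of_eventuallyEq ?_
    filter_upwards [isOpen_Ioo.mem_nhds hs] with r hr
    have hsub := Icc_subset_Ico_of_mem (Ioo_subset_Ico_self hr)
    have h4 := (isKernel_phiOp (X := X) hP.one_sub_pos).kConv_sub hr.1.le (hvc.mono hsub)
      (hu.mono hsub)
    rw [kConv_phiOp, kConv_phiOp, kConv_phiOp] at h4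
    exact h4

end WellPosedness

end

end FracEvol

open FracEvol

theorem theorem2p3 {X : Type*} [NormedAddCommGroup X] [NormedSpace ℂ X] [CompleteSpace X]
    (A : X →ₗ.[ℂ] X) (hclosed : A.IsClosed) (hdense : Dense (A.domain : Set X))
    (θ₀ : ℝ) (hA : IsSectorial A θ₀)
    (α : ℝ) (hα₀ : 0 < α) (hα₁ : α < 1) (T : ℝ) (hT : 0 < T)
    (g : ℝ → X) (hg : C1OnDomain A g (Set.Ico 0 T)) :
    -- admissible contours exist
    (∃ γ : ℝ → ℂ, IsContour (angleOne α θ₀) γ) ∧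
    ∀ γ : ℝ → ℂ, IsContour (angleOne α θ₀) γ →
      -- the contour integral converges
      (∀ t : ℝ, 0 < t → MeasureTheory.Integrable (contourIntegrand A α γ t)) ∧
      -- the Laplace transform of `P_α` is the resolvent at `z ^ α`
      (∀ z : ℂ, 0 < z.re →
        MeasureTheory.IntegrableOn (fun t : ℝ => Complex.exp (-z * (t : ℂ)) • opP A α γ t)
          (Set.Ioi 0) ∧
        ∫ t in Set.Ioi (0 : ℝ), Complex.exp (-z * (t : ℂ)) • opP A α γ t =
          res A (z ^ (α : ℂ))) ∧
      -- the convolution integral converges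
      (∀ t ∈ Set.Ico (0 : ℝ) T,
        IntervalIntegrable (fun s => opP A α γ (t - s) (g s)) MeasureTheory.volume 0 t) ∧
      -- `P_α * g` is a strong solution, with its regularity up to the initial time
      IsStrongSolution A α T 0 g (convP A α γ g) ∧
      HasStrongRegularity A α (Set.Ico 0 T) 0 (convP A α γ g) ∧
      -- it is the only one, also with Caputo's derivative in its regularized form
      (∀ v : ℝ → X, IsStrongSolution A α T 0 g v →
        Set.EqOn v (convP A α γ g) (Set.Ico 0 T)) ∧
      (∀ v : ℝ → X, IsRegularizedStrongSolution A α T 0 g v →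
        Set.EqOn v (convP A α γ g) (Set.Ico 0 T)) := by
  refine ⟨⟨_, isContour_wedge (angleOne_pos hα₀ hα₁ hA.angle_pos) (angleOne_le α θ₀) one_pos⟩,
    fun γ hγ => ?_⟩
  obtain ⟨C, hL⟩ := hA.hasDecay hα₀ hα₁
  obtain ⟨M, hP⟩ := hA.isFracKernel hα₀ hα₁ hγ
  have hR := hA.isResolventAt (one_mem_sector hA.angle_pos)
  have hg₀ := hg.continuousOnDomain
  have huniq := fun v hv => hP.eqOn_kConv hR hg₀ (v := v) hv
  refine ⟨fun t ht => hL.integrable hγ ht,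
    fun z hz => ⟨hL.integrableOn_laplace hγ hz, hL.laplace_invLaplace hγ hz⟩,
    fun t ht => hP.isKernel.intervalIntegrable ht.1
      (hg₀.2.fst.mono (Icc_subset_Ico_of_mem ht)),
    hP.isStrongSolution hR hg hT, hP.hasStrongRegularity hR hg₀ hT, fun v hv => ?_, huniq⟩
  exact huniq v (hv.isRegularizedStrongSolution hα₀ hα₁
    (hg₀.2.fst.mono Set.Ioo_subset_Ico_self))
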